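/- Let $F$ be a non-archimedean local field with ring of integers $\mathcal O$, uniformiser $\varpi$ and normalised absolute value $|\cdot|$, and let $\psi:F\to S^1$ be an additive character of level one (trivial on $\varpi\mathcal O$, non-trivial on $\mathcal O$). **Supercuspidal datum for $\mathrm{GL}_n(F)$, $n\ge 1$.** It consists of the following. An integer $e\mid n$, with the standard principal hereditary order $\mathfrak A\subset M_n(\mathcal O)$ of period $e$ (block matrices with $e\times e$ blocks of size $n/e$, with entries in $\mathcal O$ on and above the block diagonal and in $\varpi\mathcal O$ below it), its Jacobson radical $\mathfrak B$, and $U_{\mathfrak A}(i)=1+\mathfrak B^i$. An element $\beta\in\mathfrak B^{-j}\setminus\mathfrak B^{-j+1}$ with $j>0$ such that $L=F[\beta]$ is a field of degree $n$ over $F$ with ramification index $e$, $L^\times$ normalises $\mathfrak A$, and $\beta$ is minimal: $v_L(\beta)$ is prime to $e$ and the class of $\varpi^{-v_L(\beta)}\beta^{e}$ generates the residue field of $L$ over that of $F$. Put $U_L(1)=1+\mathfrak p_L$, $H^1=U_L(1)U_{\mathfrak A}(\lfloor j/2\rfloor+1)$, $J^1=U_L(1)U_{\mathfrak A}(\lfloor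 (j+1)/2\rfloor)$ and $J=L^\times U_{\mathfrak A}(\lfloor (j+1)/2\rfloor)$. A character $\theta$ of $H^1$ with $\theta(x)=\psi(\mathrm{Tr}\,\beta(x-1))$ on $U_{\mathfrak A}(\lfloor j/2\rfloor+1)$. A representation $\Lambda$ of $J$ whose restriction to $J^1$ is irreducible and contains $\theta$ on $H^1$. The associated supercuspidal representation is $\text{c-Ind}_J^{\mathrm{GL}_n(F)}\Lambda$, and its normalised depth is $j/e$. For such a datum let $B^1$ be any group with $H^1\le B^1\le J^1$ that polarises $J^1/H^1$ for the pairing $(x,y)\mapsto\psi(\mathrm{Tr}\,\beta(xy-yx))$ (i.e. $B^1$ is its own orthogonal in $J^1$), and let $\tilde\theta$ be any character of $B^1$ extending $\theta$ (if $J^1=H^1$ then $B^1=H^1$ and $\tilde\theta=\theta$). **Parabolic induction.** Let $k\ge1$, $N=n_1+\dots+n_k$ with $n_i\ge 1$, $G=\mathrm{GL}_N(F)$, and let $P$ be any parabolic subgroup of $G$ with Levi subgroup the block diagonal group $M=\prod_i\mathrm{GL}_{n_i}(F)$. Let $\delta_P$ be its modulus character. Let $\sigma_i$ on $V_i$ be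 isomorphic to the supercuspidal representation of $\mathrm{GL}_{n_i}(F)$ given by a datum as above, with choices $B_i^1,\tilde\theta_i$, and let $\sigma=\bigotimes_i\sigma_i$. For $s\in\mathbb R$ let $\pi=\mathrm{Ind}_P^G\sigma$ be the space of functions $f:G\to\bigotimes_iV_i$, right invariant under some open subgroup, with $f(pg)=\delta_P(p)^s\sigma(p)f(g)$ for $p\in P$, on which $G$ acts by right translation ($s=0$ is unnormalised and $s=\tfrac12$ normalised induction). Let $c=\lceil\max_i c(\sigma_i)\rceil$, where $c(\sigma_i)$ is the normalised depth. Assume that $\pi$ has generic induction datum, i.e. moreover $\sigma_i$ and $\sigma_{i'}$ are not equivalent up to an unramified twist for $i\ne i'$, and $|c(\sigma_i)-c|\le A$ for all $i$, where $A$ is a constant. Let $K_\pi$ be the set of all $g\in G$ whose $i$-th diagonal block lies in $B_i^1$, whose blocks above the diagonal have entries in $\varpi^{\lfloor (c+1)/2\rfloor}\mathcal O$, and whose blocks below the diagonal have entries in $\varpi^{\lceil (c+1)/2\rceil}\mathcal O$. **Theorem.** $K_\pi$ is a compact open subgroup of $G$, and the rule $\Theta(g)=\prod_i\tilde\theta_i(b_i)$,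 where $b_1,\dots,b_k$ are the diagonal blocks of $g$, defines a character $\Theta=\bigotimes_i\tilde\theta_i$ of $K_\pi$. There are non-zero vectors $\varphi_i\in V_i$ on which $B_i^1$ acts by $\tilde\theta_i$, and a non-zero $\varphi_0\in\pi$ on which $K_\pi$ acts by $\Theta$, such that the support of $\varphi_0$ is exactly $P\cdot K_\pi$ and $$\varphi_0(px)=\delta_P(p)^{s}\,\Theta(x)\,\sigma(p)\bigotimes_i\varphi_i\qquad(p\in P,\ x\in K_\pi).$$ -/

import Mathlib

open ValuativeRel Matrix
open scoped IsMulCommutative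

namespace MinimalVector

universe u v w

/-! ### Smooth functions on a group and compact induction -/

/-- `f : G → W` is smooth: right invariant under some open subgroup of `G`. -/
def IsSmoothFun {G : Type u} [Group G] [TopologicalSpace G] {W : Type v} (f : G → W) : Prop :=
  ∃ U : Subgroup G, IsOpen (U : Set G) ∧ ∀ g : G, ∀ x ∈ U, f (g * x) = f g

theorem IsSmoothFun.add {G : Type u} [Group G] [TopologicalSpace G] {W : Type v} [Add W]
    {f g : G → W} (hf : IsSmoothFun f) (hg : IsSmoothFun g) : IsSmoothFun (f + g) := by
  obtain ⟨U, hU, hfU⟩ := hf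
  obtain ⟨U', hU', hgU⟩ := hg
  refine ⟨U ⊓ U', hU.inter hU', fun y x hx => ?_⟩
  simp [hfU y x hx.1, hgU y x hx.2]

theorem IsSmoothFun.smul {G : Type u} [Group G] [TopologicalSpace G] {W : Type v} [SMul ℂ W]
    {f : G → W} (c : ℂ) (hf : IsSmoothFun f) : IsSmoothFun (c • f) := by
  obtain ⟨U, hU, hfU⟩ := hf
  exact ⟨U, hU, fun y x hx => by simp [hfU y x hx]⟩

theorem IsSmoothFun.zero {G : Type u} [Group G] [TopologicalSpace G] {W : Type v} [Zero W] :
    IsSmoothFun (0 : G → W) :=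
  ⟨⊤, isOpen_univ, fun _ _ _ => rfl⟩

theorem IsSmoothFun.translate {G : Type u} [Group G] [TopologicalSpace G] [IsTopologicalGroup G]
    {W : Type v} {f : G → W} (h : G) (hf : IsSmoothFun f) : IsSmoothFun (fun x => f (x * h)) := by
  obtain ⟨U, hU, hfU⟩ := hf
  refine ⟨U.comap (MulAut.conj h⁻¹).toMonoidHom, ?_, fun y x hx => ?_⟩
  · have hc : Continuous fun x : G => h⁻¹ * x * h := by fun_prop
    have : ((U.comap (MulAut.conj h⁻¹).toMonoidHom : Subgroup G) : Set G)
        = (fun x : G => h⁻¹ * x * h) ⁻¹' (U : Set G) := by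
      ext x; simp
    rw [this]
    exact hU.preimage hc
  · have hx' : h⁻¹ * x * h ∈ U := by simpa using hx
    have := hfU (y * h) _ hx'
    simpa [mul_assoc] using this

section Induction

variable {G : Type u} [Group G] [TopologicalSpace G] [IsTopologicalGroup G]
  {W : Type v} [AddCommGroup W] [Module ℂ W]

/-- The space of the compactly induced representation `c-Ind_J^G Λ`: smooth functions
`f : G → W` with `f (j g) = Λ(j) f(g)` whose support is contained in `J C` for a compact `C`. -/
def compactIndSpace (J : Subgroup G) (Λ : Representation ℂ J W) : Submodule ℂ (G → W) where
  carrier := {f | (∀ (j : J) (g : G), f (j * g) = Λ j (f g)) ∧ IsSmoothFun f ∧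
    ∃ C : Set G, IsCompact C ∧ ∀ g, f g ≠ 0 → ∃ j ∈ J, ∃ x ∈ C, g = j * x}
  add_mem' := by
    rintro f f' ⟨h1, h2, C, hC, h3⟩ ⟨h1', h2', C', hC', h3'⟩
    refine ⟨fun j g => by simp [h1, h1'], h2.add h2', C ∪ C', hC.union hC', fun g hg => ?_⟩
    by_cases hf : f g = 0
    · have hf' : f' g ≠ 0 := fun h => hg (by simp [hf, h])
      obtain ⟨j, hj, x, hx, e⟩ := h3' g hf'
      exact ⟨j, hj, x, Or.inr hx, e⟩
    · obtain ⟨j, hj, x, hx, e⟩ := h3 g hf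
      exact ⟨j, hj, x, Or.inl hx, e⟩
  zero_mem' := ⟨fun j g => by simp, IsSmoothFun.zero, ∅, isCompact_empty, fun g hg => by simp at hg⟩
  smul_mem' := by
    rintro c f ⟨h1, h2, C, hC, h3⟩
    refine ⟨fun j g => by simp [h1], h2.smul c, C, hC, fun g hg => h3 g fun h => hg ?_⟩
    simp [h]

/-- `c-Ind_J^G Λ`, with `G` acting by right translation. -/
def compactInd (J : Subgroup G) (Λ : Representation ℂ J W) :
    Representation ℂ G (compactIndSpace J Λ) where
  toFun h :=
    { toFun := fun f => ⟨fun x => f.1 (x * h), by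
        obtain ⟨f, h1, h2, C, hC, h3⟩ := f
        refine ⟨fun j g => by simp [h1, mul_assoc], h2.translate h, (fun x => x * h⁻¹) '' C,
          hC.image (by fun_prop), fun g hg => ?_⟩
        obtain ⟨j, hj, x, hx, e⟩ := h3 _ hg
        exact ⟨j, hj, x * h⁻¹, ⟨x, hx, rfl⟩, by rw [← mul_assoc, ← e]; simp⟩⟩
      map_add' := fun _ _ => rfl
      map_smul' := fun _ _ => rfl }
  map_one' := by ext f x; simp
  map_mul' a b := by ext f x; simp [mul_assoc]

end Induction

/-! ### The standard principal hereditary order and its filtration -/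

section Order

variable {F : Type u} [Field F] [ValuativeRel F]

/-- The fractional ideal `ϖ^k 𝒪` of `F`. -/
def fracIdeal (ϖ : 𝒪[F]) (k : ℤ) : Set F := {x | ∃ y : 𝒪[F], x = (ϖ : F) ^ k * y}

theorem fracIdeal_zero_mem (ϖ : 𝒪[F]) (k : ℤ) : (0 : F) ∈ fracIdeal ϖ k := ⟨0, by simp⟩

theorem fracIdeal_add_mem {ϖ : 𝒪[F]} {k : ℤ} {x y : F} (hx : x ∈ fracIdeal ϖ k)
    (hy : y ∈ fracIdeal ϖ k) : x + y ∈ fracIdeal ϖ k := by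
  obtain ⟨a, rfl⟩ := hx
  obtain ⟨b, rfl⟩ := hy
  exact ⟨a + b, by push_cast; ring⟩

theorem fracIdeal_mul_mem {ϖ : 𝒪[F]} (hϖ : ϖ ≠ 0) {k l r : ℤ} (hr : r ≤ k + l) {x y : F}
    (hx : x ∈ fracIdeal ϖ k) (hy : y ∈ fracIdeal ϖ l) : x * y ∈ fracIdeal ϖ r := by
  obtain ⟨a, rfl⟩ := hx
  obtain ⟨b, rfl⟩ := hy
  obtain ⟨d, hd⟩ := Int.eq_ofNat_of_zero_le (sub_nonneg.mpr hr)
  have hϖ' : (ϖ : F) ≠ 0 := by simpa using hϖ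
  refine ⟨ϖ ^ d * a * b, ?_⟩
  have h1 : (ϖ : F) ^ k * (ϖ : F) ^ l = (ϖ : F) ^ r * (ϖ : F) ^ d := by
    rw [← zpow_natCast, ← zpow_add₀ hϖ', ← zpow_add₀ hϖ']
    congr 1
    omega
  push_cast
  linear_combination (a : F) * b * h1

/-- For `e ∣ n` cut the indices `0, …, n - 1` into `e` consecutive blocks of length `n / e`, and let
`[a]` be the block of `a`. The `i`-th power (`i ∈ ℤ`) of the radical of the standard principal
hereditary order consists of the matrices whose `(a, b)` entry lies in
`ϖ ^ ⌈(i + [a] - [b]) / e⌉ 𝒪`. In particular for `i = 0` one gets the order `𝔄` itself (entries in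
`𝒪` on and above the block diagonal, in `ϖ 𝒪` below it), and for `i = 1` its Jacobson radical `𝔅`
(entries in `𝒪` strictly above the block diagonal, in `ϖ 𝒪` elsewhere). -/
def radPow (ϖ : 𝒪[F]) (n e : ℕ) (i : ℤ) : Set (Matrix (Fin n) (Fin n) F) :=
  {x | ∀ a b : Fin n, x a b ∈ fracIdeal ϖ
    ⌈((i + ((a.val / (n / e) : ℕ) : ℤ) - ((b.val / (n / e) : ℕ) : ℤ) : ℤ) : ℚ) / e⌉}

theorem radPow_add_mem {ϖ : 𝒪[F]} {n e : ℕ} {i : ℤ} {x y : Matrix (Fin n) (Fin n) F}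
    (hx : x ∈ radPow ϖ n e i) (hy : y ∈ radPow ϖ n e i) : x + y ∈ radPow ϖ n e i :=
  fun a b => fracIdeal_add_mem (hx a b) (hy a b)

theorem radPow_mul_mem {ϖ : 𝒪[F]} (hϖ : ϖ ≠ 0) {n e : ℕ} {i j r : ℤ} (hr : r ≤ i + j)
    {x y : Matrix (Fin n) (Fin n) F}
    (hx : x ∈ radPow ϖ n e i) (hy : y ∈ radPow ϖ n e j) : x * y ∈ radPow ϖ n e r := by
  intro a b
  rw [Matrix.mul_apply]
  refine Finset.sum_induction _ (· ∈ fracIdeal ϖ _) (fun _ _ => fracIdeal_add_mem)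
    (fracIdeal_zero_mem _ _) fun c _ => fracIdeal_mul_mem hϖ ?_ (hx a c) (hy c b)
  refine le_trans (Int.ceil_mono ?_) (Int.ceil_add_le _ _)
  rw [← add_div]
  refine div_le_div_of_nonneg_right ?_ (Nat.cast_nonneg e)
  have : (r : ℚ) ≤ i + j := by exact_mod_cast hr
  push_cast
  linarith

/-- `U_𝔄(i) = 1 + 𝔅 ^ i`, as a subgroup of `GL_n(F)` (`i ≥ 1`; for `i = 0` it is `𝔄ˣ`). -/
def unitFiltration (ϖ : 𝒪[F]) (hϖ : ϖ ≠ 0) (n e i : ℕ) : Subgroup (GL (Fin n) F) where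
  carrier := {g | (g : Matrix (Fin n) (Fin n) F) - 1 ∈ radPow ϖ n e i ∧
    ((g⁻¹ : GL (Fin n) F) : Matrix (Fin n) (Fin n) F) - 1 ∈ radPow ϖ n e i}
  one_mem' := by
    have : (0 : Matrix (Fin n) (Fin n) F) ∈ radPow ϖ n e i := fun a b => fracIdeal_zero_mem _ _
    simpa using this
  inv_mem' := by
    rintro g ⟨h1, h2⟩
    exact ⟨h2, by simpa using h1⟩
  mul_mem' := by
    have key : ∀ x y : Matrix (Fin n) (Fin n) F, x - 1 ∈ radPow ϖ n e i →
        y - 1 ∈ radPow ϖ n e i → x * y - 1 ∈ radPow ϖ n e i := by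
      intro x y hx hy
      have : x * y - 1 = (x - 1) * (y - 1) + (x - 1) + (y - 1) := by noncomm_ring
      rw [this]
      exact radPow_add_mem (radPow_add_mem (radPow_mul_mem hϖ (by omega) hx hy) hx) hy
    rintro g h ⟨hg, hg'⟩ ⟨hh, hh'⟩
    refine ⟨by simpa using key _ _ hg hh, ?_⟩
    rw [_root_.mul_inv_rev]
    simpa using key _ _ hh' hg'

end Order

/-! ### The field `L = F[β]`, its ring of integers, minimal elements -/

section FieldL

variable {F : Type u} [Field F] [ValuativeRel F] {n : ℕ}

/-- `L = F[β]`, the `F`-subalgebra of `M_n(F)` generated by `β`. -/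
abbrev fieldL (β : Matrix (Fin n) (Fin n) F) : Subalgebra F (Matrix (Fin n) (Fin n) F) :=
  Algebra.adjoin F {β}

/-- `β` as an element of `F[β]`. -/
def gen (β : Matrix (Fin n) (Fin n) F) : fieldL β := ⟨β, Algebra.self_mem_adjoin_singleton F β⟩

/-- `𝒪_L`, the integral closure of `𝒪` in `L = F[β]`. -/
noncomputable abbrev integersL (β : Matrix (Fin n) (Fin n) F) : Subalgebra 𝒪[F] (fieldL β) :=
  integralClosure 𝒪[F] (fieldL β)

/-- The maximal ideal of `𝒪_L`, written as its Jacobson radical (`𝒪_L` is a local ring when `F` is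
a local field and `L` is a field). -/
noncomputable def maxIdealL (β : Matrix (Fin n) (Fin n) F) : Ideal (integersL β) :=
  Ideal.jacobson ⊥

/-- The normalised valuation of `x ∈ L` is `v`: for a generator `π` of the maximal ideal of `𝒪_L`,
`x = u π ^ v` with a unit `u` of `𝒪_L`. -/
def HasValuationL (β : Matrix (Fin n) (Fin n) F) (x : fieldL β) (v : ℤ) : Prop :=
  ∃ (π : integersL β) (u : (integersL β)ˣ), Ideal.span {π} = maxIdealL β ∧
    x * (π : fieldL β) ^ (-v).toNat = ((u : integersL β) : fieldL β) * (π : fieldL β) ^ v.toNat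

/-- The ramification index of `L / F` is `e`: `𝔭_F 𝒪_L = 𝔭_L ^ e`. -/
def HasRamificationIndex (β : Matrix (Fin n) (Fin n) F) (e : ℕ) : Prop :=
  (𝓂[F]).map (algebraMap 𝒪[F] (integersL β)) = maxIdealL β ^ e

/-- `β` is minimal over `F` (where `e = e(L / F)`): `v_L(β)` is prime to `e`, and the class of
`ϖ ^ (-v_L(β)) β ^ e` generates the residue field of `L` over that of `F`. -/
def IsMinimalElement (ϖ : 𝒪[F]) (β : Matrix (Fin n) (Fin n) F) (e : ℕ) : Prop :=
  ∃ v : ℤ, HasValuationL β (gen β) v ∧ IsCoprime v (e : ℤ) ∧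
    ∃ y : integersL β, (y : fieldL β) = ((ϖ : F) ^ (-v)) • gen β ^ e ∧
      Algebra.adjoin 𝒪[F] {Ideal.Quotient.mk (maxIdealL β) y} = ⊤

/-- `Lˣ` as a subgroup of `GL_n(F)`. -/
def torus (β : Matrix (Fin n) (Fin n) F) : Subgroup (GL (Fin n) F) :=
  (fieldL β).toSubmonoid.units

/-- `U_L(1) = 1 + 𝔭_L` as a subgroup of `GL_n(F)`. -/
def unitsL (β : Matrix (Fin n) (Fin n) F) : Subgroup (GL (Fin n) F) where
  carrier := {g |
    (∃ y ∈ maxIdealL β, (g : Matrix (Fin n) (Fin n) F) = 1 + ((y : fieldL β) : Matrix _ _ F)) ∧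
    (∃ y ∈ maxIdealL β, ((g⁻¹ : GL (Fin n) F) : Matrix (Fin n) (Fin n) F)
      = 1 + ((y : fieldL β) : Matrix _ _ F))}
  one_mem' := ⟨⟨0, zero_mem _, by simp⟩, ⟨0, zero_mem _, by simp⟩⟩
  inv_mem' := by
    rintro g ⟨h1, h2⟩
    exact ⟨h2, by simpa using h1⟩
  mul_mem' := by
    have key : ∀ x y : Matrix (Fin n) (Fin n) F,
        (∃ a ∈ maxIdealL β, x = 1 + ((a : fieldL β) : Matrix _ _ F)) →
        (∃ b ∈ maxIdealL β, y = 1 + ((b : fieldL β) : Matrix _ _ F)) →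
        (∃ c ∈ maxIdealL β, x * y = 1 + ((c : fieldL β) : Matrix _ _ F)) := by
      rintro _ _ ⟨a, ha, rfl⟩ ⟨b, hb, rfl⟩
      refine ⟨a + b + a * b, add_mem (add_mem ha hb) (Ideal.mul_mem_right _ _ ha), ?_⟩
      push_cast
      noncomm_ring
    rintro g h ⟨hg, hg'⟩ ⟨hh, hh'⟩
    refine ⟨by simpa using key _ _ hg hh, ?_⟩
    rw [_root_.mul_inv_rev]
    simpa using key _ _ hh' hg'

theorem unitsL_le_torus (β : Matrix (Fin n) (Fin n) F) : unitsL β ≤ torus β := by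
  rintro g ⟨⟨y, -, hy⟩, ⟨z, -, hz⟩⟩
  refine (Submonoid.mem_units_iff _ _).mpr ⟨?_, ?_⟩
  · rw [hy]
    exact (fieldL β).add_mem (one_mem (fieldL β)) (y : fieldL β).2
  · rw [hz]
    exact (fieldL β).add_mem (one_mem (fieldL β)) (z : fieldL β).2

end FieldL

/-! ### Supercuspidal representations with generic induction datum -/

section Supercuspidal

variable {F : Type u} [Field F] [ValuativeRel F]

/-- `ψ` has level one: it is trivial on the maximal ideal of `𝒪`, but not on `𝒪`. -/
def IsLevelOne (ψ : AddChar F Circle) : Prop :=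
  (∀ x ∈ 𝓂[F], ψ (x : F) = 1) ∧ ∃ x : 𝒪[F], ψ (x : F) ≠ 1

/-- `H¹(β, 𝔄) = U_L(1) U_𝔄(⌊j/2⌋ + 1)`. -/
def groupH1 (ϖ : 𝒪[F]) (hϖ : ϖ ≠ 0) {n : ℕ} (e : ℕ) (β : Matrix (Fin n) (Fin n) F) (j : ℕ) :
    Subgroup (GL (Fin n) F) :=
  unitsL β ⊔ unitFiltration ϖ hϖ n e (j / 2 + 1)

/-- `J¹(β, 𝔄) = U_L(1) U_𝔄(⌊(j+1)/2⌋)`. -/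
def groupJ1 (ϖ : 𝒪[F]) (hϖ : ϖ ≠ 0) {n : ℕ} (e : ℕ) (β : Matrix (Fin n) (Fin n) F) (j : ℕ) :
    Subgroup (GL (Fin n) F) :=
  unitsL β ⊔ unitFiltration ϖ hϖ n e ((j + 1) / 2)

/-- `J(β, 𝔄) = Lˣ U_𝔄(⌊(j+1)/2⌋)`. -/
def groupJ (ϖ : 𝒪[F]) (hϖ : ϖ ≠ 0) {n : ℕ} (e : ℕ) (β : Matrix (Fin n) (Fin n) F) (j : ℕ) :
    Subgroup (GL (Fin n) F) :=
  torus β ⊔ unitFiltration ϖ hϖ n e ((j + 1) / 2)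

theorem groupJ1_le_groupJ (ϖ : 𝒪[F]) (hϖ : ϖ ≠ 0) {n : ℕ} (e : ℕ)
    (β : Matrix (Fin n) (Fin n) F) (j : ℕ) : groupJ1 ϖ hϖ e β j ≤ groupJ ϖ hϖ e β j :=
  sup_le_sup_right (unitsL_le_torus β) _

/-- The data from which a supercuspidal representation of `GL_n(F)` with generic induction datum is
built: a minimal element `β`, a simple character `θ` of `H¹`, and a representation `Λ` of `J` whose
restriction to `J¹` is the irreducible representation `η(θ)` containing `θ`. -/
structure SupercuspidalDatum (ϖ : 𝒪[F]) (hϖ : ϖ ≠ 0) (ψ : AddChar F Circle) (n : ℕ) where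
  /-- The period of the hereditary order `𝔄`. -/
  e : ℕ
  e_dvd : e ∣ n
  β : Matrix (Fin n) (Fin n) F
  isField : IsField (fieldL β)
  finrank_eq : Module.finrank F (fieldL β) = n
  /-- `Lˣ` normalises `𝔄`. -/
  normalises : ∀ l ∈ torus β, ∀ x ∈ radPow ϖ n e 0,
    (l : Matrix (Fin n) (Fin n) F) * x * ((l⁻¹ : GL (Fin n) F) : Matrix (Fin n) (Fin n) F)
      ∈ radPow ϖ n e 0
  ramification : HasRamificationIndex β e
  minimal : IsMinimalElement ϖ β e
  /-- The depth `j = -v_𝔄(β) > 0`. -/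
  depth : ℕ
  depth_pos : 0 < depth
  mem_radPow : β ∈ radPow ϖ n e (-(depth : ℤ))
  notMem_radPow : β ∉ radPow ϖ n e (-(depth : ℤ) + 1)
  /-- A simple character of `H¹` associated to `β`. -/
  θ : groupH1 ϖ hϖ e β depth →* ℂˣ
  θ_eq : ∀ x : groupH1 ϖ hϖ e β depth,
    (x : GL (Fin n) F) ∈ unitFiltration ϖ hϖ n e (depth / 2 + 1) →
      (θ x : ℂ) = ψ (β * (((x : GL (Fin n) F) : Matrix (Fin n) (Fin n) F) - 1)).trace
  W : Type w
  [addCommGroupW : AddCommGroup W]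
  [moduleW : Module ℂ W]
  Λ : Representation ℂ (groupJ ϖ hϖ e β depth) W
  irreducible :
    Representation.IsIrreducible (Λ.comp (Subgroup.inclusion (groupJ1_le_groupJ ϖ hϖ e β depth)))
  contains_θ : ∃ x : W, x ≠ 0 ∧ ∀ (h : groupJ ϖ hϖ e β depth)
    (hh : (h : GL (Fin n) F) ∈ groupH1 ϖ hϖ e β depth), Λ h x = (θ ⟨h, hh⟩ : ℂ) • x

attribute [instance] SupercuspidalDatum.addCommGroupW SupercuspidalDatum.moduleW

namespace SupercuspidalDatum

variable {ϖ : 𝒪[F]} {hϖ : ϖ ≠ 0} {ψ : AddChar F Circle} {n : ℕ}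

/-- The normalised depth `-v_𝔄(β) / e`. -/
noncomputable def normalisedDepth (D : SupercuspidalDatum.{u, w} ϖ hϖ ψ n) : ℝ := D.depth / D.e

/-- `H¹` -/
abbrev H1 (D : SupercuspidalDatum.{u, w} ϖ hϖ ψ n) : Subgroup (GL (Fin n) F) :=
  groupH1 ϖ hϖ D.e D.β D.depth

/-- `J¹` -/
abbrev J1 (D : SupercuspidalDatum.{u, w} ϖ hϖ ψ n) : Subgroup (GL (Fin n) F) :=
  groupJ1 ϖ hϖ D.e D.β D.depth

/-- `J` -/
abbrev J (D : SupercuspidalDatum.{u, w} ϖ hϖ ψ n) : Subgroup (GL (Fin n) F) :=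
  groupJ ϖ hϖ D.e D.β D.depth

/-- The supercuspidal representation `c-Ind_J^G Λ` of `GL_n(F)`. -/
def rep [TopologicalSpace F] [IsTopologicalRing F] (D : SupercuspidalDatum.{u, w} ϖ hϖ ψ n) :
    Representation ℂ (GL (Fin n) F) (compactIndSpace D.J D.Λ) :=
  compactInd D.J D.Λ

/-- A choice of `B¹` with `H¹ ≤ B¹ ≤ J¹` polarising `J¹ / H¹` under the pairing
`(x, y) ↦ ψ(Tr β(xy - yx))`, i.e. `B¹` is its own orthogonal in `J¹`, and of a character `θ̃` of
`B¹` extending `θ`. -/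
structure Polarisation (D : SupercuspidalDatum.{u, w} ϖ hϖ ψ n) where
  B1 : Subgroup (GL (Fin n) F)
  H1_le : D.H1 ≤ B1
  le_J1 : B1 ≤ D.J1
  self_orthogonal : ∀ x ∈ D.J1, x ∈ B1 ↔ ∀ y ∈ B1,
    ψ (D.β * ((x : Matrix (Fin n) (Fin n) F) * (y : Matrix (Fin n) (Fin n) F)
      - (y : Matrix (Fin n) (Fin n) F) * (x : Matrix (Fin n) (Fin n) F))).trace = 1
  θt : B1 →* ℂˣ
  extends_θ : ∀ x : D.H1, θt ⟨x, H1_le x.2⟩ = D.θ x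

end SupercuspidalDatum

/-- `σ` and `τ` are equivalent up to an unramified twist: `n = m` and `σ ≅ τ ⊗ (χ ∘ det)` with a
character `χ` of `Fˣ` trivial on the units of `𝒪`. -/
def EquivUpToUnramifiedTwist {n m : ℕ} {V : Type v} [AddCommGroup V] [Module ℂ V]
    {V' : Type w} [AddCommGroup V'] [Module ℂ V'] (σ : Representation ℂ (GL (Fin n) F) V)
    (τ : Representation ℂ (GL (Fin m) F) V') : Prop :=
  ∃ (r : Fin n ≃ Fin m) (χ : Fˣ →* ℂˣ) (T : V ≃ₗ[ℂ] V'),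
    (∀ x : Fˣ, valuation F (x : F) = 1 → χ x = 1) ∧
    ∀ (g : GL (Fin n) F) (x : V), T (σ g x) =
      (χ (Matrix.GeneralLinearGroup.det g) : ℂ) •
        τ (Units.mapEquiv (Matrix.reindexAlgEquiv F F r).toMulEquiv g) (T x)

end Supercuspidal

/-! ### Parabolic induction -/

section Parabolic

variable {F : Type u} [Field F] [ValuativeRel F] [TopologicalSpace F]
  [IsNonarchimedeanLocalField F] {k : ℕ} {n : Fin k → ℕ}

/-- The normalised absolute value on `Fˣ`: `|ϖ| = 1 / q` for a uniformiser `ϖ`, where `q` is the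
cardinality of the residue field. -/
noncomputable def normAbs (x : Fˣ) : ℝ :=
  (Nat.card 𝓀[F] : ℝ) ^
    (WithZero.log (IsNonarchimedeanLocalField.valueGroupWithZeroIsoInt F (valuation F x)) : ℤ)

/-- `GL_N(F)` with `N = n 0 + ⋯ + n (k - 1)`; the rows and columns are indexed by pairs consisting
of a block `i` and a position in the block `i`. -/
abbrev BlockGL (F : Type u) [Field F] {k : ℕ} (n : Fin k → ℕ) : Type u :=
  GL (Σ i : Fin k, Fin (n i)) F

/-- The `(i, j)` block of `g`, of size `n i × n j`. -/
def block (g : BlockGL F n) (i j : Fin k) : Matrix (Fin (n i)) (Fin (n j)) F :=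
  Matrix.of fun a b => (g : Matrix (Σ i, Fin (n i)) (Σ i, Fin (n i)) F) ⟨i, a⟩ ⟨j, b⟩

/-- The parabolic subgroup with Levi subgroup `M = ∏ GL_{n i}` (block diagonal matrices) attached
to an ordering `w` of the blocks; for `w = 1` it is the group of block upper triangular matrices,
and every parabolic subgroup with Levi subgroup `M` is of this form. -/
def parabolic (F : Type u) [Field F] {k : ℕ} (n : Fin k → ℕ) (w : Equiv.Perm (Fin k)) :
    Subgroup (BlockGL F n) where
  carrier := {g | (g : Matrix (Σ i, Fin (n i)) (Σ i, Fin (n i)) F).BlockTriangular (fun a => w a.1) ∧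
    ((g⁻¹ : BlockGL F n) : Matrix (Σ i, Fin (n i)) (Σ i, Fin (n i)) F).BlockTriangular (fun a => w a.1)}
  one_mem' := by
    refine ⟨?_, ?_⟩
    · exact Matrix.blockTriangular_one
    · rw [inv_one]; exact Matrix.blockTriangular_one
  inv_mem' := by
    rintro g ⟨h1, h2⟩
    exact ⟨h2, by simpa using h1⟩
  mul_mem' := by
    rintro g h ⟨hg, hg'⟩ ⟨hh, hh'⟩
    refine ⟨by simpa using hg.mul hh, ?_⟩
    rw [_root_.mul_inv_rev]
    simpa using hh'.mul hg'

/-- `m ∈ M` is the Levi component of `p`: the diagonal blocks of `p` are the `m i`. -/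
def HasLeviPart (p : BlockGL F n) (m : ∀ i, GL (Fin (n i)) F) : Prop :=
  ∀ i, block p i i = (m i : Matrix (Fin (n i)) (Fin (n i)) F)

/-- `δ_P(m) ^ s`, where `δ_P(m) = |det (Ad m | Lie N)|` is the modulus character of the parabolic
subgroup with unipotent radical `N`: the product over the blocks `(i, j)` of `N` of
`|det m_i| ^ n_j |det m_j| ^ (-n_i)`. -/
noncomputable def modulusPow (w : Equiv.Perm (Fin k)) (s : ℝ) (m : ∀ i, GL (Fin (n i)) F) : ℝ :=
  (∏ i : Fin k, ∏ j : Fin k, if w i < w j then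
    normAbs (Matrix.GeneralLinearGroup.det (m i)) ^ n j /
      normAbs (Matrix.GeneralLinearGroup.det (m j)) ^ n i else 1) ^ s

variable {V : Fin k → Type v} [∀ i, AddCommGroup (V i)] [∀ i, Module ℂ (V i)]

/-- The space of `Ind_P^G σ` with `σ = ⨂ σ i`: smooth functions `f : G → ⨂ V i` with
`f (p g) = δ_P(p) ^ s σ(p) f(g)`, where `σ` is inflated from `M` to `P`. The choice `s = 0` is
unnormalised and `s = 1/2` is normalised induction. -/
def parabolicIndSpace (w : Equiv.Perm (Fin k)) (s : ℝ)
    (σ : ∀ i, Representation ℂ (GL (Fin (n i)) F) (V i)) :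
    Submodule ℂ (BlockGL F n → PiTensorProduct ℂ V) where
  carrier := {f | (∀ p ∈ parabolic F n w, ∀ m, HasLeviPart p m → ∀ g,
      f (p * g) = (modulusPow w s m : ℂ) • PiTensorProduct.map (fun i => σ i (m i)) (f g)) ∧
    IsSmoothFun f}
  add_mem' := by
    rintro f f' ⟨h1, h2⟩ ⟨h1', h2'⟩
    exact ⟨fun p hp m hm g => by simp [h1 p hp m hm, h1' p hp m hm], h2.add h2'⟩
  zero_mem' := ⟨fun p hp m hm g => by simp, IsSmoothFun.zero⟩
  smul_mem' := by
    rintro c f ⟨h1, h2⟩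
    exact ⟨fun p hp m hm g => by
      simp only [Pi.smul_apply, h1 p hp m hm, map_smul]; rw [smul_comm], h2.smul c⟩

/-- `Ind_P^G σ`, with `G` acting by right translation. -/
def parabolicInd (w : Equiv.Perm (Fin k)) (s : ℝ)
    (σ : ∀ i, Representation ℂ (GL (Fin (n i)) F) (V i)) :
    Representation ℂ (BlockGL F n) (parabolicIndSpace w s σ) where
  toFun h :=
    { toFun := fun f => ⟨fun x => f.1 (x * h), by
        obtain ⟨f, h1, h2⟩ := f
        exact ⟨fun p hp m hm g => by simp [h1 p hp m hm, mul_assoc], h2.translate h⟩⟩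
      map_add' := fun _ _ => rfl
      map_smul' := fun _ _ => rfl }
  map_one' := by ext f x; simp
  map_mul' a b := by ext f x; simp [mul_assoc]

variable {ϖ : 𝒪[F]} {hϖ : ϖ ≠ 0} {ψ : AddChar F Circle}

/-- `c(π) = ⌈max_i c(σ i)⌉`, where `c(σ i)` is the normalised depth of `σ i`. -/
noncomputable def inducedDepth (D : ∀ i, SupercuspidalDatum.{u, w} ϖ hϖ ψ (n i)) : ℕ :=
  ⌈⨆ i, (D i).normalisedDepth⌉₊

/-- `π = Ind_P^G (⨂ σ i)` has generic induction datum: `σ i` is the supercuspidal representation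
attached to the datum `D i`, distinct `σ i` are not equivalent up to an unramified twist, and their
normalised depths agree with `c(π)` up to the constant `A`. -/
structure HasGenericInductionDatum (D : ∀ i, SupercuspidalDatum.{u, w} ϖ hϖ ψ (n i))
    (σ : ∀ i, Representation ℂ (GL (Fin (n i)) F) (V i)) (A : ℝ) : Prop where
  equiv : ∀ i, Nonempty (Representation.Equiv (σ i) (D i).rep)
  not_twist : ∀ i j, i ≠ j → ¬ EquivUpToUnramifiedTwist (σ i) (σ j)
  depth : ∀ i, |(D i).normalisedDepth - inducedDepth D| ≤ A

/-- The set `K_π` of all `g ∈ GL_N(F)` whose `i`-th diagonal block lies in `B¹_i`, whose blocks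
above the diagonal have entries in `ϖ ^ ⌊(c+1)/2⌋ 𝒪`, and whose blocks below the diagonal have
entries in `ϖ ^ ⌈(c+1)/2⌉ 𝒪`, where `c = c(π)`. -/
def setK {D : ∀ i, SupercuspidalDatum.{u, w} ϖ hϖ ψ (n i)} (B : ∀ i, (D i).Polarisation) :
    Set (BlockGL F n) :=
  {g | (∀ i, ∃ b ∈ (B i).B1, block g i i = (b : Matrix (Fin (n i)) (Fin (n i)) F)) ∧
    (∀ i j, i < j → ∀ a b, block g i j a b ∈ fracIdeal ϖ ⌊((inducedDepth D : ℚ) + 1) / 2⌋) ∧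
    (∀ i j, j < i → ∀ a b, block g i j a b ∈ fracIdeal ϖ ⌈((inducedDepth D : ℚ) + 1) / 2⌉)}

end Parabolic

end MinimalVector

/-!
Everything about a single block rests on the lattice chain on which the
hereditary order `𝔄` acts. An element of `GL_n(F)` normalising `𝔄` permutes the lattices of the
chain, hence shifts it by an integer (`exists_hasShift`); so the non-zero elements of `L = F[β]`
have a well defined shift, the integers and the maximal ideal of `L` are cut out of `L` by `𝔄` and
its radical (`isIntegral_iff`, `mem_maxIdealL_iff`), and `v_L(β) = -j` (`valuation_β`).

If the depth `j` is odd then `H¹ = J¹`, and the vector of `Λ` containing `θ` is the required one. If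
`j = 2m`, the character `θ` is invariant under `J¹`, so by irreducibility `H¹` acts on `Λ` through
`θ` (`Λ_apply_of_mem_H1`), and the pairing `(x, y) ↦ θ ⁅x, y⁆` of `J¹ / H¹` is nondegenerate
(`mem_H1_of_forall_commutator`): by duality with respect to `ψ ∘ Tr`, an element `1 + z` of the
radical satisfies `β z - z β ∈ 𝔅 ^ (1 - m)`, and then `z` is congruent to an element of `L` modulo
`𝔅 ^ (m + 1)` (`exists_mem_fieldL_sub_mem`). For the latter subtract from `z` an element of `L` so
that a generator of a lattice of the chain over `𝒪_L` is killed. The elements of `L` commuting with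
`z` to first order contain `β` and `ϖ`, hence, by minimality of `β`, an element of shift one and
representatives of the residue field, hence everything; so `z` is small on the whole chain.
Nondegeneracy makes the average of `θ̃(b)⁻¹ Λ(b)` over `B¹ / H¹` non-zero, by linear independence of
characters (`exists_eigenvector_of_commutator_nondegenerate`), which gives a vector of `Λ` on which
`B¹` acts by `θ̃`. The function on `GL_n(F)` supported on `J` which it defines transports to a vector
`φ_i` of `V_i` (`exists_eigenvector_of_equiv`).

For the induced representation, write an element of `K_π` as a block diagonal matrix with entries
in the `B¹_i` plus an error with entries in the ideals prescribed by `blockExponent`, where the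
exponent on the diagonal is `c + 1`. Since `⌊(c+1)/2⌋ + ⌈(c+1)/2⌉ = c + 1`, these errors are closed
under multiplication and the formation of `(1 + x)⁻¹ - 1` (`entrySet_mul_mem`,
`exists_unit_of_mem_entrySet`), while a perturbation of an element of `B¹_i` modulo `ϖ ^ (c + 1)`
remains in `B¹_i` and does not change `θ̃_i`, because `c` is at least the normalised depth
(`Polarisation.exists_eq_add`). So `K_π` is a group, compact and open, and `Θ` is a character
(`groupK`, `exists_charK`).
An element of `P ∩ K_π` has Levi component in `∏ B¹_i`, on which `δ_P` is trivial and which acts on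
`⨂ φ_i` through `Θ` (`parabolicAction_tprod_of_mem_setK`); hence the formula for `φ₀` on `P K_π`,
extended by zero, is consistent (`exists_function_of_compatible`), and the function is smooth since
the kernel of `Θ` is open.
-/

open scoped commutatorElement

namespace MinimalVector

universe u v w

/-! ### Fractional ideals of a local field -/

section FracIdeal

variable {F : Type u} [Field F] [ValuativeRel F]

theorem fracIdeal_neg_mem {ϖ : 𝒪[F]} {k : ℤ} {x : F} (hx : x ∈ fracIdeal ϖ k) :
    -x ∈ fracIdeal ϖ k := by
  obtain ⟨a, rfl⟩ := hx
  exact ⟨-a, by push_cast; ring⟩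

theorem mem_fracIdeal_zero {ϖ : 𝒪[F]} {x : F} : x ∈ fracIdeal ϖ 0 ↔ x ∈ 𝒪[F] :=
  ⟨by rintro ⟨y, rfl⟩; simp, fun h => ⟨⟨x, h⟩, by simp⟩⟩

theorem zpow_mem_fracIdeal (ϖ : 𝒪[F]) (k : ℤ) : (ϖ : F) ^ k ∈ fracIdeal ϖ k := ⟨1, by simp⟩

theorem fracIdeal_anti {ϖ : 𝒪[F]} (hϖ : ϖ ≠ 0) {k l : ℤ} (h : l ≤ k) {x : F}
    (hx : x ∈ fracIdeal ϖ k) : x ∈ fracIdeal ϖ l := by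
  simpa using fracIdeal_mul_mem hϖ (r := l) (l := 0) (by simpa) hx
    (mem_fracIdeal_zero.2 (one_mem _))

theorem fracIdeal_sub_mem {ϖ : 𝒪[F]} {k : ℤ} {x y : F} (hx : x ∈ fracIdeal ϖ k)
    (hy : y ∈ fracIdeal ϖ k) : x - y ∈ fracIdeal ϖ k := by
  rw [sub_eq_add_neg]
  exact fracIdeal_add_mem hx (fracIdeal_neg_mem hy)

theorem fracIdeal_sum_mem {ϖ : 𝒪[F]} {k : ℤ} {ι : Type*} {s : Finset ι} {f : ι → F}
    (h : ∀ i ∈ s, f i ∈ fracIdeal ϖ k) : ∑ i ∈ s, f i ∈ fracIdeal ϖ k :=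
  Finset.sum_induction _ (· ∈ fracIdeal ϖ k) (fun _ _ => fracIdeal_add_mem)
    (fracIdeal_zero_mem _ _) h

theorem zpow_mul_unit_mem_fracIdeal {ϖ : 𝒪[F]} (hϖ : Irreducible ϖ) {k l : ℤ} {u : 𝒪[F]ˣ} :
    (ϖ : F) ^ k * ((u : 𝒪[F]) : F) ∈ fracIdeal ϖ l ↔ l ≤ k := by
  have h0 : (ϖ : F) ≠ 0 := by simpa using hϖ.ne_zero
  constructor
  · rintro ⟨y, hy⟩
    by_contra! hlt
    obtain ⟨d, hd⟩ := Int.eq_ofNat_of_zero_le (sub_nonneg.mpr hlt.le)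
    have h1 : (ϖ : F) ^ l = (ϖ : F) ^ k * (ϖ : F) ^ d := by
      rw [← zpow_natCast, ← zpow_add₀ h0]
      congr 1
      omega
    rw [h1, mul_assoc, mul_right_inj' (zpow_ne_zero _ h0)] at hy
    have hy' : (u : 𝒪[F]) = ϖ ^ d * y := by exact_mod_cast hy
    have hd0 : d ≠ 0 := by omega
    exact hϖ.not_isUnit (isUnit_of_dvd_unit
      ((dvd_pow_self ϖ hd0).trans ⟨y, hy'⟩) u.isUnit)
  · intro h
    exact fracIdeal_anti hϖ.ne_zero h ⟨u, rfl⟩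

theorem zpow_mem_fracIdeal_iff {ϖ : 𝒪[F]} (hϖ : Irreducible ϖ) {k l : ℤ} :
    (ϖ : F) ^ k ∈ fracIdeal ϖ l ↔ l ≤ k := by
  simpa using zpow_mul_unit_mem_fracIdeal hϖ (k := k) (l := l) (u := 1)

theorem exists_zpow_mul_unit [TopologicalSpace F] [IsNonarchimedeanLocalField F] {ϖ : 𝒪[F]}
    (hϖ : Irreducible ϖ) {x : F} (hx : x ≠ 0) :
    ∃ (k : ℤ) (u : 𝒪[F]ˣ), x = (ϖ : F) ^ k * ((u : 𝒪[F]) : F) := by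
  have h0 : (ϖ : F) ≠ 0 := by simpa using hϖ.ne_zero
  obtain ⟨a, b, hb, rfl⟩ := IsFractionRing.div_surjective (A := 𝒪[F]) x
  have hb0 : b ≠ 0 := nonZeroDivisors.ne_zero hb
  have ha0 : a ≠ 0 := by rintro rfl; simp at hx
  obtain ⟨m, s, rfl⟩ := IsDiscreteValuationRing.eq_unit_mul_pow_irreducible ha0 hϖ
  obtain ⟨l, t, rfl⟩ := IsDiscreteValuationRing.eq_unit_mul_pow_irreducible hb0 hϖ
  refine ⟨m - l, s * t⁻¹, ?_⟩
  have ht : (((t⁻¹ : 𝒪[F]ˣ) : 𝒪[F]) : F) * ((t : 𝒪[F]) : F) = 1 := by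
    exact_mod_cast congrArg (Subtype.val) (Units.inv_mul t)
  have ht0 : ((t : 𝒪[F]) : F) ≠ 0 := right_ne_zero_of_mul_eq_one ht
  have hal : ∀ z : 𝒪[F], algebraMap 𝒪[F] F z = z := fun _ => rfl
  rw [hal, hal]
  rw [zpow_sub₀ h0]
  push_cast
  rw [zpow_natCast, zpow_natCast]
  field_simp
  linear_combination -ht

theorem maximalIdeal_eq_span [TopologicalSpace F] [IsNonarchimedeanLocalField F] {ϖ : 𝒪[F]}
    (hϖ : Irreducible ϖ) : 𝓂[F] = Ideal.span {ϖ} := hϖ.maximalIdeal_eq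

theorem isOpen_fracIdeal [TopologicalSpace F] [IsNonarchimedeanLocalField F] {ϖ : 𝒪[F]}
    (hϖ : ϖ ≠ 0) (k : ℤ) : IsOpen (fracIdeal ϖ k) := by
  have h0 : (ϖ : F) ≠ 0 := by simpa using hϖ
  have hO : IsOpen (𝒪[F] : Set F) := by
    let := IsTopologicalAddGroup.rightUniformSpace F
    have := isUniformAddGroup_of_addCommGroup (G := F)
    exact Valued.isOpen_integer F
  have : fracIdeal ϖ k = (fun x => (ϖ : F) ^ (-k) * x) ⁻¹' (𝒪[F] : Set F) := by
    ext x
    simp only [Set.mem_preimage, SetLike.mem_coe]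
    constructor
    · rintro ⟨y, rfl⟩
      rw [← mul_assoc, ← zpow_add₀ h0]
      simp
    · intro h
      refine ⟨⟨_, h⟩, ?_⟩
      simp only
      rw [← mul_assoc, ← zpow_add₀ h0]
      simp
  rw [this]
  exact hO.preimage (by fun_prop)

theorem ceil_div_le_iff {e : ℕ} (he : 0 < e) {z k : ℤ} : ⌈(z : ℚ) / e⌉ ≤ k ↔ z ≤ e * k := by
  have he' : (0 : ℚ) < e := by exact_mod_cast he
  rw [Int.ceil_le, div_le_iff₀ he']
  constructor <;> intro h
  · have : (z : ℚ) ≤ ((e * k : ℤ) : ℚ) := by push_cast; linarith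
    exact_mod_cast this
  · have : (z : ℚ) ≤ ((e * k : ℤ) : ℚ) := by exact_mod_cast h
    push_cast at this
    linarith

/-- The exponents of the entries of the dual lattice of `radPow`: the dual of `ϖ ^ k 𝒪` with respect
to a character of level one is `ϖ ^ (1 - k) 𝒪`. -/
theorem one_sub_ceil_div {e : ℕ} (he : 0 < e) (z : ℤ) :
    ⌈((1 - z : ℤ) : ℚ) / e⌉ = 1 - ⌈(z : ℚ) / e⌉ := by
  have h1 := fun k => ceil_div_le_iff he (z := z) (k := k)
  set c := ⌈(z : ℚ) / e⌉
  have hc : z ≤ e * c := (h1 c).1 le_rfl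
  have hc' : ¬ z ≤ e * (c - 1) := fun h => by have := (h1 _).2 h; omega
  apply le_antisymm
  · rw [ceil_div_le_iff he]
    nlinarith
  · by_contra! h
    have := (ceil_div_le_iff he (z := 1 - z) (k := 1 - c - 1)).1 (by omega)
    nlinarith

end FracIdeal

/-! ### The lattice chain of the hereditary order -/

section Chain

variable {F : Type u} [Field F] [ValuativeRel F]

/-- The lattice chain of the standard hereditary order: the `a`-th coordinate of a vector of the
`r`-th lattice lies in `ϖ ^ ⌈(r + [a]) / e⌉ 𝒪`, where `[a]` is the block of `a`. -/
def chain (ϖ : 𝒪[F]) (n e : ℕ) (r : ℤ) : Set (Fin n → F) :=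
  {v | ∀ a : Fin n, v a ∈ fracIdeal ϖ ⌈((r + ((a.val / (n / e) : ℕ) : ℤ) : ℤ) : ℚ) / e⌉}

variable {ϖ : 𝒪[F]} {n e : ℕ}

theorem block_lt (hn : 0 < n) (he : e ∣ n) (a : Fin n) : a.val / (n / e) < e := by
  rw [Nat.div_lt_iff_lt_mul (Nat.div_pos (Nat.le_of_dvd hn he) (Nat.pos_of_dvd_of_pos he hn)),
    Nat.mul_div_cancel' he]
  exact a.2

theorem exists_block_eq (hn : 0 < n) (he : e ∣ n) {c : ℕ} (hc : c < e) :
    ∃ a : Fin n, a.val / (n / e) = c := by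
  have hp := Nat.div_pos (Nat.le_of_dvd hn he) (Nat.pos_of_dvd_of_pos he hn)
  refine ⟨⟨c * (n / e), ?_⟩, Nat.mul_div_cancel _ hp⟩
  calc c * (n / e) < e * (n / e) := Nat.mul_lt_mul_of_pos_right hc hp
    _ = n := Nat.mul_div_cancel' he

theorem ceil_div_mono {z z' : ℤ} (h : z ≤ z') : ⌈(z : ℚ) / e⌉ ≤ ⌈(z' : ℚ) / e⌉ := by
  apply Int.ceil_mono
  have : (z : ℚ) ≤ z' := by exact_mod_cast h
  gcongr

theorem ceil_div_add_le (z z' : ℤ) :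
    ⌈((z + z' : ℤ) : ℚ) / e⌉ ≤ ⌈(z : ℚ) / e⌉ + ⌈(z' : ℚ) / e⌉ := by
  refine le_trans (Int.ceil_mono ?_) (Int.ceil_add_le _ _)
  rw [← add_div]
  push_cast
  rfl

theorem chain_anti (hϖ : ϖ ≠ 0) {r r' : ℤ} (h : r' ≤ r) {v : Fin n → F}
    (hv : v ∈ chain ϖ n e r) : v ∈ chain ϖ n e r' :=
  fun a => fracIdeal_anti hϖ (ceil_div_mono (by omega)) (hv a)

theorem mulVec_mem_chain (hϖ : ϖ ≠ 0) {i r s : ℤ} (hs : s ≤ i + r)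
    {x : Matrix (Fin n) (Fin n) F} {v : Fin n → F}
    (hx : x ∈ radPow ϖ n e i) (hv : v ∈ chain ϖ n e r) : x *ᵥ v ∈ chain ϖ n e s := by
  intro a
  rw [Matrix.mulVec, dotProduct]
  refine fracIdeal_sum_mem fun b _ => fracIdeal_mul_mem hϖ ?_ (hx a b) (hv b)
  exact (ceil_div_mono (by omega)).trans (ceil_div_add_le _ _)

theorem single_mem_chain {r : ℤ} {t : ℤ} {a : Fin n} {c : F} (he : 0 < e) (hϖ : ϖ ≠ 0)
    (hr : r + ((a.val / (n / e) : ℕ) : ℤ) ≤ e * t) (hc : c ∈ fracIdeal ϖ t) :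
    Pi.single a c ∈ chain ϖ n e r := by
  intro b
  obtain rfl | hab := eq_or_ne b a
  · rw [Pi.single_eq_same]
    exact fracIdeal_anti hϖ ((ceil_div_le_iff he).2 hr) hc
  · rw [Pi.single_eq_of_ne hab]
    exact fracIdeal_zero_mem _ _

/-- The powers of the radical are determined by their action on the lattice chain. -/
theorem mem_radPow_of_forall_chain (he : 0 < e) (hϖ : ϖ ≠ 0) {i : ℤ}
    {x : Matrix (Fin n) (Fin n) F}
    (h : ∀ r, ∀ v ∈ chain ϖ n e r, x *ᵥ v ∈ chain ϖ n e (r + i)) : x ∈ radPow ϖ n e i := by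
  intro a b
  have h1 : Pi.single b (1 : F) ∈ chain ϖ n e (-((b.val / (n / e) : ℕ) : ℤ)) :=
    single_mem_chain (t := 0) he hϖ (by simp) (mem_fracIdeal_zero.2 (one_mem _))
  have h2 := h _ _ h1 a
  rw [Matrix.mulVec_single_one, Matrix.col_apply] at h2
  convert h2 using 4
  ring_nf

theorem radPow_anti (hϖ : ϖ ≠ 0) {i i' : ℤ} (h : i' ≤ i) {x : Matrix (Fin n) (Fin n) F}
    (hx : x ∈ radPow ϖ n e i) : x ∈ radPow ϖ n e i' :=
  fun a b => fracIdeal_anti hϖ (ceil_div_mono (by omega)) (hx a b)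

theorem zero_mem_radPow {i : ℤ} : (0 : Matrix (Fin n) (Fin n) F) ∈ radPow ϖ n e i :=
  fun _ _ => fracIdeal_zero_mem _ _

theorem radPow_neg_mem {i : ℤ} {x : Matrix (Fin n) (Fin n) F} (hx : x ∈ radPow ϖ n e i) :
    -x ∈ radPow ϖ n e i := fun a b => fracIdeal_neg_mem (hx a b)

theorem radPow_sub_mem {i : ℤ} {x y : Matrix (Fin n) (Fin n) F} (hx : x ∈ radPow ϖ n e i)
    (hy : y ∈ radPow ϖ n e i) : x - y ∈ radPow ϖ n e i :=
  fun a b => fracIdeal_sub_mem (hx a b) (hy a b)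

theorem smul_mem_radPow (he : 0 < e) (hϖ : ϖ ≠ 0) {i j t : ℤ} {c : F}
    (hj : j ≤ e * t + i) (hc : c ∈ fracIdeal ϖ t)
    {x : Matrix (Fin n) (Fin n) F} (hx : x ∈ radPow ϖ n e i) : c • x ∈ radPow ϖ n e j := by
  intro a b
  refine fracIdeal_mul_mem hϖ ?_ hc (hx a b)
  rw [ceil_div_le_iff he]
  have := (ceil_div_le_iff he
    (z := i + ((a.val / (n / e) : ℕ) : ℤ) - ((b.val / (n / e) : ℕ) : ℤ))).1
    le_rfl
  linarith

theorem one_mem_radPow (he : 0 < e) (hϖ : ϖ ≠ 0) :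
    (1 : Matrix (Fin n) (Fin n) F) ∈ radPow ϖ n e 0 := by
  refine mem_radPow_of_forall_chain he hϖ fun r v hv => ?_
  simpa using hv

theorem radPow_pow_mem (he : 0 < e) (hϖ : ϖ ≠ 0) {i : ℤ} {x : Matrix (Fin n) (Fin n) F}
    (hx : x ∈ radPow ϖ n e i) (k : ℕ) : x ^ k ∈ radPow ϖ n e (i * k) := by
  induction k with
  | zero => simpa using one_mem_radPow he hϖ
  | succ k ih =>
    rw [pow_succ]
    exact radPow_mul_mem hϖ (by push_cast; linarith) ih hx

theorem one_notMem_radPow_one (hϖ : Irreducible ϖ) (hn : 0 < n) (he : e ∣ n) :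
    (1 : Matrix (Fin n) (Fin n) F) ∉ radPow ϖ n e 1 := by
  intro h
  have he' := Nat.pos_of_dvd_of_pos he hn
  have h1 := h ⟨0, hn⟩ ⟨0, hn⟩
  rw [Matrix.one_apply_eq, ← zpow_zero (ϖ : F), zpow_mem_fracIdeal_iff hϖ,
    ceil_div_le_iff he'] at h1
  simp at h1

/-- The entries of an element of the hereditary order are integral. -/
theorem integral_of_mem_radPow (hϖ : ϖ ≠ 0) (hn : 0 < n) (he : e ∣ n)
    {x : Matrix (Fin n) (Fin n) F} (hx : x ∈ radPow ϖ n e 0) (a b : Fin n) : x a b ∈ 𝒪[F] := by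
  rw [← mem_fracIdeal_zero (ϖ := ϖ)]
  refine fracIdeal_anti hϖ ?_ (hx a b)
  have he' := Nat.pos_of_dvd_of_pos he hn
  by_contra! h
  have h1 := (ceil_div_le_iff he' (k := -1)).1 (Int.le_sub_one_of_lt h)
  have h2 : ((b.val / (n / e) : ℕ) : ℤ) < e := by exact_mod_cast block_lt hn he b
  have h3 := Int.natCast_nonneg (a.val / (n / e))
  linarith

theorem mem_radPow_of_forall_mem_fracIdeal (hϖ : ϖ ≠ 0) (hn : 0 < n) (he : e ∣ n) {i t : ℤ}
    (h : i + e - 1 ≤ e * t) {x : Matrix (Fin n) (Fin n) F} (hx : ∀ a b, x a b ∈ fracIdeal ϖ t) :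
    x ∈ radPow ϖ n e i := by
  intro a b
  refine fracIdeal_anti hϖ ?_ (hx a b)
  rw [ceil_div_le_iff (Nat.pos_of_dvd_of_pos he hn)]
  have h2 : ((a.val / (n / e) : ℕ) : ℤ) < e := by exact_mod_cast block_lt hn he a
  have h3 := Int.natCast_nonneg (b.val / (n / e))
  linarith

theorem trace_mem_of_mem_radPow_one (hϖ : ϖ ≠ 0) (hn : 0 < n) (he : e ∣ n)
    {x : Matrix (Fin n) (Fin n) F} (hx : x ∈ radPow ϖ n e 1) : x.trace ∈ fracIdeal ϖ 1 := by
  refine fracIdeal_sum_mem fun a _ => fracIdeal_anti hϖ ?_ (hx a a)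
  have he' := Nat.pos_of_dvd_of_pos he hn
  by_contra! h
  have h1 := (ceil_div_le_iff he' (k := 0)).1 (Int.lt_add_one_iff.1 h)
  simp at h1

/-- Every non-zero vector has an exact level in the lattice chain, and the lattice of that level
is generated over the hereditary order by that vector. -/
theorem exists_level [TopologicalSpace F] [IsNonarchimedeanLocalField F] (hϖ : Irreducible ϖ)
    (he : 0 < e) {v : Fin n → F} (hv : v ≠ 0) :
    ∃ r, v ∈ chain ϖ n e r ∧ v ∉ chain ϖ n e (r + 1) ∧
      ∀ w ∈ chain ϖ n e r, ∃ x ∈ radPow ϖ n e 0, w = x *ᵥ v := by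
  have h0 : (ϖ : F) ≠ 0 := by simpa using hϖ.ne_zero
  have hex : ∀ a, ∃ (k : ℤ) (u : 𝒪[F]ˣ), v a ≠ 0 → v a = (ϖ : F) ^ k * ((u : 𝒪[F]) : F) := by
    intro a
    by_cases h : v a = 0
    · exact ⟨0, 1, fun h' => (h' h).elim⟩
    · obtain ⟨k, u, hk⟩ := exists_zpow_mul_unit hϖ h
      exact ⟨k, u, fun _ => hk⟩
  choose o u hou using hex
  classical
  -- the level is the least `e o_a - [a]`, where `o_a` is the valuation of the `a`-th coordinate; at
  -- a minimal `a` the matrices with only the `a`-th column non-zero suffice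
  obtain ⟨a₀, ha₀⟩ := Function.ne_iff.1 hv
  obtain ⟨a, ha, hmin⟩ := Finset.exists_min_image (Finset.univ.filter fun a => v a ≠ 0)
    (fun a => (e : ℤ) * o a - ((a.val / (n / e) : ℕ) : ℤ)) ⟨a₀, by simpa using ha₀⟩
  have ha' : v a ≠ 0 := by simpa using ha
  refine ⟨e * o a - ((a.val / (n / e) : ℕ) : ℤ), ?_, ?_, ?_⟩
  · intro b
    by_cases hb : v b = 0
    · rw [hb]
      exact fracIdeal_zero_mem _ _
    · have := hmin b (by simpa using hb)
      rw [hou b hb, zpow_mul_unit_mem_fracIdeal hϖ, ceil_div_le_iff he]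
      linarith
  · intro h
    have h1 := h a
    rw [hou a ha', zpow_mul_unit_mem_fracIdeal hϖ, ceil_div_le_iff he] at h1
    linarith
  · intro w hw
    refine ⟨Matrix.of fun b c => if c = a then w b * (v a)⁻¹ else 0, ?_, ?_⟩
    · intro b c
      simp only [Matrix.of_apply]
      split_ifs with hc
      · subst hc
        have hinv : (v c)⁻¹ ∈ fracIdeal ϖ (-o c) := by
          have hu : ((((u c)⁻¹ : 𝒪[F]ˣ) : 𝒪[F]) : F) * (((u c : 𝒪[F]ˣ) : 𝒪[F]) : F) = 1 := by
            exact_mod_cast congrArg (Subtype.val) (Units.inv_mul (u c))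
          refine ⟨((u c)⁻¹ : 𝒪[F]ˣ), ?_⟩
          rw [hou c ha', mul_inv, _root_.zpow_neg, eq_comm]
          congr 1
          exact eq_inv_of_mul_eq_one_left hu
        refine fracIdeal_mul_mem hϖ.ne_zero ?_ (hw b) hinv
        rw [ceil_div_le_iff he]
        have := (ceil_div_le_iff he (z := e * o c - ((c.val / (n / e) : ℕ) : ℤ)
          + ((b.val / (n / e) : ℕ) : ℤ))).1 le_rfl
        linarith
      · exact fracIdeal_zero_mem _ _
    · ext b
      simp [Matrix.mulVec, dotProduct, ha']

theorem exists_mem_chain_notMem (hϖ : Irreducible ϖ) (hn : 0 < n) (he : e ∣ n) (r : ℤ) :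
    ∃ v ∈ chain ϖ n e r, v ∉ chain ϖ n e (r + 1) := by
  have he' := Nat.pos_of_dvd_of_pos he hn
  have he'' : (0 : ℤ) < e := by exact_mod_cast he'
  have hm := Int.emod_nonneg (-r) he''.ne'
  have hm' := Int.emod_lt_of_pos (-r) he''
  have hd := Int.emod_add_mul_ediv (-r) e
  obtain ⟨c, hc⟩ := Int.eq_ofNat_of_zero_le hm
  obtain ⟨a, ha⟩ := exists_block_eq hn he (c := c) (by omega)
  refine ⟨Pi.single a ((ϖ : F) ^ (-(-r / e))), ?_, fun h => ?_⟩
  · refine single_mem_chain he' hϖ.ne_zero ?_ (zpow_mem_fracIdeal _ _)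
    rw [ha]
    linarith
  · have h1 := h a
    rw [Pi.single_eq_same, zpow_mem_fracIdeal_iff hϖ, ceil_div_le_iff he', ha] at h1
    linarith

/-- `g` maps the `r`-th lattice of the chain onto the `(r + i)`-th one, for all `r`. -/
def HasShift (ϖ : 𝒪[F]) (e : ℕ) (g : GL (Fin n) F) (i : ℤ) : Prop :=
  (g : Matrix (Fin n) (Fin n) F) ∈ radPow ϖ n e i ∧
    ((g⁻¹ : GL (Fin n) F) : Matrix (Fin n) (Fin n) F) ∈ radPow ϖ n e (-i)

theorem HasShift.one (hϖ : ϖ ≠ 0) (he : 0 < e) : HasShift (n := n) ϖ e 1 0 := by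
  refine ⟨one_mem_radPow he hϖ, ?_⟩
  simpa using one_mem_radPow he hϖ

theorem HasShift.mul (hϖ : ϖ ≠ 0) {g h : GL (Fin n) F} {i j : ℤ} (hg : HasShift ϖ e g i)
    (hh : HasShift ϖ e h j) : HasShift ϖ e (g * h) (i + j) := by
  refine ⟨radPow_mul_mem hϖ le_rfl hg.1 hh.1, ?_⟩
  rw [_root_.mul_inv_rev]
  exact radPow_mul_mem hϖ (by omega) hh.2 hg.2

theorem HasShift.inv {g : GL (Fin n) F} {i : ℤ} (hg : HasShift ϖ e g i) :
    HasShift ϖ e g⁻¹ (-i) :=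
  ⟨hg.2, by simpa using hg.1⟩

theorem HasShift.pow (hϖ : ϖ ≠ 0) (he : 0 < e) {g : GL (Fin n) F} {i : ℤ}
    (hg : HasShift ϖ e g i) (k : ℕ) : HasShift ϖ e (g ^ k) (i * k) := by
  induction k with
  | zero => simpa using HasShift.one hϖ he
  | succ k ih =>
    rw [pow_succ]
    convert ih.mul hϖ hg using 1
    push_cast
    ring

theorem HasShift.zpow (hϖ : ϖ ≠ 0) (he : 0 < e) {g : GL (Fin n) F} {i : ℤ}
    (hg : HasShift ϖ e g i) (k : ℤ) : HasShift ϖ e (g ^ k) (i * k) := by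
  obtain ⟨k, rfl | rfl⟩ := k.eq_nat_or_neg
  · simpa using hg.pow hϖ he k
  · simpa using (hg.pow hϖ he k).inv

/-- An element of shift `i` lies in no higher power of the radical than the `i`-th. -/
theorem HasShift.le_of_mem (hϖ : Irreducible ϖ) (hn : 0 < n) (he : e ∣ n) {g : GL (Fin n) F}
    {i j : ℤ} (hg : HasShift ϖ e g i) (h : (g : Matrix (Fin n) (Fin n) F) ∈ radPow ϖ n e j) :
    j ≤ i := by
  by_contra! hij
  refine one_notMem_radPow_one hϖ hn he ?_
  simpa using radPow_mul_mem hϖ.ne_zero (r := 1) (by omega) h hg.2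

theorem HasShift.unique (hϖ : Irreducible ϖ) (hn : 0 < n) (he : e ∣ n) {g : GL (Fin n) F}
    {i j : ℤ} (hg : HasShift ϖ e g i) (hg' : HasShift ϖ e g j) : i = j :=
  le_antisymm (hg'.le_of_mem hϖ hn he hg.1) (hg.le_of_mem hϖ hn he hg'.1)

/-- An element which normalises the hereditary order permutes the lattices of the chain, hence
shifts it. -/
theorem exists_hasShift [TopologicalSpace F] [IsNonarchimedeanLocalField F] (hϖ : Irreducible ϖ)
    (hn : 0 < n) (he : e ∣ n) {g : GL (Fin n) F}
    (hg : ∀ x ∈ radPow ϖ n e 0, (g : Matrix (Fin n) (Fin n) F) * x *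
      ((g⁻¹ : GL (Fin n) F) : Matrix (Fin n) (Fin n) F) ∈ radPow ϖ n e 0)
    (hg' : ∀ x ∈ radPow ϖ n e 0, ((g⁻¹ : GL (Fin n) F) : Matrix (Fin n) (Fin n) F) * x *
      (g : Matrix (Fin n) (Fin n) F) ∈ radPow ϖ n e 0) :
    ∃ i, HasShift ϖ e g i := by
  have he' := Nat.pos_of_dvd_of_pos he hn
  have h0 : (ϖ : F) ≠ 0 := by simpa using hϖ.ne_zero
  have hgi : ∀ v : Fin n → F, ((g⁻¹ : GL (Fin n) F) : Matrix (Fin n) (Fin n) F) *ᵥ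
      ((g : Matrix (Fin n) (Fin n) F) *ᵥ v) = v := by
    intro v
    rw [Matrix.mulVec_mulVec, ← Units.val_mul]
    simp
  -- lattices generated by one vector over the order go to such lattices
  have key : ∀ r, ∃ s, ∀ v, v ∈ chain ϖ n e r ↔
      (g : Matrix (Fin n) (Fin n) F) *ᵥ v ∈ chain ϖ n e s := by
    intro r
    obtain ⟨u, hu, hu'⟩ := exists_mem_chain_notMem hϖ hn he r
    have hu0 : u ≠ 0 := by
      rintro rfl
      exact hu' fun a => fracIdeal_zero_mem _ _
    obtain ⟨r', hr1, hr2, hr3⟩ := exists_level hϖ he' hu0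
    obtain rfl : r = r' := by
      by_contra hne
      rcases lt_or_gt_of_ne hne with h | h
      · exact hu' (chain_anti hϖ.ne_zero (by omega) hr1)
      · exact hr2 (chain_anti hϖ.ne_zero (by omega) hu)
    have hgu : (g : Matrix (Fin n) (Fin n) F) *ᵥ u ≠ 0 := by
      intro h
      apply hu0
      rw [← hgi u, h, Matrix.mulVec_zero]
    obtain ⟨s, hs1, hs2, hs3⟩ := exists_level hϖ he' hgu
    refine ⟨s, fun v => ⟨fun hv => ?_, fun hv => ?_⟩⟩
    · obtain ⟨x, hx, rfl⟩ := hr3 v hv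
      have := mulVec_mem_chain hϖ.ne_zero (s := s) (by simp) (hg x hx) hs1
      rwa [← Matrix.mulVec_mulVec, hgi, ← Matrix.mulVec_mulVec] at this
    · obtain ⟨x, hx, hxv⟩ := hs3 _ hv
      have := mulVec_mem_chain hϖ.ne_zero (s := r) (by simp) (hg' x hx) hu
      rwa [← Matrix.mulVec_mulVec, ← Matrix.mulVec_mulVec, ← hxv, hgi] at this
  choose f hf using key
  have hgs : ∀ w : Fin n → F, ∃ v, (g : Matrix (Fin n) (Fin n) F) *ᵥ v = w := by
    intro w
    refine ⟨((g⁻¹ : GL (Fin n) F) : Matrix (Fin n) (Fin n) F) *ᵥ w, ?_⟩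
    rw [Matrix.mulVec_mulVec, ← Units.val_mul]
    simp
  -- the lattices strictly decrease, so the index of the image determines that of the lattice
  have hmono : ∀ r s, f r ≤ f s ↔ r ≤ s := by
    intro r s
    constructor
    · intro h
      by_contra! hlt
      obtain ⟨u, hu, hu'⟩ := exists_mem_chain_notMem hϖ hn he s
      exact hu' (chain_anti hϖ.ne_zero (by omega)
        ((hf r u).2 (chain_anti hϖ.ne_zero h ((hf s u).1 hu))))
    · intro h
      by_contra! hlt
      obtain ⟨u, hu, hu'⟩ := exists_mem_chain_notMem hϖ hn he (f s)
      obtain ⟨v, rfl⟩ := hgs u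
      exact hu' (chain_anti hϖ.ne_zero (by omega)
        ((hf r v).1 (chain_anti hϖ.ne_zero h ((hf s v).2 hu))))
  have hsmul : ∀ r v, v ∈ chain ϖ n e r ↔ (ϖ : F) • v ∈ chain ϖ n e (r + e) := by
    have aux : ∀ (r t : ℤ) v, v ∈ chain ϖ n e r → (ϖ : F) ^ t • v ∈ chain ϖ n e (r + e * t) := by
      intro r t v hv a
      refine fracIdeal_mul_mem hϖ.ne_zero ?_ (zpow_mem_fracIdeal ϖ t) (hv a)
      rw [ceil_div_le_iff he']
      have := (ceil_div_le_iff he' (z := r + ((a.val / (n / e) : ℕ) : ℤ))).1 le_rfl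
      linarith
    intro r v
    constructor
    · intro hv
      simpa using aux r 1 v hv
    · intro hv
      simpa [smul_smul, h0] using aux _ (-1) _ hv
  have hper : ∀ r, f (r + e) = f r + e := by
    intro r
    apply le_antisymm
    · by_contra! hlt
      obtain ⟨u, hu, hu'⟩ := exists_mem_chain_notMem hϖ hn he (f r)
      obtain ⟨v, rfl⟩ := hgs u
      have h1 := (hsmul _ _).1 ((hf r v).2 hu)
      rw [hf, Matrix.mulVec_smul] at h1
      refine hu' ((hsmul _ _).2 (chain_anti hϖ.ne_zero ?_ h1))
      omega
    · by_contra! hlt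
      obtain ⟨u, hu, hu'⟩ := exists_mem_chain_notMem hϖ hn he (f (r + e))
      obtain ⟨v, rfl⟩ := hgs u
      have h1 := (hf _ _).2 hu
      have h2 : v = (ϖ : F) • ((ϖ : F)⁻¹ • v) := by rw [smul_inv_smul₀ h0]
      rw [h2] at h1
      have h3 := (hsmul _ _).1 ((hf r _).1 ((hsmul _ _).2 h1))
      rw [← Matrix.mulVec_smul, ← h2] at h3
      exact hu' (chain_anti hϖ.ne_zero (by omega) h3)
  -- a strictly increasing function `f` with `f (r + e) = f r + e` is a translation
  have hlt : ∀ r, f r + 1 ≤ f (r + 1) := fun r => by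
    by_contra! h
    have := (hmono (r + 1) r).1 (by omega)
    omega
  have hge : ∀ (k : ℕ) r, f r + k ≤ f (r + k) := by
    intro k
    induction k with
    | zero => simp
    | succ k ih =>
      intro r
      have h1 := ih r
      have h2 := hlt (r + k)
      rw [add_assoc] at h2
      push_cast
      linarith
  have hsucc : ∀ r, f (r + 1) = f r + 1 := by
    intro r
    have h1 := hge (e - 1) (r + 1)
    have h2 := hper r
    have h3 := hlt r
    rw [show r + 1 + ((e - 1 : ℕ) : ℤ) = r + e by omega] at h1
    omega
  have hlin : ∀ r, f r = r + f 0 := by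
    intro r
    induction r with
    | zero => simp
    | succ k ih => rw [hsucc, ih]; ring
    | pred k ih =>
      have := hsucc (-k - 1)
      rw [sub_add_cancel, ih] at this
      omega
  refine ⟨f 0, mem_radPow_of_forall_chain he' hϖ.ne_zero fun r v hv => ?_,
    mem_radPow_of_forall_chain he' hϖ.ne_zero fun r v hv => ?_⟩
  · rw [← hlin]
    exact (hf r v).1 hv
  · obtain ⟨v, rfl⟩ := hgs v
    rw [hgi, hf, hlin (r + -f 0), neg_add_cancel_right]
    exact hv

end Chain

/-! ### The field `F[β]` inside the hereditary order -/

theorem coe_mem_of_mem_torus {F : Type u} [Field F] {n : ℕ} {β : Matrix (Fin n) (Fin n) F}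
    {g : GL (Fin n) F}
    (hg : g ∈ torus β) : (g : Matrix (Fin n) (Fin n) F) ∈ fieldL β :=
  ((Submonoid.mem_units_iff _ _).1 hg).1

theorem commute_of_mem_fieldL {F : Type u} [Field F] {n : ℕ} {β x y : Matrix (Fin n) (Fin n) F}
    (hx : x ∈ fieldL β) (hy : y ∈ fieldL β) : x * y = y * x :=
  congrArg Subtype.val (mul_comm (⟨x, hx⟩ : fieldL β) ⟨y, hy⟩)

namespace SupercuspidalDatum

variable {F : Type u} [Field F] [ValuativeRel F] {ϖ : 𝒪[F]} {h0 : ϖ ≠ 0}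
  {ψ : AddChar F Circle} {n : ℕ} (D : SupercuspidalDatum.{u, w} ϖ h0 ψ n)

theorem e_pos (hn : 0 < n) : 0 < D.e := Nat.pos_of_dvd_of_pos D.e_dvd hn

theorem exists_torus {x : Matrix (Fin n) (Fin n) F} (hx : x ∈ fieldL D.β) (hx0 : x ≠ 0) :
    ∃ g ∈ torus D.β, (g : Matrix (Fin n) (Fin n) F) = x := by
  obtain ⟨y, hy⟩ := D.isField.mul_inv_cancel (a := ⟨x, hx⟩) (by simpa [Subtype.ext_iff] using hx0)
  have h1 : x * (y : Matrix (Fin n) (Fin n) F) = 1 := congrArg Subtype.val hy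
  have h2 : (y : Matrix (Fin n) (Fin n) F) * x = 1 := mul_eq_one_comm.1 h1
  exact ⟨⟨x, y, h1, h2⟩, (Submonoid.mem_units_iff _ _).2 ⟨hx, y.2⟩, rfl⟩

theorem β_ne_zero : D.β ≠ 0 := fun h => D.notMem_radPow (h ▸ zero_mem_radPow)

variable [TopologicalSpace F] [IsNonarchimedeanLocalField F]

theorem exists_hasShift_of_mem_torus (hϖ : Irreducible ϖ) (hn : 0 < n) {g : GL (Fin n) F}
    (hg : g ∈ torus D.β) :
    ∃ i, HasShift ϖ D.e g i := by
  refine exists_hasShift hϖ hn D.e_dvd (D.normalises g hg) ?_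
  simpa using D.normalises g⁻¹ (inv_mem hg)

/-- The integers of `F[β]` are its elements in the hereditary order. -/
theorem isIntegral_iff (hϖ : Irreducible ϖ) (hn : 0 < n) (x : fieldL D.β) :
    IsIntegral 𝒪[F] x ↔ (x : Matrix (Fin n) (Fin n) F) ∈ radPow ϖ n D.e 0 := by
  have he := D.e_pos hn
  constructor
  · intro h
    by_cases hx0 : (x : Matrix (Fin n) (Fin n) F) = 0
    · rw [hx0]
      exact zero_mem_radPow
    obtain ⟨g, hg, hgx⟩ := D.exists_torus x.2 hx0
    obtain ⟨i, hi⟩ := D.exists_hasShift_of_mem_torus hϖ hn hg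
    rw [← hgx]
    obtain hi0 | hi0 := le_or_gt 0 i
    · exact radPow_anti hϖ.ne_zero hi0 hi.1
    -- a negative shift contradicts an equation of integral dependence
    exfalso
    have h' : IsIntegral 𝒪[F] (g : Matrix (Fin n) (Fin n) F) := by
      rw [hgx]
      exact h.map ((fieldL D.β).val.restrictScalars 𝒪[F])
    obtain ⟨p, hp, hp0⟩ := h'
    change Polynomial.aeval _ p = 0 at hp0
    rw [hp.as_sum] at hp0
    simp only [map_add, map_pow, Polynomial.aeval_X, map_sum, map_mul, Polynomial.aeval_C] at hp0
    set d := p.natDegree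
    have hd : (g : Matrix (Fin n) (Fin n) F) ^ d ∈ radPow ϖ n D.e (i * (d - 1 : ℤ)) := by
      rw [eq_neg_of_add_eq_zero_left hp0]
      refine radPow_neg_mem (Finset.sum_induction _ (· ∈ radPow ϖ n D.e _)
        (fun _ _ => radPow_add_mem) zero_mem_radPow fun k hk => ?_)
      rw [← Algebra.smul_def]
      change ((p.coeff k : 𝒪[F]) : F) • (g : Matrix (Fin n) (Fin n) F) ^ k ∈ _
      have hk' : (k : ℤ) ≤ d - 1 := by
        have := Finset.mem_range.1 hk
        omega
      refine smul_mem_radPow he hϖ.ne_zero (t := 0) (i := i * k) (by nlinarith)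
        (mem_fracIdeal_zero.2 (p.coeff k).2) (radPow_pow_mem he hϖ.ne_zero hi.1 k)
    have hgd := hi.pow hϖ.ne_zero he d
    have := hgd.le_of_mem hϖ hn D.e_dvd (by simpa using hd)
    nlinarith
  · intro h
    have hO : ∀ a b, (x : Matrix (Fin n) (Fin n) F) a b ∈ 𝒪[F] :=
      fun a b => integral_of_mem_radPow hϖ.ne_zero hn D.e_dvd h a b
    have h1 := (Matrix.isIntegral (Matrix.of fun a b => (⟨_, hO a b⟩ : 𝒪[F]))).map
      (Algebra.ofId 𝒪[F] F).mapMatrix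
    have h2 : (Algebra.ofId 𝒪[F] F).mapMatrix (Matrix.of fun a b => (⟨_, hO a b⟩ : 𝒪[F]))
        = ((fieldL D.β).val.restrictScalars 𝒪[F]) x := by
      ext a b
      rfl
    rw [h2] at h1
    exact (isIntegral_algHom_iff _ Subtype.val_injective).1 h1

theorem integersL_mem_radPow (hϖ : Irreducible ϖ) (hn : 0 < n) (y : integersL D.β) :
    ((y : fieldL D.β) : Matrix (Fin n) (Fin n) F) ∈ radPow ϖ n D.e 0 :=
  (D.isIntegral_iff hϖ hn _).1 y.2

theorem isUnit_integersL_of_hasShift (hϖ : Irreducible ϖ) (hn : 0 < n) {y : integersL D.β}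
    {g : GL (Fin n) F} (hg : g ∈ torus D.β)
    (hgy : (g : Matrix (Fin n) (Fin n) F) = ((y : fieldL D.β) : Matrix (Fin n) (Fin n) F))
    (hs : HasShift ϖ D.e g 0) : IsUnit y := by
  have hz : ((g⁻¹ : GL (Fin n) F) : Matrix (Fin n) (Fin n) F) ∈ radPow ϖ n D.e 0 := by
    simpa using hs.2
  have hz' := (D.isIntegral_iff hϖ hn ⟨_, coe_mem_of_mem_torus (inv_mem hg)⟩).2 hz
  refine IsUnit.of_mul_eq_one (⟨_, hz'⟩ : integersL D.β) ?_
  apply Subtype.ext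
  apply Subtype.ext
  change ((y : fieldL D.β) : Matrix (Fin n) (Fin n) F) * _ = 1
  rw [← hgy, ← Units.val_mul]
  simp

/-- The maximal ideal of the integers of `F[β]` consists of the elements in the radical of the
hereditary order. -/
theorem mem_maxIdealL_iff (hϖ : Irreducible ϖ) (hn : 0 < n) (y : integersL D.β) :
    y ∈ maxIdealL D.β ↔ ((y : fieldL D.β) : Matrix (Fin n) (Fin n) F) ∈ radPow ϖ n D.e 1 := by
  have he := D.e_pos hn
  rw [maxIdealL, Ideal.mem_jacobson_bot]
  constructor
  · intro h
    by_cases hy0 : ((y : fieldL D.β) : Matrix (Fin n) (Fin n) F) = 0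
    · rw [hy0]
      exact zero_mem_radPow
    obtain ⟨g, hg, hgy⟩ := D.exists_torus (y : fieldL D.β).2 hy0
    obtain ⟨i, hi⟩ := D.exists_hasShift_of_mem_torus hϖ hn hg
    have hi0 : 0 ≤ i := hi.le_of_mem hϖ hn D.e_dvd (hgy ▸ D.integersL_mem_radPow hϖ hn y)
    obtain hi1 | rfl := hi0.lt_or_eq
    · rw [← hgy]
      exact radPow_anti hϖ.ne_zero hi1 hi.1
    · obtain ⟨z, hz⟩ := (D.isUnit_integersL_of_hasShift hϖ hn hg hgy hi).exists_right_inv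
      have := h (-z)
      have hz' : ((y : fieldL D.β) : Matrix (Fin n) (Fin n) F) * ((z : fieldL D.β) : Matrix _ _ F)
          = 1 := congrArg (fun t : integersL D.β => (t : fieldL D.β).1) hz
      have hz0 : y * -z + 1 = 0 := by
        apply Subtype.ext
        apply Subtype.ext
        change ((y : fieldL D.β) : Matrix (Fin n) (Fin n) F) * -((z : fieldL D.β) : Matrix _ _ F)
          + 1 = 0
        rw [Matrix.mul_neg, hz', neg_add_cancel]
      rw [hz0, isUnit_zero_iff] at this
      exfalso
      apply hy0
      have h1 : y = 0 := by rw [← mul_one y, ← this, mul_zero]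
      rw [h1]
      rfl
  · intro h z
    have h1 : ((y * z : integersL D.β) : fieldL D.β).1 ∈ radPow ϖ n D.e 1 :=
      radPow_mul_mem hϖ.ne_zero (by simp) h (D.integersL_mem_radPow hϖ hn z)
    have h2 : (((y * z + 1 : integersL D.β) : fieldL D.β) : Matrix (Fin n) (Fin n) F)
        ∉ radPow ϖ n D.e 1 := by
      intro h2
      apply one_notMem_radPow_one hϖ hn D.e_dvd
      have := radPow_sub_mem h2 h1
      push_cast at this
      simpa using this
    obtain ⟨g, hg, hgy⟩ := D.exists_torus (y * z + 1 : integersL D.β).1.2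
      (fun h0 => h2 (h0 ▸ zero_mem_radPow))
    obtain ⟨i, hi⟩ := D.exists_hasShift_of_mem_torus hϖ hn hg
    have hi0 : 0 ≤ i := hi.le_of_mem hϖ hn D.e_dvd (hgy ▸ D.integersL_mem_radPow hϖ hn _)
    obtain hi1 | rfl := hi0.lt_or_eq
    · exact (h2 (hgy ▸ radPow_anti hϖ.ne_zero hi1 hi.1)).elim
    · exact D.isUnit_integersL_of_hasShift hϖ hn hg hgy hi

theorem mem_unitsL_iff (hϖ : Irreducible ϖ) (hn : 0 < n) {g : GL (Fin n) F} :
    g ∈ unitsL D.β ↔ g ∈ torus D.β ∧ g ∈ unitFiltration ϖ h0 n D.e 1 := by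
  constructor
  · intro hg
    refine ⟨unitsL_le_torus _ hg, ?_⟩
    obtain ⟨⟨y, hy, h1⟩, ⟨z, hz, h2⟩⟩ := hg
    refine ⟨?_, ?_⟩
    · rw [h1, add_sub_cancel_left]
      exact (D.mem_maxIdealL_iff hϖ hn y).1 hy
    · rw [h2, add_sub_cancel_left]
      exact (D.mem_maxIdealL_iff hϖ hn z).1 hz
  · have key : ∀ h : GL (Fin n) F, h ∈ torus D.β →
        (h : Matrix (Fin n) (Fin n) F) - 1 ∈ radPow ϖ n D.e 1 →
        ∃ y ∈ maxIdealL D.β, (h : Matrix (Fin n) (Fin n) F)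
          = 1 + ((y : fieldL D.β) : Matrix _ _ F) := by
      intro h hh h1
      have hL : (h : Matrix (Fin n) (Fin n) F) - 1 ∈ fieldL D.β :=
        sub_mem (coe_mem_of_mem_torus hh) (one_mem _)
      have hint := (D.isIntegral_iff hϖ hn ⟨_, hL⟩).2 (radPow_anti hϖ.ne_zero (by simp) h1)
      exact ⟨⟨⟨_, hL⟩, hint⟩, (D.mem_maxIdealL_iff hϖ hn _).2 h1, by simp⟩
    rintro ⟨hg, h1, h2⟩
    exact ⟨key g hg h1, key _ (inv_mem hg) h2⟩

end SupercuspidalDatum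

/-! ### Duality, and the valuation of the minimal element -/

section Duality

variable {F : Type u} [Field F] [ValuativeRel F] {ϖ : 𝒪[F]} {ψ : AddChar F Circle}

theorem IsLevelOne.map_eq_one (hψ : IsLevelOne ψ) (hϖ : Irreducible ϖ) {x : F}
    (hx : x ∈ fracIdeal ϖ 1) : ψ x = 1 := by
  obtain ⟨y, rfl⟩ := hx
  have h : ϖ * y ∈ 𝓂[F] :=
    Ideal.mul_mem_right _ _ ((IsLocalRing.mem_maximalIdeal _).2 hϖ.not_isUnit)
  simpa using hψ.1 _ h

theorem IsLevelOne.map_trace_eq_one (hψ : IsLevelOne ψ) (hϖ : Irreducible ϖ) {n e : ℕ}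
    (hn : 0 < n) (he : e ∣ n) {x : Matrix (Fin n) (Fin n) F} (hx : x ∈ radPow ϖ n e 1) :
    ψ x.trace = 1 :=
  hψ.map_eq_one hϖ (trace_mem_of_mem_radPow_one hϖ.ne_zero hn he hx)

/-- With respect to `ψ ∘ Tr` the orthogonal of `radPow ϖ n e m` is `radPow ϖ n e (1 - m)`. -/
theorem IsLevelOne.mem_radPow_of_forall_trace [TopologicalSpace F] [IsNonarchimedeanLocalField F]
    (hψ : IsLevelOne ψ) (hϖ : Irreducible ϖ) {n e : ℕ} (he : 0 < e) {m : ℤ}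
    {x : Matrix (Fin n) (Fin n) F} (h : ∀ y ∈ radPow ϖ n e m, ψ (x * y).trace = 1) :
    x ∈ radPow ϖ n e (1 - m) := by
  intro a b
  have h0 : (ϖ : F) ≠ 0 := by simpa using hϖ.ne_zero
  have hexp : (1 - m + ((a.val / (n / e) : ℕ) : ℤ) - ((b.val / (n / e) : ℕ) : ℤ) : ℤ)
      = 1 - (m + ((b.val / (n / e) : ℕ) : ℤ) - ((a.val / (n / e) : ℕ) : ℤ)) := by ring
  rw [hexp, one_sub_ceil_div he]
  set t := ⌈((m + ((b.val / (n / e) : ℕ) : ℤ) - ((a.val / (n / e) : ℕ) : ℤ) : ℤ) : ℚ) / e⌉ with ht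
  by_cases hx : x a b = 0
  · rw [hx]
    exact fracIdeal_zero_mem _ _
  obtain ⟨k, s, hk⟩ := exists_zpow_mul_unit hϖ hx
  rw [hk, zpow_mul_unit_mem_fracIdeal hϖ]
  by_contra! hlt
  obtain ⟨c, hc⟩ := hψ.2
  have hd : (x a b)⁻¹ * (c : F) ∈ fracIdeal ϖ t := by
    have hinv : ((((s⁻¹ : 𝒪[F]ˣ) : 𝒪[F]) : F)) * ((s : 𝒪[F]) : F) = 1 := by
      exact_mod_cast congrArg (Subtype.val) (Units.inv_mul s)
    have : (x a b)⁻¹ * (c : F)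
        = (ϖ : F) ^ (-k) * (((s⁻¹ : 𝒪[F]ˣ) * c : 𝒪[F]) : F) := by
      rw [hk, mul_inv, _root_.zpow_neg, ← eq_inv_of_mul_eq_one_left hinv]
      push_cast
      ring
    rw [this]
    exact fracIdeal_anti hϖ.ne_zero (by omega) ⟨_, rfl⟩
  apply hc
  have := h (Matrix.single b a ((x a b)⁻¹ * (c : F))) (by
    intro b' a'
    by_cases hba : b = b' ∧ a = a'
    · obtain ⟨rfl, rfl⟩ := hba
      rw [Matrix.single_apply_same]
      exact hd
    · rw [Matrix.single_apply_of_ne _ _ _ _ _ hba]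
      exact fracIdeal_zero_mem _ _)
  rw [Matrix.trace_mul_single] at this
  simpa [mul_inv_cancel_left₀ hx] using this

end Duality

namespace SupercuspidalDatum

variable {F : Type u} [Field F] [ValuativeRel F] {ϖ : 𝒪[F]} {h0 : ϖ ≠ 0}
  {ψ : AddChar F Circle} {n : ℕ} (D : SupercuspidalDatum.{u, w} ϖ h0 ψ n)

theorem exists_hasShift_uniformiser (hn : 0 < n) :
    ∃ g ∈ torus D.β, (g : Matrix (Fin n) (Fin n) F) = (ϖ : F) • 1 ∧ HasShift ϖ D.e g D.e := by
  have h0' : (ϖ : F) ≠ 0 := by simpa using h0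
  have he := D.e_pos hn
  refine ⟨⟨(ϖ : F) • 1, (ϖ : F)⁻¹ • 1, by simp [smul_smul, h0'], by simp [smul_smul, h0']⟩,
    (Submonoid.mem_units_iff _ _).2 ⟨?_, ?_⟩, rfl, ?_, ?_⟩
  · exact Subalgebra.smul_mem _ (one_mem _) _
  · exact Subalgebra.smul_mem _ (one_mem _) _
  · exact smul_mem_radPow he h0 (t := 1) (i := 0) (by simp) ⟨1, by simp⟩ (one_mem_radPow he h0)
  · exact smul_mem_radPow he h0 (t := -1) (i := 0) (by simp) ⟨1, by simp⟩ (one_mem_radPow he h0)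

variable [TopologicalSpace F] [IsNonarchimedeanLocalField F]

theorem exists_hasShift_β (hϖ : Irreducible ϖ) (hn : 0 < n) :
    ∃ g ∈ torus D.β, (g : Matrix (Fin n) (Fin n) F) = D.β ∧ HasShift ϖ D.e g (-(D.depth : ℤ)) := by
  obtain ⟨g, hg, hgβ⟩ := D.exists_torus (gen D.β).2 D.β_ne_zero
  change _ = D.β at hgβ
  obtain ⟨i, hi⟩ := D.exists_hasShift_of_mem_torus hϖ hn hg
  have h1 : -(D.depth : ℤ) ≤ i := hi.le_of_mem hϖ hn D.e_dvd (hgβ ▸ D.mem_radPow)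
  have h2 : i ≤ -(D.depth : ℤ) := by
    by_contra! h
    exact D.notMem_radPow (hgβ ▸ radPow_anti h0 (by omega) hi.1)
  obtain rfl : i = -(D.depth : ℤ) := le_antisymm h2 h1
  exact ⟨g, hg, hgβ, hi⟩

/-- A generator of the maximal ideal of the integers of `F[β]` shifts the lattice chain by one. -/
theorem hasShift_one_of_span_eq (hϖ : Irreducible ϖ) (hn : 0 < n) {π : integersL D.β}
    (hπ : Ideal.span {π} = maxIdealL D.β) :
    ∃ g ∈ torus D.β, (g : Matrix (Fin n) (Fin n) F) = ((π : fieldL D.β) : Matrix _ _ F) ∧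
      HasShift ϖ D.e g 1 := by
  have he := D.e_pos hn
  have h0' : (ϖ : F) ≠ 0 := by simpa using h0
  have hram : Ideal.span {algebraMap 𝒪[F] (integersL D.β) ϖ} = Ideal.span {π ^ D.e} := by
    have := D.ramification
    rw [HasRamificationIndex, maximalIdeal_eq_span hϖ, Ideal.map_span, Set.image_singleton, ← hπ,
      Ideal.span_singleton_pow] at this
    exact this
  obtain ⟨a, ha⟩ := Ideal.span_singleton_le_span_singleton.1 hram.le
  obtain ⟨b, hb⟩ := Ideal.span_singleton_le_span_singleton.1 hram.ge
  obtain ⟨p, hp, hpϖ, hps⟩ := D.exists_hasShift_uniformiser hn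
  have hcoe : ((algebraMap 𝒪[F] (integersL D.β) ϖ : fieldL D.β) : Matrix (Fin n) (Fin n) F)
      = p := by
    rw [hpϖ, ← Algebra.algebraMap_eq_smul_one]
    rfl
  have ha' : (p : Matrix (Fin n) (Fin n) F)
      = ((π : fieldL D.β) : Matrix _ _ F) ^ D.e * ((a : fieldL D.β) : Matrix _ _ F) := by
    rw [← hcoe, ha]
    rfl
  have hb' : ((π : fieldL D.β) : Matrix _ _ F) ^ D.e
      = (p : Matrix (Fin n) (Fin n) F) * ((b : fieldL D.β) : Matrix _ _ F) := by
    rw [← hcoe]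
    exact congrArg (fun t : integersL D.β => (t : fieldL D.β).1) hb
  have hπ0 : ((π : fieldL D.β) : Matrix (Fin n) (Fin n) F) ≠ 0 := by
    intro h
    rw [h, zero_pow he.ne', zero_mul] at ha'
    apply one_notMem_radPow_one hϖ hn D.e_dvd
    rw [← Units.mul_inv p, ha', zero_mul]
    exact zero_mem_radPow
  obtain ⟨g, hg, hgπ⟩ := D.exists_torus (π : fieldL D.β).2 hπ0
  obtain ⟨i, hi⟩ := D.exists_hasShift_of_mem_torus hϖ hn hg
  refine ⟨g, hg, hgπ, ?_⟩
  have hie := hi.pow h0 he D.e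
  have h1 : (D.e : ℤ) ≤ i * D.e := by
    refine hie.le_of_mem hϖ hn D.e_dvd ?_
    rw [Units.val_pow_eq_pow_val, hgπ, hb']
    exact radPow_mul_mem h0 (by simp) hps.1 (D.integersL_mem_radPow hϖ hn b)
  have h2 : i * D.e ≤ D.e := by
    refine hps.le_of_mem hϖ hn D.e_dvd ?_
    rw [ha', ← hgπ, ← Units.val_pow_eq_pow_val]
    exact radPow_mul_mem h0 (by simp) hie.1 (D.integersL_mem_radPow hϖ hn a)
  have he' : (0 : ℤ) < D.e := by exact_mod_cast he
  obtain rfl : i = 1 := by nlinarith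
  exact hi

/-- The normalised valuation of `β` is `-depth`, so that minimality is a condition on the depth. -/
theorem valuation_β (hϖ : Irreducible ϖ) (hn : 0 < n) {v : ℤ}
    (hv : HasValuationL D.β (gen D.β) v) : v = -(D.depth : ℤ) := by
  have he := D.e_pos hn
  obtain ⟨π, s, hπ, heq⟩ := hv
  obtain ⟨g, hg, hgπ, hgs⟩ := D.hasShift_one_of_span_eq hϖ hn hπ
  obtain ⟨b, hb, hbβ, hbs⟩ := D.exists_hasShift_β hϖ hn
  have hsinv : (((s : integersL D.β) : fieldL D.β) : Matrix (Fin n) (Fin n) F)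
      * (((s⁻¹ : (integersL D.β)ˣ) : fieldL D.β) : Matrix (Fin n) (Fin n) F) = 1 :=
    congrArg (fun t : integersL D.β => (t : fieldL D.β).1) (Units.mul_inv s)
  have hs : HasShift ϖ D.e ⟨_, _, hsinv, mul_eq_one_comm.1 hsinv⟩ 0 :=
    ⟨D.integersL_mem_radPow hϖ hn _, D.integersL_mem_radPow hϖ hn _⟩
  have h1 := hbs.mul h0 (hgs.pow h0 he (-v).toNat)
  have h2 := hs.mul h0 (hgs.pow h0 he v.toNat)
  have h3 : b * g ^ (-v).toNat
      = (⟨_, _, hsinv, mul_eq_one_comm.1 hsinv⟩ : GL (Fin n) F) * g ^ v.toNat := by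
    apply Units.ext
    simp only [Units.val_mul, Units.val_pow_eq_pow_val, hgπ, hbβ]
    exact congrArg Subtype.val heq
  have := (h3 ▸ h1).unique hϖ hn D.e_dvd h2
  omega

theorem isCoprime_depth (hϖ : Irreducible ϖ) (hn : 0 < n) :
    IsCoprime (-(D.depth : ℤ)) (D.e : ℤ) := by
  obtain ⟨v, hv, hco, -⟩ := D.minimal
  exact D.valuation_β hϖ hn hv ▸ hco

/-- The residue field of `F[β]` is generated by the class of `y = ϖ ^ depth • β ^ e`: a subalgebra
of the integers of `F[β]` which contains `y` and the maximal ideal is the whole ring. -/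
theorem exists_residue_generator (hϖ : Irreducible ϖ) (hn : 0 < n) :
    ∃ y : integersL D.β, ((y : fieldL D.β) : Matrix (Fin n) (Fin n) F)
      = (ϖ : F) ^ D.depth • D.β ^ D.e ∧
      ∀ S : Subalgebra 𝒪[F] (integersL D.β), y ∈ S → (∀ x ∈ maxIdealL D.β, x ∈ S) →
        ∀ x, x ∈ S := by
  obtain ⟨v, hv, -, y, hy, hgen⟩ := D.minimal
  obtain rfl := D.valuation_β hϖ hn hv
  refine ⟨y, ?_, fun S hyS hS x => ?_⟩
  · rw [hy]
    simp [gen]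
  · have h1 : Algebra.adjoin 𝒪[F] {Ideal.Quotient.mk (maxIdealL D.β) y}
        ≤ S.map (Ideal.Quotient.mkₐ 𝒪[F] (maxIdealL D.β)) := by
      rw [Algebra.adjoin_le_iff, Set.singleton_subset_iff]
      exact ⟨y, hyS, rfl⟩
    rw [hgen] at h1
    obtain ⟨s, hs, hsx⟩ := h1 (Algebra.mem_top (x := Ideal.Quotient.mk (maxIdealL D.β) x))
    have h2 : x - s ∈ maxIdealL D.β := Ideal.Quotient.eq.1 hsx.symm
    have h3 := add_mem (hS _ h2) hs
    rwa [sub_add_cancel] at h3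

end SupercuspidalDatum

/-! ### The first order centraliser of the minimal element -/

namespace SupercuspidalDatum

variable {F : Type u} [Field F] [ValuativeRel F] {ϖ : 𝒪[F]} {h0 : ϖ ≠ 0}
  {ψ : AddChar F Circle} {n : ℕ} (D : SupercuspidalDatum.{u, w} ϖ h0 ψ n)
variable [TopologicalSpace F] [IsNonarchimedeanLocalField F]

/-- A vector of exact level `0` identifies `F[β]` with `Fⁿ` and the powers of its maximal ideal
with the lattices of the chain. -/
theorem exists_cyclic_vector (hϖ : Irreducible ϖ) (hn : 0 < n) :
    ∃ v ∈ chain ϖ n D.e 0, ∀ r, ∀ x ∈ chain ϖ n D.e r,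
      ∃ l ∈ fieldL D.β, l ∈ radPow ϖ n D.e r ∧ l *ᵥ v = x := by
  obtain ⟨v, hv, hv'⟩ := exists_mem_chain_notMem hϖ hn D.e_dvd 0
  have hv0 : v ≠ 0 := by
    rintro rfl
    exact hv' fun a => fracIdeal_zero_mem _ _
  refine ⟨v, hv, fun r x hx => ?_⟩
  let φ : fieldL D.β →ₗ[F] (Fin n → F) :=
    { toFun := fun l => (l : Matrix (Fin n) (Fin n) F) *ᵥ v
      map_add' := fun a b => Matrix.add_mulVec _ _ _
      map_smul' := fun c a => Matrix.smul_mulVec _ _ _ }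
  have hinj : Function.Injective φ := by
    rw [injective_iff_map_eq_zero]
    intro l hl
    by_contra hl0
    obtain ⟨g, -, hgl⟩ := D.exists_torus l.2 (fun h => hl0 (Subtype.ext h))
    change (l : Matrix (Fin n) (Fin n) F) *ᵥ v = 0 at hl
    apply hv0
    rw [← Matrix.one_mulVec v, ← Units.inv_mul g, ← Matrix.mulVec_mulVec, hgl, hl,
      Matrix.mulVec_zero]
  have hfin : FiniteDimensional F (fieldL D.β) :=
    Module.finite_of_finrank_pos (by rw [D.finrank_eq]; exact hn)
  obtain ⟨l, hl⟩ := (LinearMap.injective_iff_surjective_of_finrank_eq_finrank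
    (by rw [D.finrank_eq]; simp)).1 hinj x
  change (l : Matrix (Fin n) (Fin n) F) *ᵥ v = x at hl
  refine ⟨l, l.2, ?_, hl⟩
  by_cases hl0 : (l : Matrix (Fin n) (Fin n) F) = 0
  · rw [hl0]
    exact zero_mem_radPow
  obtain ⟨g, hg, hgl⟩ := D.exists_torus l.2 hl0
  obtain ⟨i, hi⟩ := D.exists_hasShift_of_mem_torus hϖ hn hg
  have hri : r ≤ i := by
    by_contra! hlt
    apply hv'
    rw [← Matrix.one_mulVec v, ← Units.inv_mul g, ← Matrix.mulVec_mulVec, hgl, hl]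
    exact mulVec_mem_chain h0 (by omega) hi.2 hx
  rw [← hgl]
  exact radPow_anti h0 hri hi.1

/-- If `z` commutes with `β` to first order, then `z` agrees to first order with an element of
`F[β]`: this is where the minimality of `β` enters. -/
theorem exists_mem_fieldL_sub_mem (hϖ : Irreducible ϖ) (hn : 0 < n) {m : ℤ}
    {z : Matrix (Fin n) (Fin n) F} (hz : z ∈ radPow ϖ n D.e m)
    (hβz : D.β * z - z * D.β ∈ radPow ϖ n D.e (m - D.depth + 1)) :
    ∃ l ∈ fieldL D.β, l ∈ radPow ϖ n D.e m ∧ z - l ∈ radPow ϖ n D.e (m + 1) := by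
  have he := D.e_pos hn
  obtain ⟨v, hv, hcyc⟩ := D.exists_cyclic_vector hϖ hn
  obtain ⟨l, hlL, hlm, hlv⟩ := hcyc m (z *ᵥ v) (mulVec_mem_chain h0 (by simp) hz hv)
  refine ⟨l, hlL, hlm, ?_⟩
  obtain ⟨b, hb, hbβ, hbs⟩ := D.exists_hasShift_β hϖ hn
  obtain ⟨p, hp, hpϖ, hps⟩ := D.exists_hasShift_uniformiser hn
  obtain ⟨z', hz'⟩ : ∃ z', z' = z - l := ⟨_, rfl⟩
  rw [← hz']
  have hz'm : z' ∈ radPow ϖ n D.e m := hz' ▸ radPow_sub_mem hz hlm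
  have hz'v : z' *ᵥ v = 0 := by rw [hz', Matrix.sub_mulVec, hlv, sub_self]
  -- commuting with `z'` modulo higher order terms is stable under products
  have hmul : ∀ (x y : Matrix (Fin n) (Fin n) F) (i j : ℤ), x ∈ radPow ϖ n D.e i →
      y ∈ radPow ϖ n D.e j → x * z' - z' * x ∈ radPow ϖ n D.e (m + i + 1) →
      y * z' - z' * y ∈ radPow ϖ n D.e (m + j + 1) →
      x * y * z' - z' * (x * y) ∈ radPow ϖ n D.e (m + (i + j) + 1) := by
    intro x y i j hx hy hxz hyz
    have : x * y * z' - z' * (x * y) = x * (y * z' - z' * y) + (x * z' - z' * x) * y := by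
      noncomm_ring
    rw [this]
    exact radPow_add_mem (radPow_mul_mem h0 (by omega) hx hyz)
      (radPow_mul_mem h0 (by omega) hxz hy)
  -- the elements of a definite shift `i` which commute with `z'` to first order
  let S : Subgroup (GL (Fin n) F) :=
    { carrier := {g | ∃ i, HasShift ϖ D.e g i ∧ (g : Matrix (Fin n) (Fin n) F) * z'
        - z' * (g : Matrix (Fin n) (Fin n) F) ∈ radPow ϖ n D.e (m + i + 1)}
      one_mem' := ⟨0, HasShift.one h0 he, by simpa using zero_mem_radPow⟩
      mul_mem' := by
        rintro g h ⟨i, hi, hig⟩ ⟨j, hj, hjh⟩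
        exact ⟨i + j, hi.mul h0 hj, hmul _ _ _ _ hi.1 hj.1 hig hjh⟩
      inv_mem' := by
        rintro g ⟨i, hi, hig⟩
        refine ⟨-i, hi.inv, ?_⟩
        have h1 : ((g⁻¹ : GL (Fin n) F) : Matrix (Fin n) (Fin n) F) * z'
            - z' * ((g⁻¹ : GL (Fin n) F) : Matrix (Fin n) (Fin n) F)
            = -(((g⁻¹ : GL (Fin n) F) : Matrix (Fin n) (Fin n) F) *
              ((g : Matrix (Fin n) (Fin n) F) * z' - z' * (g : Matrix (Fin n) (Fin n) F)) *
              ((g⁻¹ : GL (Fin n) F) : Matrix (Fin n) (Fin n) F)) := by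
          simp only [Matrix.mul_sub, Matrix.sub_mul, Matrix.mul_assoc, Units.mul_inv,
            Matrix.mul_one, Units.inv_mul_cancel_left, neg_sub]
        rw [h1]
        exact radPow_neg_mem (radPow_mul_mem (i := -i + (m + i + 1)) h0 (by omega)
          (radPow_mul_mem h0 le_rfl hi.2 hig) hi.2) }
  have hbS : b ∈ S := by
    refine ⟨_, hbs, ?_⟩
    have hlβ := commute_of_mem_fieldL hlL (gen D.β).2
    change l * D.β = D.β * l at hlβ
    have h1 : D.β * z' - z' * D.β = D.β * z - z * D.β := by
      rw [hz', Matrix.mul_sub, Matrix.sub_mul, hlβ]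
      abel
    rw [hbβ, h1]
    exact radPow_anti h0 (by omega) hβz
  have hpS : p ∈ S := by
    refine ⟨_, hps, ?_⟩
    rw [hpϖ]
    simpa using zero_mem_radPow
  -- as the depth is prime to `e`, a product of powers of `β` and `ϖ` has shift one
  obtain ⟨s, t, hst⟩ := D.isCoprime_depth hϖ hn
  set q := b ^ s * p ^ t with hq
  have hqS : q ∈ S := mul_mem (zpow_mem hbS _) (zpow_mem hpS _)
  have hqL : q ∈ torus D.β := mul_mem (zpow_mem hb _) (zpow_mem hp _)
  have hqs : HasShift ϖ D.e q 1 := by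
    have := (hbs.zpow h0 he s).mul h0 (hps.zpow h0 he t)
    rwa [mul_comm _ s, mul_comm _ t, hst] at this
  -- all integers of `F[β]` commute with `z'` to first order
  have hint : ∀ y : integersL D.β, ((y : fieldL D.β) : Matrix (Fin n) (Fin n) F) * z'
      - z' * ((y : fieldL D.β) : Matrix (Fin n) (Fin n) F) ∈ radPow ϖ n D.e (m + 1) := by
    obtain ⟨y, hy, hgen⟩ := D.exists_residue_generator hϖ hn
    let T : Subalgebra 𝒪[F] (integersL D.β) :=
      { carrier := {y | ((y : fieldL D.β) : Matrix (Fin n) (Fin n) F) * z'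
          - z' * ((y : fieldL D.β) : Matrix (Fin n) (Fin n) F) ∈ radPow ϖ n D.e (m + 1)}
        mul_mem' := by
          intro x y hx hy
          have := hmul _ _ 0 0 (D.integersL_mem_radPow hϖ hn x) (D.integersL_mem_radPow hϖ hn y)
            (by simpa using hx) (by simpa using hy)
          simpa using this
        add_mem' := by
          intro x y hx hy
          have := radPow_add_mem hx hy
          change (((x : fieldL D.β) : Matrix (Fin n) (Fin n) F)
            + ((y : fieldL D.β) : Matrix (Fin n) (Fin n) F)) * z'
            - z' * (((x : fieldL D.β) : Matrix (Fin n) (Fin n) F)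
            + ((y : fieldL D.β) : Matrix (Fin n) (Fin n) F)) ∈ radPow ϖ n D.e (m + 1)
          convert this using 1
          noncomm_ring
        algebraMap_mem' := by
          intro c
          change (algebraMap F (Matrix (Fin n) (Fin n) F) c) * z'
            - z' * (algebraMap F (Matrix (Fin n) (Fin n) F) c) ∈ radPow ϖ n D.e (m + 1)
          rw [Algebra.commutes, sub_self]
          exact zero_mem_radPow }
    refine hgen T ?_ ?_
    · change ((y : fieldL D.β) : Matrix (Fin n) (Fin n) F) * z'
          - z' * ((y : fieldL D.β) : Matrix (Fin n) (Fin n) F) ∈ radPow ϖ n D.e (m + 1)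
      have h1 : ((y : fieldL D.β) : Matrix (Fin n) (Fin n) F)
          = ((p ^ D.depth * b ^ D.e : GL (Fin n) F) : Matrix (Fin n) (Fin n) F) := by
        rw [hy, Units.val_mul, Units.val_pow_eq_pow_val, Units.val_pow_eq_pow_val, hpϖ, hbβ,
          smul_pow, one_pow, Matrix.smul_mul, Matrix.one_mul]
      have h2 : p ^ D.depth * b ^ D.e ∈ S := mul_mem (pow_mem hpS _) (pow_mem hbS _)
      obtain ⟨i, hi, hc⟩ := h2
      have h3 := (hps.pow h0 he D.depth).mul h0 (hbs.pow h0 he D.e)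
      have h4 := hi.unique hϖ hn D.e_dvd h3
      obtain rfl : i = 0 := by rw [h4]; ring
      rw [h1]
      simpa using hc
    · intro x hx
      have hx' := (D.mem_maxIdealL_iff hϖ hn x).1 hx
      exact radPow_sub_mem (radPow_mul_mem h0 (by omega) hx' hz'm)
        (radPow_mul_mem h0 (by omega) hz'm hx')
  -- an element of `F[β]` in `radPow ϖ n e r` is `q ^ r` times an integer; as `z' v = 0`, the value
  -- of `z'` at `y v` is that of a commutator at `v`
  refine mem_radPow_of_forall_chain he h0 fun r x hx => ?_
  obtain ⟨y, hyL, hyr, rfl⟩ := hcyc r x hx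
  obtain ⟨i, hi, hcomm⟩ := zpow_mem hqS r
  obtain rfl : i = r := by
    simpa using hi.unique hϖ hn D.e_dvd (hqs.zpow h0 he r)
  have hq : ((q ^ i)⁻¹ : GL (Fin n) F).1 * y ∈ radPow ϖ n D.e 0 :=
    radPow_mul_mem h0 (by omega) hi.2 hyr
  have hqL : ((q ^ i)⁻¹ : GL (Fin n) F).1 * y ∈ fieldL D.β :=
    mul_mem (coe_mem_of_mem_torus (inv_mem (zpow_mem hqL _))) hyL
  have h5 := hint ⟨⟨_, hqL⟩, (D.isIntegral_iff hϖ hn ⟨_, hqL⟩).2 hq⟩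
  have h6 := hmul _ _ i 0 hi.1 hq hcomm (by simpa using h5)
  rw [← Matrix.mul_assoc, Units.mul_inv, Matrix.one_mul, add_zero] at h6
  have h7 : z' *ᵥ (y *ᵥ v) = (-(y * z' - z' * y)) *ᵥ v := by
    rw [neg_sub, Matrix.sub_mulVec, ← Matrix.mulVec_mulVec, ← Matrix.mulVec_mulVec, hz'v,
      Matrix.mulVec_zero, sub_zero]
  rw [h7]
  exact mulVec_mem_chain h0 (by omega) (radPow_neg_mem h6) hv

end SupercuspidalDatum

/-! ### Integral matrices congruent to the identity -/

section Congruence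

variable {F : Type u} [Field F] [ValuativeRel F] [TopologicalSpace F]
  [IsNonarchimedeanLocalField F] {ϖ : 𝒪[F]} {ι : Type*} [Fintype ι] [DecidableEq ι]

/-- A matrix congruent to the identity modulo `ϖ` is invertible over the integers. -/
theorem exists_unit_of_forall_mem_fracIdeal_one (hϖ : Irreducible ϖ) {x : Matrix ι ι F}
    (hx : ∀ a b, x a b ∈ fracIdeal ϖ 1) :
    ∃ g : GL ι F, (g : Matrix ι ι F) = 1 + x ∧
      ∀ a b, ((g⁻¹ : GL ι F) : Matrix ι ι F) a b ∈ 𝒪[F] := by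
  choose z hz using hx
  let X : Matrix ι ι 𝒪[F] := 1 + Matrix.of fun a b => ϖ * z a b
  have hX : IsUnit X := by
    rw [Matrix.isUnit_iff_isUnit_det, ← IsLocalRing.residue_ne_zero_iff_isUnit, RingHom.map_det]
    have : (IsLocalRing.residue 𝒪[F]).mapMatrix X = 1 := by
      rw [map_add, map_one, add_eq_left]
      ext a b
      have h0 : IsLocalRing.residue 𝒪[F] ϖ = 0 :=
        (IsLocalRing.residue_eq_zero_iff _).2 ((IsLocalRing.mem_maximalIdeal _).2 hϖ.not_isUnit)
      simp [h0]
    rw [this, Matrix.det_one]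
    exact one_ne_zero
  obtain ⟨Y, hY⟩ := hX
  refine ⟨Units.map (algebraMap 𝒪[F] F).mapMatrix.toMonoidHom Y, ?_, fun a b => ?_⟩
  · change (algebraMap 𝒪[F] F).mapMatrix (Y : Matrix ι ι 𝒪[F]) = _
    rw [hY, map_add, map_one]
    congr 1
    ext a b
    rw [hz]
    simp
    rfl
  · rw [← map_inv]
    exact ((Y⁻¹ : (Matrix ι ι 𝒪[F])ˣ) : Matrix ι ι 𝒪[F]) a b |>.2

/-- For `i ≥ 1` every element of `1 + radPow ϖ n e i` is invertible, with inverse of the same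
form. -/
theorem exists_mem_unitFiltration (hϖ : Irreducible ϖ) {n e : ℕ} (hn : 0 < n) (he : e ∣ n) {i : ℕ}
    (hi : 0 < i) {x : Matrix (Fin n) (Fin n) F} (hx : x ∈ radPow ϖ n e i) :
    ∃ g ∈ unitFiltration ϖ hϖ.ne_zero n e i, (g : Matrix (Fin n) (Fin n) F) = 1 + x := by
  have he' := Nat.pos_of_dvd_of_pos he hn
  -- a high power of `x` has entries in `ϖ ^ 2 𝒪`, and `1 + x` divides `1 - (-x) ^ (3 * e)`
  have hx1 := radPow_anti hϖ.ne_zero (i' := 1) (by omega) hx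
  have hpow : ∀ a b, (-(-x) ^ (3 * e)) a b ∈ fracIdeal ϖ 2 := by
    intro a b
    have h1 := radPow_neg_mem (radPow_pow_mem he' hϖ.ne_zero (radPow_neg_mem hx1) (3 * e))
    refine fracIdeal_anti hϖ.ne_zero ?_ (h1 a b)
    by_contra! h
    have h2 := (ceil_div_le_iff he' (k := 1)).1 (Int.lt_add_one_iff.1 h)
    have h3 : ((b.val / (n / e) : ℕ) : ℤ) < e := by exact_mod_cast block_lt hn he b
    have h4 := Int.natCast_nonneg (a.val / (n / e))
    have h5 : ((3 * e : ℕ) : ℤ) = 3 * e := by push_cast; ring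
    rw [h5] at h2
    linarith
  obtain ⟨g, hg, hg'⟩ := exists_unit_of_forall_mem_fracIdeal_one hϖ
    (fun a b => fracIdeal_anti hϖ.ne_zero (by norm_num) (hpow a b))
  have hginv : ((g⁻¹ : GL (Fin n) F) : Matrix (Fin n) (Fin n) F) ∈ radPow ϖ n e 0 := by
    have h1 : ((g⁻¹ : GL (Fin n) F) : Matrix (Fin n) (Fin n) F)
        = 1 - ((g⁻¹ : GL (Fin n) F) : Matrix (Fin n) (Fin n) F) * (-(-x) ^ (3 * e)) := by
      have h2 := Units.inv_mul g
      rw [hg, Matrix.mul_add, Matrix.mul_one] at h2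
      exact eq_sub_of_add_eq h2
    rw [h1]
    refine radPow_sub_mem (one_mem_radPow he' hϖ.ne_zero)
      (mem_radPow_of_forall_mem_fracIdeal hϖ.ne_zero hn he (t := 2) (by omega) fun a b => ?_)
    rw [Matrix.mul_apply]
    exact fracIdeal_sum_mem fun c _ =>
      fracIdeal_mul_mem hϖ.ne_zero (by simp) (mem_fracIdeal_zero.2 (hg' a c)) (hpow c b)
  set s := ∑ k ∈ Finset.range (3 * e), (-x) ^ k with hs
  have hsmem : s ∈ radPow ϖ n e 0 := by
    refine Finset.sum_induction _ (· ∈ radPow ϖ n e 0) (fun _ _ => radPow_add_mem)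
      zero_mem_radPow fun k _ => ?_
    exact radPow_anti hϖ.ne_zero (by positivity)
      (radPow_pow_mem he' hϖ.ne_zero (radPow_neg_mem hx1) k)
  obtain ⟨y, hy, hmul⟩ : ∃ y ∈ radPow ϖ n e 0, (1 + x) * y = 1 := by
    refine ⟨s * ((g⁻¹ : GL (Fin n) F) : Matrix (Fin n) (Fin n) F),
      radPow_mul_mem (i := 0) (j := 0) hϖ.ne_zero (by simp) hsmem hginv, ?_⟩
    rw [← Matrix.mul_assoc]
    have h1 := mul_neg_geom_sum (-x) (3 * e)
    rw [sub_neg_eq_add] at h1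
    rw [h1, sub_eq_add_neg, ← hg, Units.mul_inv]
  have hmul' : y * (1 + x) = 1 := mul_eq_one_comm.1 hmul
  refine ⟨⟨1 + x, y, hmul, hmul'⟩, ⟨?_, ?_⟩, rfl⟩
  · simpa using hx
  · change y - 1 ∈ radPow ϖ n e i
    have h1 : y - 1 = -(y * x) := by
      rw [Matrix.mul_add, Matrix.mul_one] at hmul'
      rw [sub_eq_iff_eq_add, neg_add_eq_sub, eq_sub_iff_add_eq]
      exact hmul'
    rw [h1]
    exact radPow_neg_mem (radPow_mul_mem hϖ.ne_zero (by simp) hy hx)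

/-- A subgroup of `GL(F)` consisting of integral matrices which contains a principal congruence
subgroup is open and compact. -/
theorem isOpen_and_isCompact_of_integral (hϖ : ϖ ≠ 0) (K : Subgroup (GL ι F))
    (hK : ∀ g ∈ K, ∀ a b, (g : Matrix ι ι F) a b ∈ 𝒪[F]) (t : ℤ)
    (ht : ∀ g : GL ι F, (∀ a b, ((g : Matrix ι ι F) - 1) a b ∈ fracIdeal ϖ t) →
      (∀ a b, (((g⁻¹ : GL ι F) : Matrix ι ι F) - 1) a b ∈ fracIdeal ϖ t) → g ∈ K) :
    IsOpen (K : Set (GL ι F)) ∧ IsCompact (K : Set (GL ι F)) := by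
  have hopen : IsOpen (K : Set (GL ι F)) := by
    refine Subgroup.isOpen_of_mem_nhds K (g := 1) ?_
    have hent : ∀ a b, Continuous fun M : Matrix ι ι F => (M - 1) a b := fun a b =>
      ((continuous_id.sub continuous_const : Continuous fun M : Matrix ι ι F => M - 1).matrix_elem
        a b)
    have h1 : IsOpen {M : Matrix ι ι F | ∀ a b, (M - 1) a b ∈ fracIdeal ϖ t} := by
      simp only [Set.ofPred_forall]
      exact isOpen_iInter_of_finite fun a => isOpen_iInter_of_finite fun b =>
        (isOpen_fracIdeal hϖ t).preimage (hent a b)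
    have h2 := (h1.preimage Units.continuous_val).inter
      (h1.preimage (Units.continuous_val.comp (continuous_inv (G := GL ι F))))
    refine Filter.mem_of_superset (h2.mem_nhds ⟨?_, ?_⟩) fun g hg => ht g hg.1 hg.2
    · simpa using fun _ _ => fracIdeal_zero_mem _ _
    · simpa using fun _ _ => fracIdeal_zero_mem _ _
  refine ⟨hopen, ?_⟩
  have hO : IsCompact (𝒪[F] : Set F) := IsNonarchimedeanLocalField.isCompact_closedBall F 1
  have hM : IsCompact {M : Matrix ι ι F | ∀ a b, M a b ∈ 𝒪[F]} := by
    have h1 : {M : Matrix ι ι F | ∀ a b, M a b ∈ 𝒪[F]}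
        = Set.univ.pi fun _ : ι => Set.univ.pi fun _ : ι => (𝒪[F] : Set F) := by
      ext M
      exact ⟨fun h a _ b _ => h a b, fun h a b => h a trivial b trivial⟩
    rw [h1]
    exact isCompact_univ_pi fun _ : ι => isCompact_univ_pi fun _ : ι => hO
  have hT2 : T2Space F := by
    let := IsTopologicalAddGroup.rightUniformSpace F
    have := isUniformAddGroup_of_addCommGroup (G := F)
    infer_instance
  have hMT2 : T2Space (Matrix ι ι F) := inferInstanceAs (T2Space (ι → ι → F))
  have hC := Units.isClosedEmbedding_embedProduct.isCompact_preimage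
    (hM.prod (hM.image MulOpposite.continuous_op))
  refine hC.of_isClosed_subset (Subgroup.isClosed_of_isOpen K hopen) fun g hg => ?_
  exact ⟨hK g hg, ⟨_, hK _ (inv_mem hg), rfl⟩⟩

end Congruence

/-! ### Commutators in the unit filtration -/

/-- The value of `Tr β (⁅g, h⁆ - 1)` in terms of that of the additive commutator. -/
theorem trace_commutator {F : Type u} [Field F] {n : ℕ} (β : Matrix (Fin n) (Fin n) F)
    (g h : GL (Fin n) F) :
    (β * (((⁅g, h⁆ : GL (Fin n) F) : Matrix (Fin n) (Fin n) F) - 1)).trace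
      = (β * ((g : Matrix (Fin n) (Fin n) F) * h - h * g)).trace
        + (β * ((g : Matrix (Fin n) (Fin n) F) * h - h * g) *
          (((g⁻¹ * h⁻¹ : GL (Fin n) F) : Matrix (Fin n) (Fin n) F) - 1)).trace := by
  have h1 : ((⁅g, h⁆ : GL (Fin n) F) : Matrix (Fin n) (Fin n) F) - 1
      = ((g : Matrix (Fin n) (Fin n) F) * h - h * g) *
        ((g⁻¹ * h⁻¹ : GL (Fin n) F) : Matrix (Fin n) (Fin n) F) := by
    rw [Matrix.sub_mul, ← Units.val_mul, ← Units.val_mul, ← Units.val_mul, ← Units.val_mul]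
    congr 1
    · rw [commutatorElement_def, ← mul_assoc]
    · rw [show h * g * (g⁻¹ * h⁻¹) = 1 by group, Units.val_one]
  rw [h1, ← Matrix.trace_add, Matrix.mul_sub (β * _), Matrix.mul_one, Matrix.mul_assoc]
  congr 1
  abel

section UnitFiltration

variable {F : Type u} [Field F] [ValuativeRel F] {ϖ : 𝒪[F]} {h0 : ϖ ≠ 0} {n e : ℕ}

theorem unitFiltration_anti {i j : ℕ} (h : i ≤ j) :
    unitFiltration ϖ h0 n e j ≤ unitFiltration ϖ h0 n e i :=
  fun _ hg => ⟨radPow_anti h0 (by exact_mod_cast h) hg.1, radPow_anti h0 (by exact_mod_cast h) hg.2⟩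

theorem coe_mem_radPow_zero (he : 0 < e) {i : ℕ} {g : GL (Fin n) F}
    (hg : g ∈ unitFiltration ϖ h0 n e i) : (g : Matrix (Fin n) (Fin n) F) ∈ radPow ϖ n e 0 := by
  have := radPow_add_mem (radPow_anti h0 (by positivity) hg.1) (one_mem_radPow he h0)
  rwa [sub_add_cancel] at this

theorem mem_unitFiltration_of_sub_mem (he : 0 < e) {i k l : ℕ} {g h : GL (Fin n) F}
    (hg : g ∈ unitFiltration ϖ h0 n e k) (hh : h ∈ unitFiltration ϖ h0 n e l)
    (hgh : (h : Matrix (Fin n) (Fin n) F) - (g : Matrix (Fin n) (Fin n) F) ∈ radPow ϖ n e i) :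
    g⁻¹ * h ∈ unitFiltration ϖ h0 n e i := by
  constructor
  · have : ((g⁻¹ * h : GL (Fin n) F) : Matrix (Fin n) (Fin n) F) - 1
        = ((g⁻¹ : GL (Fin n) F) : Matrix (Fin n) (Fin n) F) *
          ((h : Matrix (Fin n) (Fin n) F) - (g : Matrix (Fin n) (Fin n) F)) := by
      rw [Matrix.mul_sub, Units.inv_mul, Units.val_mul]
    rw [this]
    exact radPow_mul_mem h0 (by simp) (coe_mem_radPow_zero he (inv_mem hg)) hgh
  · have : (((g⁻¹ * h)⁻¹ : GL (Fin n) F) : Matrix (Fin n) (Fin n) F) - 1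
        = -(((h⁻¹ : GL (Fin n) F) : Matrix (Fin n) (Fin n) F) *
          ((h : Matrix (Fin n) (Fin n) F) - (g : Matrix (Fin n) (Fin n) F))) := by
      rw [Matrix.mul_sub, Units.inv_mul, _root_.mul_inv_rev, inv_inv, Units.val_mul, neg_sub]
    rw [this]
    exact radPow_neg_mem (radPow_mul_mem h0 (by simp) (coe_mem_radPow_zero he (inv_mem hh)) hgh)

theorem mul_sub_mul_mem {i j : ℕ} {g h : GL (Fin n) F} (hg : g ∈ unitFiltration ϖ h0 n e i)
    (hh : h ∈ unitFiltration ϖ h0 n e j) :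
    (g : Matrix (Fin n) (Fin n) F) * h - h * g ∈ radPow ϖ n e (i + j) := by
  have : (g : Matrix (Fin n) (Fin n) F) * h - h * g = ((g : Matrix (Fin n) (Fin n) F) - 1) *
      ((h : Matrix (Fin n) (Fin n) F) - 1)
      - ((h : Matrix (Fin n) (Fin n) F) - 1) * ((g : Matrix (Fin n) (Fin n) F) - 1) := by
    noncomm_ring
  rw [this]
  exact radPow_sub_mem (radPow_mul_mem h0 le_rfl hg.1 hh.1)
    (radPow_mul_mem h0 (by omega) hh.1 hg.1)

theorem commutator_mem_unitFiltration (he : 0 < e) {i j k : ℕ} (hk : k ≤ i + j)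
    {g h : GL (Fin n) F} (hg : g ∈ unitFiltration ϖ h0 n e i)
    (hh : h ∈ unitFiltration ϖ h0 n e j) : ⁅g, h⁆ ∈ unitFiltration ϖ h0 n e k := by
  have h1 : ∀ m, m ∈ unitFiltration ϖ h0 n e i → m ∈ unitFiltration ϖ h0 n e 0 :=
    fun m hm => unitFiltration_anti (Nat.zero_le _) hm
  have h2 : ∀ m, m ∈ unitFiltration ϖ h0 n e j → m ∈ unitFiltration ϖ h0 n e 0 :=
    fun m hm => unitFiltration_anti (Nat.zero_le _) hm
  have hgi := mul_sub_mul_mem (inv_mem hg) (inv_mem hh)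
  have h5 : ⁅g, h⁆ = (h⁻¹ * g⁻¹)⁻¹ * (g⁻¹ * h⁻¹) := by
    rw [commutatorElement_def]
    group
  rw [h5]
  refine mem_unitFiltration_of_sub_mem he (mul_mem (h2 _ (inv_mem hh)) (h1 _ (inv_mem hg)))
    (mul_mem (h1 _ (inv_mem hg)) (h2 _ (inv_mem hh))) ?_
  rw [Units.val_mul, Units.val_mul]
  exact radPow_anti h0 (by exact_mod_cast hk) hgi

end UnitFiltration

/-! ### Representations of Heisenberg type -/

section Heisenberg

variable {G : Type u} [Group G] {W : Type v} [AddCommGroup W] [Module ℂ W]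

/-- Let `H` be a subgroup of `G` which contains all commutators and acts on `W` by the character
`θ`, and let `θt` be a character of `B ≥ H` extending `θ`. If no element of `B` outside `H` is
orthogonal to `G` for the commutator pairing `(x, b) ↦ θ ⁅x, b⁆`, then `W` contains `θt`.

The average over `B / H` of the operators `θt(b)⁻¹ ρ(b)` has values on which `B` acts by `θt`.
Conjugation by `x : G` multiplies its summand at `b` by `θ ⁅x, b⁆`; as these characters of `G` are
distinct, hence linearly independent, the average does not vanish. -/
theorem exists_eigenvector_of_commutator_nondegenerate [Nontrivial W] (ρ : Representation ℂ G W)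
    {H B : Subgroup G} (hHB : H ≤ B) (hfin : H.FiniteIndex) (θ : H →* ℂˣ)
    (hθ : ∀ (h : H) (x : W), ρ h x = (θ h : ℂ) • x) (hcomm : ∀ x y : G, ⁅x, y⁆ ∈ H)
    (hnd : ∀ b ∈ B, (∀ x, θ ⟨⁅x, b⁆, hcomm x b⟩ = 1) → b ∈ H)
    (θt : B →* ℂˣ) (hθt : ∀ h : H, θt ⟨h, hHB h.2⟩ = θ h) :
    ∃ x : W, x ≠ 0 ∧ ∀ b : B, ρ b x = (θt b : ℂ) • x := by
  have hmulρ : ∀ x y (v : W), ρ x (ρ y v) = ρ (x * y) v := fun x y v => by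
    rw [map_mul]; rfl
  have hconj_mem : ∀ x, ∀ h ∈ H, x * h * x⁻¹ ∈ H := fun x h hh => by
    have := mul_mem (hcomm x h) hh
    rwa [commutatorElement_def, inv_mul_cancel_right] at this
  have hconj : ∀ x (h : H), θ ⟨x * h * x⁻¹, hconj_mem x h h.2⟩ = θ h := by
    intro x h
    obtain ⟨v, hv⟩ := exists_ne (0 : W)
    have h1 := hθ ⟨x * h * x⁻¹, hconj_mem x h h.2⟩ (ρ x v)
    rw [hmulρ, inv_mul_cancel_right, ← hmulρ, hθ, map_smul] at h1
    have hv' : ρ x v ≠ 0 := fun h0 => hv (by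
      have := hmulρ x⁻¹ x v
      rwa [h0, map_zero, inv_mul_cancel, map_one, eq_comm] at this)
    exact (Units.ext (smul_left_injective ℂ hv' h1)).symm
  -- the character `x ↦ θ ⁅x, b⁆`
  let χ : G → G →* ℂ := fun b =>
    { toFun := fun x => θ ⟨⁅x, b⁆, hcomm x b⟩
      map_one' := by
        have : (⟨⁅(1 : G), b⁆, hcomm 1 b⟩ : H) = 1 := Subtype.ext (by simp)
        rw [this, map_one, Units.val_one]
      map_mul' := fun x y => by
        have : (⟨⁅x * y, b⁆, hcomm _ b⟩ : H)
            = ⟨x * ⁅y, b⁆ * x⁻¹, hconj_mem x _ (hcomm y b)⟩ * ⟨⁅x, b⁆, hcomm x b⟩ :=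
          Subtype.ext (by simp only [Subgroup.coe_mul, commutatorElement_def]; group)
        rw [this, map_mul, hconj x ⟨⁅y, b⁆, hcomm y b⟩, mul_comm, Units.val_mul] }
  have hχ : ∀ b ∈ B, ∀ b' ∈ B, χ b = χ b' → b⁻¹ * b' ∈ H := by
    intro b hb b' hb' h
    refine hnd _ (mul_mem (inv_mem hb) hb') fun x => ?_
    have h1 : (θ ⟨⁅x, b⁆, hcomm x b⟩ : ℂ) = θ ⟨⁅x, b'⁆, hcomm x b'⟩ := DFunLike.congr_fun h x
    have h2 : (⟨⁅x, b'⁆, hcomm x b'⟩ : H)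
        = ⟨⁅x, b⁆, hcomm x b⟩ * ⟨b * ⁅x, b⁻¹ * b'⁆ * b⁻¹, hconj_mem b _ (hcomm x _)⟩ :=
      Subtype.ext (by simp only [Subgroup.coe_mul, commutatorElement_def]; group)
    rw [h2, map_mul, hconj b ⟨⁅x, b⁻¹ * b'⁆, hcomm x _⟩] at h1
    exact (mul_eq_left.1 (Units.ext h1).symm)
  have : Finite (B ⧸ H.subgroupOf B) := inferInstance
  have := Fintype.ofFinite (B ⧸ H.subgroupOf B)
  let f : B → W →ₗ[ℂ] W := fun b => ((θt b)⁻¹ : ℂ) • ρ b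
  have hf : ∀ b b' : B, b⁻¹ * b' ∈ H.subgroupOf B → f b = f b' := by
    intro b b' h
    obtain ⟨h', rfl⟩ : ∃ h' : B, b' = b * h' := ⟨b⁻¹ * b', by group⟩
    rw [inv_mul_cancel_left, Subgroup.mem_subgroupOf] at h
    ext v
    have h1 : θt h' = θ ⟨h', h⟩ := hθt ⟨h', h⟩
    simp only [f, LinearMap.smul_apply, map_mul, Subgroup.coe_mul, Module.End.mul_apply,
      hθ ⟨h', h⟩, h1, map_smul, smul_smul, Units.val_mul]
    congr 1
    field_simp
  have hfmul : ∀ (b b' : B) v, f b (f b' v) = f (b * b') v := by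
    intro b b' v
    simp only [f, LinearMap.smul_apply, map_mul, Subgroup.coe_mul, Module.End.mul_apply,
      map_smul, smul_smul, Units.val_mul, mul_inv]
    rw [mul_comm]
  -- the average over `B / H`, up to a scalar
  let P : W → W := fun v => ∑ q : B ⧸ H.subgroupOf B, f q.out v
  have hP : ∀ (b : B) v, f b (P v) = P v := by
    intro b v
    simp only [P, map_sum, hfmul]
    refine (Finset.sum_congr rfl fun q _ => ?_).trans
      (Equiv.sum_comp (MulAction.toPerm b) fun q : B ⧸ H.subgroupOf B => f q.out v)
    congr 1
    refine hf _ _ (QuotientGroup.eq.1 ?_)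
    rw [MulAction.toPerm_apply, QuotientGroup.out_eq',
      ← MulAction.Quotient.coe_smul_out (H.subgroupOf B) b q]
    rfl
  by_contra! hcon
  obtain ⟨v, hv⟩ := exists_ne (0 : W)
  have hP0 : ∀ v, P v = 0 := by
    intro v
    by_contra h
    obtain ⟨b, hb⟩ := hcon _ h
    refine hb ?_
    conv_rhs => rw [← hP b v]
    simp [f]
  have hsum : ∀ x, ∑ q : B ⧸ H.subgroupOf B, χ (q.out : B) x • f q.out v = 0 := by
    intro x
    have h1 := congrArg (ρ x) (hP0 (ρ x⁻¹ v))
    simp only [P, map_sum, map_zero] at h1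
    rw [← h1]
    refine Finset.sum_congr rfl fun q _ => ?_
    simp only [f, LinearMap.smul_apply, map_smul, hmulρ]
    rw [smul_comm]
    congr 1
    have h2 : x * ((q.out : B) * x⁻¹) = ⁅x, (q.out : G)⁆ * (q.out : B) := by
      rw [commutatorElement_def]
      group
    rw [h2, ← hmulρ, hθ ⟨_, hcomm x _⟩]
    rfl
  have hli : LinearIndependent ℂ fun q : B ⧸ H.subgroupOf B => (χ (q.out : B) : G → ℂ) := by
    refine (linearIndependent_monoidHom G ℂ).comp (fun q : B ⧸ H.subgroupOf B => χ (q.out : B)) ?_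
    intro q q' h
    have h1 : (q.out)⁻¹ * q'.out ∈ H.subgroupOf B :=
      Subgroup.mem_subgroupOf.2 (hχ _ q.out.2 _ q'.out.2 h)
    rw [← QuotientGroup.out_eq' q, ← QuotientGroup.out_eq' q']
    exact QuotientGroup.eq.2 h1
  have hne : f (Quotient.out ((1 : B) : B ⧸ H.subgroupOf B)) v ≠ 0 := by
    rw [← hf 1 _ (QuotientGroup.eq.1 (QuotientGroup.out_eq' _).symm)]
    simpa [f] using hv
  obtain ⟨l, hl⟩ := not_forall.1 (mt (Module.forall_dual_apply_eq_zero_iff ℂ _).1 hne)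
  refine hl (Fintype.linearIndependent_iff.1 hli
    (fun q : B ⧸ H.subgroupOf B => l (f q.out v)) (funext fun x => ?_) _)
  have h1 := congrArg l (hsum x)
  simp only [map_sum, map_smul, map_zero, smul_eq_mul] at h1
  simp only [Finset.sum_apply, Pi.smul_apply, smul_eq_mul, Pi.zero_apply, mul_comm _ (χ _ x)]
  exact h1

end Heisenberg

/-! ### Simple characters and the representation of `J¹` -/

namespace SupercuspidalDatum

variable {F : Type u} [Field F] [ValuativeRel F] {ϖ : 𝒪[F]} {h0 : ϖ ≠ 0}
  {ψ : AddChar F Circle} {n : ℕ} (D : SupercuspidalDatum.{u, w} ϖ h0 ψ n)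

theorem H1_le_J1 : D.H1 ≤ D.J1 := sup_le_sup_left (unitFiltration_anti (by omega)) _

theorem unitFiltration_le_H1 {i : ℕ} (hi : D.depth / 2 + 1 ≤ i) :
    unitFiltration ϖ h0 n D.e i ≤ D.H1 := (unitFiltration_anti hi).trans le_sup_right

/-- `θ` is trivial on an element `x` of `U_𝔄(⌊j/2⌋ + 1)` with `ψ(Tr β(x - 1)) = 1`. -/
theorem θ_eq_one {x : GL (Fin n) F} (hx : x ∈ unitFiltration ϖ h0 n D.e (D.depth / 2 + 1))
    (hx' : x ∈ D.H1) (h : ψ (D.β * ((x : Matrix (Fin n) (Fin n) F) - 1)).trace = 1) :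
    D.θ ⟨x, hx'⟩ = 1 := by
  apply Units.ext
  rw [D.θ_eq ⟨x, hx'⟩ hx, h]
  simp

theorem mem_H1_of_mem {m : ℕ} (hm : D.depth = 2 * m) {x : GL (Fin n) F}
    (hx : x ∈ unitFiltration ϖ h0 n D.e (m + 1)) : x ∈ D.H1 :=
  D.unitFiltration_le_H1 (by omega) hx

theorem θ_eq_one_of_mem (hϖ : Irreducible ϖ) (hψ : IsLevelOne ψ) (hn : 0 < n) {x : GL (Fin n) F}
    (hx : x ∈ unitFiltration ϖ h0 n D.e (D.depth + 1)) (hx' : x ∈ D.H1) :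
    D.θ ⟨x, hx'⟩ = 1 :=
  D.θ_eq_one (unitFiltration_anti (by omega) hx) hx' (hψ.map_trace_eq_one hϖ hn D.e_dvd
    (radPow_mul_mem h0 (by push_cast; omega) D.mem_radPow hx.1))

theorem conj_mem_unitFiltration (hn : 0 < n) {i : ℕ} {g x : GL (Fin n) F}
    (hg : g ∈ unitFiltration ϖ h0 n D.e 1) (hx : x ∈ unitFiltration ϖ h0 n D.e i) :
    g * x * g⁻¹ ∈ unitFiltration ϖ h0 n D.e i := by
  have h1 := commutator_mem_unitFiltration (D.e_pos hn) (k := i) (by omega) hg hx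
  have h2 := mul_mem h1 hx
  rwa [commutatorElement_def, inv_mul_cancel_right] at h2

theorem unitsL_commutator {l l' : GL (Fin n) F} (hl : l ∈ unitsL D.β) (hl' : l' ∈ unitsL D.β) :
    ⁅l, l'⁆ = 1 := by
  rw [commutatorElement_eq_one_iff_mul_comm]
  exact Units.ext (commute_of_mem_fieldL (coe_mem_of_mem_torus (unitsL_le_torus _ hl))
    (coe_mem_of_mem_torus (unitsL_le_torus _ hl')))

variable [TopologicalSpace F] [IsNonarchimedeanLocalField F]

theorem unitsL_le_unitFiltration_one (hϖ : Irreducible ϖ) (hn : 0 < n) :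
    unitsL D.β ≤ unitFiltration ϖ h0 n D.e 1 := fun _ hg => ((D.mem_unitsL_iff hϖ hn).1 hg).2

theorem exists_mul_of_mem_sup (hϖ : Irreducible ϖ) (hn : 0 < n) {i : ℕ} {x : GL (Fin n) F}
    (hx : x ∈ unitsL D.β ⊔ unitFiltration ϖ h0 n D.e i) :
    ∃ l ∈ unitsL D.β, ∃ y ∈ unitFiltration ϖ h0 n D.e i, x = l * y := by
  have hle : unitsL D.β ≤ Subgroup.normalizer (unitFiltration ϖ h0 n D.e i : Set _) := by
    have key : ∀ l ∈ unitsL D.β, ∀ y ∈ unitFiltration ϖ h0 n D.e i,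
        l * y * l⁻¹ ∈ unitFiltration ϖ h0 n D.e i := by
      intro l hl y hy
      have h1 := commutator_mem_unitFiltration (D.e_pos hn) (i := 1) (j := i) (k := i) (by omega)
        (D.unitsL_le_unitFiltration_one hϖ hn hl) hy
      have h2 := mul_mem h1 hy
      rwa [commutatorElement_def, inv_mul_cancel_right] at h2
    intro l hl
    rw [Subgroup.mem_normalizer_iff]
    refine fun y => ⟨key l hl y, fun hy => ?_⟩
    have := key l⁻¹ (inv_mem hl) _ hy
    simpa [mul_assoc] using this
  rw [← SetLike.mem_coe, Subgroup.coe_mul_of_left_le_normalizer_right _ _ hle] at hx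
  obtain ⟨l, hl, y, hy, rfl⟩ := hx
  exact ⟨l, hl, y, hy, rfl⟩

theorem J1_le_unitFiltration_one (hϖ : Irreducible ϖ) (hn : 0 < n) :
    D.J1 ≤ unitFiltration ϖ h0 n D.e 1 :=
  sup_le (D.unitsL_le_unitFiltration_one hϖ hn)
    (unitFiltration_anti (by have := D.depth_pos; omega))

variable {m : ℕ}

theorem exists_mul_of_mem_J1 (hm : D.depth = 2 * m) (hϖ : Irreducible ϖ) (hn : 0 < n)
    {x : GL (Fin n) F} (hx : x ∈ D.J1) :
    ∃ l ∈ unitsL D.β, ∃ y ∈ unitFiltration ϖ h0 n D.e m, x = l * y := by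
  have h1 : (D.depth + 1) / 2 = m := by omega
  have hx' : x ∈ unitsL D.β ⊔ unitFiltration ϖ h0 n D.e ((D.depth + 1) / 2) := hx
  rw [h1] at hx'
  exact D.exists_mul_of_mem_sup hϖ hn hx'

theorem exists_mul_of_mem_H1 (hm : D.depth = 2 * m) (hϖ : Irreducible ϖ) (hn : 0 < n)
    {x : GL (Fin n) F} (hx : x ∈ D.H1) :
    ∃ l ∈ unitsL D.β, ∃ y ∈ unitFiltration ϖ h0 n D.e (m + 1), x = l * y := by
  have h1 : D.depth / 2 = m := by omega
  have hx' : x ∈ unitsL D.β ⊔ unitFiltration ϖ h0 n D.e (D.depth / 2 + 1) := hx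
  rw [h1] at hx'
  exact D.exists_mul_of_mem_sup hϖ hn hx'

theorem commutator_mem (hm : D.depth = 2 * m) (hϖ : Irreducible ϖ) (hn : 0 < n)
    {x y : GL (Fin n) F} (hx : x ∈ D.J1) (hy : y ∈ D.J1) :
    ⁅x, y⁆ ∈ unitFiltration ϖ h0 n D.e (m + 1) := by
  have he := D.e_pos hn
  have hU := D.unitsL_le_unitFiltration_one hϖ hn
  have hy1 := D.J1_le_unitFiltration_one hϖ hn hy
  obtain ⟨l, hl, a, ha, rfl⟩ := D.exists_mul_of_mem_J1 hm hϖ hn hx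
  obtain ⟨l', hl', b, hb, rfl⟩ := D.exists_mul_of_mem_J1 hm hϖ hn hy
  have h1 : ⁅l * a, l' * b⁆ = l * ⁅a, l' * b⁆ * l⁻¹ * (⁅l, l'⁆ * (l' * ⁅l, b⁆ * l'⁻¹)) := by
    simp only [commutatorElement_def]
    group
  rw [h1, D.unitsL_commutator hl hl', one_mul]
  exact mul_mem
    (D.conj_mem_unitFiltration hn (hU hl) (commutator_mem_unitFiltration he le_rfl ha hy1))
    (D.conj_mem_unitFiltration hn (hU hl')
      (commutator_mem_unitFiltration he (by omega) (hU hl) hb))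

/-- The commutators of `U_L(1)` with `U_𝔄(m)` lie in the kernel of `θ`, as `Tr β(y - l y l⁻¹) = 0`
for `l ∈ L`. -/
theorem θ_commutator_unitsL (hm : D.depth = 2 * m) (hϖ : Irreducible ϖ) (hψ : IsLevelOne ψ)
    (hn : 0 < n) {a l : GL (Fin n) F} (ha : a ∈ unitFiltration ϖ h0 n D.e m)
    (hl : l ∈ unitsL D.β) (h : ⁅a, l⁆ ∈ D.H1) : D.θ ⟨⁅a, l⁆, h⟩ = 1 := by
  have he := D.e_pos hn
  have hl1 := D.unitsL_le_unitFiltration_one hϖ hn hl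
  refine D.θ_eq_one ?_ h ?_
  · exact commutator_mem_unitFiltration he (by omega) ha hl1
  have hβl := commute_of_mem_fieldL (gen D.β).2
    (coe_mem_of_mem_torus (inv_mem (unitsL_le_torus _ hl)))
  change D.β * _ = _ * D.β at hβl
  have h1 : D.β * (((⁅a, l⁆ : GL (Fin n) F) : Matrix (Fin n) (Fin n) F) - 1)
      = D.β * ((a : Matrix (Fin n) (Fin n) F) -
          l * (a : Matrix (Fin n) (Fin n) F) * ((l⁻¹ : GL (Fin n) F) : Matrix (Fin n) (Fin n) F))
        + D.β * (((a : Matrix (Fin n) (Fin n) F) * l - l * a) *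
          ((((a⁻¹ : GL (Fin n) F) : Matrix (Fin n) (Fin n) F) - 1) *
            ((l⁻¹ : GL (Fin n) F) : Matrix (Fin n) (Fin n) F))) := by
    rw [← Matrix.mul_add]
    congr 1
    simp only [commutatorElement_def, Units.val_mul, Matrix.sub_mul, Matrix.mul_sub,
      Matrix.mul_assoc, Matrix.one_mul, Units.mul_inv, Matrix.mul_one, Units.mul_inv_cancel_left]
    abel
  have h2 : (D.β * ((a : Matrix (Fin n) (Fin n) F) - l * (a : Matrix (Fin n) (Fin n) F) *
      ((l⁻¹ : GL (Fin n) F) : Matrix (Fin n) (Fin n) F))).trace = 0 := by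
    rw [Matrix.mul_sub, Matrix.trace_sub, sub_eq_zero, ← Matrix.mul_assoc, Matrix.trace_mul_comm _
      ((l⁻¹ : GL (Fin n) F) : Matrix (Fin n) (Fin n) F), ← Matrix.mul_assoc, ← Matrix.mul_assoc,
      ← hβl, Matrix.mul_assoc D.β, Units.inv_mul, Matrix.mul_one]
  rw [h1, Matrix.trace_add, h2, zero_add]
  refine hψ.map_trace_eq_one hϖ hn D.e_dvd (radPow_mul_mem (j := 2 * m + 1) h0 ?_ D.mem_radPow ?_)
  · rw [hm]; push_cast; omega
  · refine radPow_mul_mem (i := m + 1) (j := m) h0 (by omega) ?_ ?_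
    · exact_mod_cast mul_sub_mul_mem ha hl1
    · exact radPow_mul_mem (j := 0) h0 (by omega) ha.2 (coe_mem_radPow_zero he (inv_mem hl1))

/-- In even depth the simple character `θ` is invariant under `J¹`. -/
theorem θ_conj (hm : D.depth = 2 * m) (hϖ : Irreducible ϖ) (hψ : IsLevelOne ψ) (hn : 0 < n)
    {x h : GL (Fin n) F} (hx : x ∈ D.J1) (hh : h ∈ D.H1) :
    ∃ hxh : x * h * x⁻¹ ∈ D.H1, D.θ ⟨x * h * x⁻¹, hxh⟩ = D.θ ⟨h, hh⟩ := by
  have he := D.e_pos hn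
  obtain ⟨l, hl, a, ha, rfl⟩ := D.exists_mul_of_mem_J1 hm hϖ hn hx
  obtain ⟨l', hl', b, hb, rfl⟩ := D.exists_mul_of_mem_H1 hm hϖ hn hh
  have hl1 := D.unitsL_le_unitFiltration_one hϖ hn hl'
  have hLH : unitsL D.β ≤ D.H1 := le_sup_left
  have hc1 : ⁅a, l'⁆ ∈ D.H1 :=
    D.mem_H1_of_mem hm (commutator_mem_unitFiltration he le_rfl ha hl1)
  have hc2' : ⁅a, b⁆ ∈ unitFiltration ϖ h0 n D.e (D.depth + 1) :=
    commutator_mem_unitFiltration he (by omega) ha hb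
  have hc2 : ⁅a, b⁆ ∈ D.H1 := D.unitFiltration_le_H1 (by omega) hc2'
  have heq : l * a * (l' * b) * (l * a)⁻¹ = l * (⁅a, l'⁆ * (l' * (⁅a, b⁆ * b))) * l⁻¹ := by
    simp only [commutatorElement_def]
    group
  have hb' := D.mem_H1_of_mem hm hb
  have hmem : l * a * (l' * b) * (l * a)⁻¹ ∈ D.H1 := by
    rw [heq]
    exact mul_mem (mul_mem (hLH hl) (mul_mem hc1 (mul_mem (hLH hl') (mul_mem hc2 hb'))))
      (inv_mem (hLH hl))
  refine ⟨hmem, ?_⟩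
  have h1 : (⟨_, hmem⟩ : D.H1) = ⟨l, hLH hl⟩ * (⟨_, hc1⟩ * (⟨l', hLH hl'⟩ * (⟨_, hc2⟩ * ⟨b, hb'⟩)))
      * ⟨l, hLH hl⟩⁻¹ := Subtype.ext heq
  have h2 : (⟨l' * b, hh⟩ : D.H1) = ⟨l', hLH hl'⟩ * ⟨b, hb'⟩ := rfl
  rw [h1, h2]
  simp only [map_mul, map_inv, D.θ_commutator_unitsL hm hϖ hψ hn ha hl' hc1,
    D.θ_eq_one_of_mem hϖ hψ hn hc2' hc2, one_mul]
  rw [mul_comm, inv_mul_cancel_left]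

/-- By irreducibility `H¹` acts on the representation of `J¹` by the invariant character `θ`. -/
theorem Λ_apply_of_mem_H1 (hm : D.depth = 2 * m) (hϖ : Irreducible ϖ) (hψ : IsLevelOne ψ)
    (hn : 0 < n) (h : D.J) (hh : (h : GL (Fin n) F) ∈ D.H1) (v : D.W) :
    D.Λ h v = (D.θ ⟨h, hh⟩ : ℂ) • v := by
  let S : Subrepresentation
      (D.Λ.comp (Subgroup.inclusion (groupJ1_le_groupJ ϖ h0 D.e D.β D.depth))) :=
    { toSubmodule :=
        { carrier := {v | ∀ (h : D.J) (hh : (h : GL (Fin n) F) ∈ D.H1),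
            D.Λ h v = (D.θ ⟨h, hh⟩ : ℂ) • v}
          add_mem' := fun {v v'} hv hv' h hh => by rw [map_add, hv h hh, hv' h hh, smul_add]
          zero_mem' := fun h hh => by rw [map_zero, smul_zero]
          smul_mem' := fun c v hv h hh => by rw [map_smul, hv h hh, smul_comm] }
      apply_mem_toSubmodule := by
        intro g v hv h hh
        obtain ⟨hm1, hθ⟩ := D.θ_conj hm hϖ hψ hn (inv_mem g.2) hh
        rw [inv_inv] at hm1
        set g' : D.J := Subgroup.inclusion (groupJ1_le_groupJ ϖ h0 D.e D.β D.depth) g with hg'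
        have h1 := hv (g'⁻¹ * h * g') hm1
        have h2 : (D.θ ⟨_, hm1⟩ : ℂ) = D.θ ⟨h, hh⟩ := by
          rw [← hθ]
          simp only [inv_inv]
        change D.Λ h (D.Λ g' v) = _ • D.Λ g' v
        rw [← h2, ← map_smul]
        change _ = D.Λ g' ((D.θ ⟨((g'⁻¹ * h * g' : D.J) : GL (Fin n) F), hm1⟩ : ℂ) • v)
        rw [← h1, ← Module.End.mul_apply, ← Module.End.mul_apply, ← map_mul, ← map_mul]
        congr 2
        group }
  have := D.irreducible
  obtain ⟨v₀, hv₀, hv₀'⟩ := D.contains_θ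
  have htop : S = ⊤ := by
    refine (eq_bot_or_eq_top S).resolve_left fun hbot => hv₀ ?_
    have h1 : v₀ ∈ S := hv₀'
    rw [hbot] at h1
    exact h1
  have h1 : v ∈ S := by
    rw [htop]
    trivial
  exact h1 h hh

/-- In even depth the radical of the commutator pairing on `J¹` lies in `H¹`: up to an element of
`U_L(1)` an element of the radical is `1 + z` with `z` commuting with `β` to first order, by
duality, hence `z` is an element of `F[β]` to first order. -/
theorem mem_H1_of_forall_commutator (hm : D.depth = 2 * m) (hϖ : Irreducible ϖ)
    (hψ : IsLevelOne ψ) (hn : 0 < n) {x : GL (Fin n) F} (hx : x ∈ D.J1)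
    (h : ∀ y ∈ D.J1, ∀ hc : ⁅y, x⁆ ∈ D.H1, D.θ ⟨⁅y, x⁆, hc⟩ = 1) : x ∈ D.H1 := by
  have he := D.e_pos hn
  have hm0 : 0 < m := by have := D.depth_pos; omega
  have hLH : unitsL D.β ≤ D.H1 := le_sup_left
  have hUJ : unitFiltration ϖ h0 n D.e m ≤ D.J1 :=
    (unitFiltration_anti (by omega)).trans le_sup_right
  obtain ⟨l, hl, a, ha, rfl⟩ := D.exists_mul_of_mem_J1 hm hϖ hn hx
  have hl1 := D.unitsL_le_unitFiltration_one hϖ hn hl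
  -- the pairing of `a` with `y` is that of `l * a` with `y`, as `l` pairs trivially
  have hθ : ∀ y ∈ unitFiltration ϖ h0 n D.e m,
      ψ (D.β * ((y : Matrix (Fin n) (Fin n) F) * a - a * y)).trace = 1 := by
    intro y hy
    have hcx : ⁅y, l * a⁆ ∈ D.H1 :=
      D.mem_H1_of_mem hm (D.commutator_mem hm hϖ hn (hUJ hy) hx)
    have hcl : ⁅y, l⁆ ∈ D.H1 :=
      D.mem_H1_of_mem hm (commutator_mem_unitFiltration he le_rfl hy hl1)
    have hca' : ⁅y, a⁆ ∈ unitFiltration ϖ h0 n D.e (m + 1) :=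
      commutator_mem_unitFiltration he (by omega) hy ha
    have hca := D.mem_H1_of_mem hm hca'
    have h1 : (⟨_, hca⟩ : D.H1) = ⟨l, hLH hl⟩⁻¹ * (⟨_, hcl⟩⁻¹ * ⟨_, hcx⟩) * ⟨l, hLH hl⟩ :=
      Subtype.ext (by
        simp only [Subgroup.coe_mul, Subgroup.coe_inv, commutatorElement_def]
        group)
    have h2 : D.θ ⟨_, hca⟩ = 1 := by
      rw [h1, map_mul, map_mul, map_mul, map_inv, map_inv, h y (hUJ hy) hcx,
        D.θ_commutator_unitsL hm hϖ hψ hn hy hl hcl, inv_one, one_mul, mul_one, inv_mul_cancel]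
    have h3 := D.θ_eq ⟨_, hca⟩ (unitFiltration_anti (by omega) hca')
    rw [h2, Units.val_one] at h3
    have h4 : ψ (D.β * (((⁅y, a⁆ : GL (Fin n) F) : Matrix (Fin n) (Fin n) F) - 1)).trace = 1 :=
      Circle.ext (by rw [← h3, Circle.coe_one])
    rw [trace_commutator, AddChar.map_add_eq_mul, hψ.map_trace_eq_one hϖ hn D.e_dvd
      (x := D.β * ((y : Matrix (Fin n) (Fin n) F) * a - a * y) * _), mul_one] at h4
    · exact h4
    · refine radPow_mul_mem (i := 0) (j := 1) h0 (by simp)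
        (radPow_mul_mem h0 (by rw [hm]; push_cast; omega) D.mem_radPow (mul_sub_mul_mem hy ha)) ?_
      have h5 : y⁻¹ * a⁻¹ ∈ unitFiltration ϖ h0 n D.e 1 :=
        mul_mem (inv_mem (unitFiltration_anti hm0 hy)) (inv_mem (unitFiltration_anti hm0 ha))
      exact h5.1
  -- hence `a - 1` commutes with `β` to first order
  have hcomm : D.β * ((a : Matrix (Fin n) (Fin n) F) - 1)
      - ((a : Matrix (Fin n) (Fin n) F) - 1) * D.β ∈ radPow ϖ n D.e (1 - m) := by
    refine hψ.mem_radPow_of_forall_trace hϖ he fun b hb => ?_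
    obtain ⟨y, hy, hyb⟩ := exists_mem_unitFiltration hϖ hn D.e_dvd hm0 hb
    have h1 := hθ y hy
    rw [hyb] at h1
    have h2 : (D.β * ((1 + b) * (a : Matrix (Fin n) (Fin n) F) - a * (1 + b))).trace
        = -((D.β * ((a : Matrix (Fin n) (Fin n) F) - 1)
          - ((a : Matrix (Fin n) (Fin n) F) - 1) * D.β) * b).trace := by
      generalize (a : Matrix (Fin n) (Fin n) F) = A
      have h3 : (D.β * (b * A)).trace = (A * D.β * b).trace := by
        rw [← Matrix.mul_assoc, Matrix.trace_mul_comm, Matrix.mul_assoc]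
      simp only [Matrix.mul_add, Matrix.add_mul, Matrix.mul_sub, Matrix.sub_mul, Matrix.one_mul,
        Matrix.mul_one, Matrix.trace_add, Matrix.trace_sub, h3, Matrix.mul_assoc]
      ring
    rw [h2, AddChar.map_neg_eq_inv, inv_eq_one] at h1
    exact h1
  obtain ⟨c, hcL, hc, hac⟩ := D.exists_mem_fieldL_sub_mem hϖ hn ha.1
    (radPow_anti h0 (by rw [hm]; push_cast; omega) hcomm)
  obtain ⟨g, hg, hgc⟩ := exists_mem_unitFiltration hϖ hn D.e_dvd hm0 hc
  have hgt : g ∈ torus D.β := by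
    obtain ⟨g', hg', hgg'⟩ := D.exists_torus (x := (g : Matrix (Fin n) (Fin n) F))
      (by rw [hgc]; exact add_mem (one_mem _) hcL) (fun h => one_notMem_radPow_one hϖ hn D.e_dvd (by
        rw [← Units.mul_inv g, h, Matrix.zero_mul]
        exact zero_mem_radPow))
    rwa [Units.ext hgg'] at hg'
  have hgL : g ∈ unitsL D.β :=
    (D.mem_unitsL_iff hϖ hn).2 ⟨hgt, unitFiltration_anti hm0 hg⟩
  have hga : g⁻¹ * a ∈ unitFiltration ϖ h0 n D.e (m + 1) := by
    refine mem_unitFiltration_of_sub_mem he hg ha ?_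
    rw [hgc, ← sub_sub]
    exact_mod_cast hac
  have := mul_mem (mul_mem (hLH hl) (hLH hgL)) (D.mem_H1_of_mem hm hga)
  rwa [mul_assoc, mul_inv_cancel_left] at this

end SupercuspidalDatum

/-! ### Vectors of a supercuspidal representation transforming by `θ̃` -/

namespace SupercuspidalDatum

variable {F : Type u} [Field F] [ValuativeRel F] {ϖ : 𝒪[F]} {h0 : ϖ ≠ 0}
  {ψ : AddChar F Circle} {n : ℕ} (D : SupercuspidalDatum.{u, w} ϖ h0 ψ n)

theorem unitFiltration_depth_le_H1 : unitFiltration ϖ h0 n D.e (D.depth + 1) ≤ D.H1 :=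
  D.unitFiltration_le_H1 (by omega)

/-- Congruences modulo `ϖ ^ (t + 1)` are congruences modulo `𝔅 ^ (depth + 1)` as soon as `t` is at
least the normalised depth. -/
theorem mem_radPow_of_forall_mem_fracIdeal (hn : 0 < n) {t : ℕ} (ht : D.depth ≤ D.e * t)
    {x : Matrix (Fin n) (Fin n) F} (hx : ∀ a b, x a b ∈ fracIdeal ϖ (t + 1)) :
    x ∈ radPow ϖ n D.e ((D.depth + 1 : ℕ) : ℤ) := by
  refine MinimalVector.mem_radPow_of_forall_mem_fracIdeal h0 hn D.e_dvd (t := t + 1) ?_ hx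
  have : (D.depth : ℤ) ≤ D.e * t := by exact_mod_cast ht
  push_cast
  linarith

variable [TopologicalSpace F] [IsNonarchimedeanLocalField F]

theorem integral_of_mem_J1 (hϖ : Irreducible ϖ) (hn : 0 < n) {g : GL (Fin n) F} (hg : g ∈ D.J1)
    (a b : Fin n) : (g : Matrix (Fin n) (Fin n) F) a b ∈ 𝒪[F] :=
  integral_of_mem_radPow h0 hn D.e_dvd
    (coe_mem_radPow_zero (D.e_pos hn) (D.J1_le_unitFiltration_one hϖ hn hg)) a b

theorem isOpen_and_isCompact_of_le (hϖ : Irreducible ϖ) (hn : 0 < n) {K : Subgroup (GL (Fin n) F)}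
    (hK : unitFiltration ϖ h0 n D.e (D.depth + 1) ≤ K) (hK' : K ≤ D.J1) :
    IsOpen (K : Set (GL (Fin n) F)) ∧ IsCompact (K : Set (GL (Fin n) F)) := by
  refine isOpen_and_isCompact_of_integral h0 K (fun g hg => D.integral_of_mem_J1 hϖ hn (hK' hg))
    (D.depth + 1) fun g hg hg' => hK ?_
  have h1 : D.depth ≤ D.e * D.depth := Nat.le_mul_of_pos_left _ (D.e_pos hn)
  exact ⟨D.mem_radPow_of_forall_mem_fracIdeal hn h1 hg,
    D.mem_radPow_of_forall_mem_fracIdeal hn h1 hg'⟩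

theorem finiteIndex_H1 (hϖ : Irreducible ϖ) (hn : 0 < n) :
    (D.H1.subgroupOf D.J1).FiniteIndex := by
  have hJ := (D.isOpen_and_isCompact_of_le hϖ hn
    (D.unitFiltration_depth_le_H1.trans D.H1_le_J1) le_rfl).2
  have hH := (D.isOpen_and_isCompact_of_le hϖ hn D.unitFiltration_depth_le_H1 D.H1_le_J1).1
  have : CompactSpace D.J1 := isCompact_iff_compactSpace.1 hJ
  have hopen : IsOpen ((D.H1.subgroupOf D.J1 : Subgroup D.J1) : Set D.J1) :=
    hH.preimage continuous_subtype_val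
  have := Subgroup.quotient_finite_of_isOpen _ hopen
  exact Subgroup.finiteIndex_of_finite_quotient

/-- The representation `Λ` contains every extension of `θ` to a polarisation. -/
theorem exists_eigenvector (hϖ : Irreducible ϖ) (hψ : IsLevelOne ψ) (hn : 0 < n)
    (B : D.Polarisation) : ∃ v : D.W, v ≠ 0 ∧ ∀ (b : B.B1) (hb : (b : GL (Fin n) F) ∈ D.J),
      D.Λ ⟨b, hb⟩ v = (B.θt b : ℂ) • v := by
  obtain ⟨m, hm | hm⟩ := Nat.even_or_odd' D.depth
  · have hJJ := groupJ1_le_groupJ ϖ h0 D.e D.β D.depth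
    have : Nontrivial D.W := by
      obtain ⟨v, hv, -⟩ := D.contains_θ
      exact ⟨v, 0, hv⟩
    obtain ⟨v, hv, hvB⟩ := exists_eigenvector_of_commutator_nondegenerate
      (D.Λ.comp (Subgroup.inclusion hJJ)) (H := D.H1.subgroupOf D.J1) (B := B.B1.subgroupOf D.J1)
      (Subgroup.subgroupOf_mono _ B.H1_le) (D.finiteIndex_H1 hϖ hn)
      (D.θ.comp (Subgroup.subgroupOfEquivOfLe D.H1_le_J1).toMonoidHom)
      (fun h x => D.Λ_apply_of_mem_H1 hm hϖ hψ hn ⟨h, hJJ h.1.2⟩ h.2 x)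
      (fun x y => Subgroup.mem_subgroupOf.2
        (D.mem_H1_of_mem hm (D.commutator_mem hm hϖ hn x.2 y.2)))
      (fun b _ h => Subgroup.mem_subgroupOf.2
        (D.mem_H1_of_forall_commutator hm hϖ hψ hn b.2 fun y hy _ => h ⟨y, hy⟩))
      (B.θt.comp (Subgroup.subgroupOfEquivOfLe B.le_J1).toMonoidHom)
      (fun h => B.extends_θ ⟨h, h.2⟩)
    exact ⟨v, hv, fun b _ => hvB ⟨⟨b, B.le_J1 b.2⟩, b.2⟩⟩
  · -- in odd depth `H¹ = J¹`
    obtain ⟨v, hv, hvθ⟩ := D.contains_θ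
    refine ⟨v, hv, fun b hb => ?_⟩
    have h1 : (D.depth + 1) / 2 = D.depth / 2 + 1 := by omega
    have hbH : (b : GL (Fin n) F) ∈ D.H1 := by
      have h2 : (b : GL (Fin n) F) ∈ unitsL D.β ⊔ unitFiltration ϖ h0 n D.e ((D.depth + 1) / 2) :=
        B.le_J1 b.2
      rwa [h1] at h2
    rw [hvθ _ hbH, ← B.extends_θ ⟨b, hbH⟩]

/-- The compactly induced representation contains every extension of `θ` to a polarisation, namely
on the function supported on `J` which is `g ↦ Λ(g) v` there. -/
theorem exists_eigenvector_rep (hϖ : Irreducible ϖ) (hψ : IsLevelOne ψ) (hn : 0 < n)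
    (B : D.Polarisation) : ∃ f : compactIndSpace D.J D.Λ, f ≠ 0 ∧
      ∀ b : B.B1, D.rep (b : GL (Fin n) F) f = (B.θt b : ℂ) • f := by
  classical
  obtain ⟨v, hv, hvB⟩ := D.exists_eigenvector hϖ hψ hn B
  have hJJ := groupJ1_le_groupJ ϖ h0 D.e D.β D.depth
  let f : GL (Fin n) F → D.W := fun g => if hg : g ∈ D.J then D.Λ ⟨g, hg⟩ v else 0
  have hfB : ∀ g (b : B.B1), f (g * b) = (B.θt b : ℂ) • f g := by
    intro g b
    have hb := hJJ (B.le_J1 b.2)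
    by_cases hg : g ∈ D.J
    · have h1 : (⟨g * b, mul_mem hg hb⟩ : D.J) = ⟨g, hg⟩ * ⟨b, hb⟩ := rfl
      simp only [f, dif_pos hg, dif_pos (mul_mem hg hb), h1, map_mul, Module.End.mul_apply,
        hvB b hb, map_smul]
    · have h1 : g * b ∉ D.J := fun h => hg ((Subgroup.mul_mem_cancel_right _ hb).1 h)
      simp only [f, dif_neg hg, dif_neg h1, smul_zero]
  have hf : f ∈ compactIndSpace D.J D.Λ := by
    refine ⟨fun j g => ?_, ⟨unitFiltration ϖ h0 n D.e (D.depth + 1), ?_, fun g x hx => ?_⟩,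
      {1}, isCompact_singleton, fun g hg => ?_⟩
    · by_cases hg : g ∈ D.J
      · have h1 : (⟨j * g, mul_mem j.2 hg⟩ : D.J) = j * ⟨g, hg⟩ := rfl
        simp only [f, dif_pos hg, dif_pos (mul_mem j.2 hg), h1, map_mul, Module.End.mul_apply]
      · have h1 : j * g ∉ D.J := fun h => hg ((Subgroup.mul_mem_cancel_left _ j.2).1 h)
        simp only [f, dif_neg hg, dif_neg h1, map_zero]
    · exact (D.isOpen_and_isCompact_of_le hϖ hn le_rfl
        (D.unitFiltration_depth_le_H1.trans D.H1_le_J1)).1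
    · have hxH := D.unitFiltration_depth_le_H1 hx
      rw [hfB g ⟨x, B.H1_le hxH⟩, B.extends_θ ⟨x, hxH⟩, D.θ_eq_one_of_mem hϖ hψ hn hx hxH]
      simp
    · have hgJ : g ∈ D.J := by
        by_contra h
        exact hg (by simp only [f, dif_neg h])
      exact ⟨g, hgJ, 1, rfl, by simp⟩
  refine ⟨⟨f, hf⟩, fun h => hv ?_, fun b => Subtype.ext (funext fun g => hfB g b)⟩
  have h1 : f 1 = 0 := congrFun (congrArg Subtype.val h) 1
  have h2 : (⟨1, one_mem _⟩ : D.J) = 1 := rfl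
  simpa [f, h2] using h1

theorem exists_eigenvector_of_equiv {V : Type*} [AddCommGroup V] [Module ℂ V]
    {σ : Representation ℂ (GL (Fin n) F) V} (hσ : Nonempty (Representation.Equiv σ D.rep))
    (hϖ : Irreducible ϖ) (hψ : IsLevelOne ψ) (hn : 0 < n) (B : D.Polarisation) :
    ∃ φ : V, φ ≠ 0 ∧ ∀ b : B.B1, σ (b : GL (Fin n) F) φ = (B.θt b : ℂ) • φ := by
  obtain ⟨E⟩ := hσ
  obtain ⟨f, hf, hfB⟩ := D.exists_eigenvector_rep hϖ hψ hn B
  refine ⟨E.toLinearEquiv.symm f, fun h => hf (E.toLinearEquiv.symm.map_eq_zero_iff.1 h),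
    fun b => ?_⟩
  apply E.toLinearEquiv.injective
  rw [map_smul, LinearEquiv.apply_symm_apply, ← hfB b]
  have h1 := LinearMap.congr_fun (E.isIntertwining' (b : GL (Fin n) F)) (E.toLinearEquiv.symm f)
  refine h1.trans (congrArg (D.rep (b : GL (Fin n) F)) ?_)
  exact E.toLinearEquiv.apply_symm_apply f

end SupercuspidalDatum

/-! ### Groups of matrices with prescribed divisibility of the entries -/

section Entries

variable {F : Type u} [Field F] [ValuativeRel F] {ϖ : 𝒪[F]} {ι : Type*}
  {r : ι → ι → ℤ}

/-- The matrices whose `(p, q)` entry lies in `ϖ ^ r p q 𝒪`. -/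
def entrySet (ϖ : 𝒪[F]) (r : ι → ι → ℤ) : Set (Matrix ι ι F) :=
  {x | ∀ p q, x p q ∈ fracIdeal ϖ (r p q)}

theorem entrySet_add_mem {x y : Matrix ι ι F} (hx : x ∈ entrySet ϖ r) (hy : y ∈ entrySet ϖ r) :
    x + y ∈ entrySet ϖ r := fun p q => fracIdeal_add_mem (hx p q) (hy p q)

theorem entrySet_neg_mem {x : Matrix ι ι F} (hx : x ∈ entrySet ϖ r) : -x ∈ entrySet ϖ r :=
  fun p q => fracIdeal_neg_mem (hx p q)

theorem entrySet_mul_mem [Fintype ι] (h0 : ϖ ≠ 0) {r' r'' : ι → ι → ℤ}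
    (hr : ∀ p s q, r p q ≤ r' p s + r'' s q)
    {x y : Matrix ι ι F} (hx : x ∈ entrySet ϖ r') (hy : y ∈ entrySet ϖ r'') :
    x * y ∈ entrySet ϖ r := by
  intro p q
  rw [Matrix.mul_apply]
  exact fracIdeal_sum_mem fun s _ => fracIdeal_mul_mem h0 (hr p s q) (hx p s) (hy s q)

/-- If `r` is superadditive, positive and bounded, then the matrices congruent to the identity
modulo `entrySet ϖ r` form a group. -/
theorem exists_unit_of_mem_entrySet [Fintype ι] [DecidableEq ι] [TopologicalSpace F]
    [IsNonarchimedeanLocalField F] (hϖ : Irreducible ϖ) (hr : ∀ p s q, r p q ≤ r p s + r s q)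
    (h1 : ∀ p q, 1 ≤ r p q) {C : ℕ} (hC : ∀ p q, r p q ≤ C) {x : Matrix ι ι F}
    (hx : x ∈ entrySet ϖ r) :
    ∃ g : GL ι F, (g : Matrix ι ι F) = 1 + x ∧
      ((g⁻¹ : GL ι F) : Matrix ι ι F) - 1 ∈ entrySet ϖ r := by
  have h0 := hϖ.ne_zero
  have hx1 : x ∈ entrySet ϖ fun _ _ => 1 := fun p q => fracIdeal_anti h0 (h1 p q) (hx p q)
  obtain ⟨g, hg, hg'⟩ := exists_unit_of_forall_mem_fracIdeal_one hϖ hx1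
  refine ⟨g, hg, ?_⟩
  set y := ((g⁻¹ : GL ι F) : Matrix ι ι F) - 1 with hy
  have hyx : y = -x + -(x * y) := by
    have h2 := Units.mul_inv g
    rw [hg] at h2
    have h3 : ((g⁻¹ : GL ι F) : Matrix ι ι F) = y + 1 := by rw [hy, sub_add_cancel]
    rw [h3, Matrix.add_mul, Matrix.one_mul, Matrix.mul_add, Matrix.mul_one] at h2
    have h4 : y + (x * y + x) = 0 := by
      refine add_right_cancel (b := (1 : Matrix ι ι F)) (Eq.trans ?_ (h2.trans (zero_add 1).symm))
      abel
    refine (eq_neg_of_add_eq_zero_left h4).trans ?_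
    abel
  -- iterate the equation `y = -x - x y`
  have key : ∀ m : ℕ, ∃ s ∈ entrySet ϖ r, ∃ t ∈ entrySet ϖ (fun _ _ : ι => (m : ℤ)), y = s + t := by
    intro m
    induction m with
    | zero =>
      refine ⟨0, fun _ _ => fracIdeal_zero_mem _ _, y, fun p q => ?_, by simp⟩
      have h2 : (1 : Matrix ι ι F) p q ∈ 𝒪[F] := by
        rw [Matrix.one_apply]
        split_ifs
        · exact one_mem _
        · exact zero_mem _
      exact mem_fracIdeal_zero.2 (sub_mem (hg' p q) h2)
    | succ m ih =>
      obtain ⟨s, hs, t, ht, hst⟩ := ih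
      refine ⟨-x + -(x * s), entrySet_add_mem (entrySet_neg_mem hx)
        (entrySet_neg_mem (entrySet_mul_mem h0 hr hx hs)), -(x * t),
        entrySet_neg_mem (entrySet_mul_mem h0 (fun _ _ _ => ?_) hx1 ht), ?_⟩
      · push_cast
        linarith
      · conv_lhs => rw [hyx, hst, Matrix.mul_add]
        abel
  obtain ⟨s, hs, t, ht, hst⟩ := key C
  rw [hst]
  exact entrySet_add_mem hs fun p q => fracIdeal_anti h0 (hC p q) (ht p q)

end Entries

/-! ### Levi components and the modulus character -/

section Levi

variable {F : Type u} [Field F] {k : ℕ} {n : Fin k → ℕ} {w : Equiv.Perm (Fin k)}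

theorem block_mul_of_mem_parabolic {p q : BlockGL F n} (hp : p ∈ parabolic F n w)
    (hq : q ∈ parabolic F n w) (i : Fin k) : block (p * q) i i = block p i i * block q i i := by
  ext a b
  simp only [block, Matrix.of_apply, Units.val_mul, Matrix.mul_apply]
  rw [Fintype.sum_sigma, Finset.sum_eq_single i]
  · intro l _ hl
    refine Finset.sum_eq_zero fun c _ => ?_
    rcases lt_or_gt_of_ne (w.injective.ne hl) with h | h
    · rw [hp.1 (show w (⟨l, c⟩ : Σ i, Fin (n i)).1 < w (⟨i, a⟩ : Σ i, Fin (n i)).1 from h),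
        zero_mul]
    · rw [hq.1 (show w (⟨i, b⟩ : Σ i, Fin (n i)).1 < w (⟨l, c⟩ : Σ i, Fin (n i)).1 from h),
        mul_zero]
  · simp

theorem block_one (i : Fin k) : block (1 : BlockGL F n) i i = 1 := by
  ext a b
  simp [block, Matrix.one_apply]

/-- The projection of a parabolic subgroup to its Levi subgroup. -/
def leviHom (F : Type u) [Field F] {k : ℕ} (n : Fin k → ℕ) (w : Equiv.Perm (Fin k)) :
    parabolic F n w →* ∀ i, GL (Fin (n i)) F where
  toFun p i := ⟨block (p : BlockGL F n) i i, block (p⁻¹ : BlockGL F n) i i,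
    by rw [← block_mul_of_mem_parabolic p.2 (inv_mem p.2), mul_inv_cancel, block_one],
    by rw [← block_mul_of_mem_parabolic (inv_mem p.2) p.2, inv_mul_cancel, block_one]⟩
  map_one' := funext fun i => Units.ext (block_one i)
  map_mul' p q := funext fun i => Units.ext (block_mul_of_mem_parabolic p.2 q.2 i)

theorem hasLeviPart_iff (p : parabolic F n w) (m : ∀ i, GL (Fin (n i)) F) :
    HasLeviPart (p : BlockGL F n) m ↔ m = leviHom F n w p :=
  ⟨fun h => funext fun i => Units.ext (h i).symm, fun h i => by rw [h]; rfl⟩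

/-- The determinant of an integral matrix with integral inverse is a unit. -/
theorem valuation_det_eq_one [ValuativeRel F] {d : ℕ} {g : GL (Fin d) F}
    (hg : ∀ a b, (g : Matrix (Fin d) (Fin d) F) a b ∈ 𝒪[F])
    (hg' : ∀ a b, ((g⁻¹ : GL (Fin d) F) : Matrix (Fin d) (Fin d) F) a b ∈ 𝒪[F]) :
    valuation F (Matrix.GeneralLinearGroup.det g : F) = 1 := by
  have hdet : ∀ M : Matrix (Fin d) (Fin d) F, (∀ a b, M a b ∈ 𝒪[F]) → valuation F M.det ≤ 1 := by
    intro M hM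
    change M.det ∈ 𝒪[F]
    rw [Matrix.det_apply]
    exact sum_mem fun τ _ => zsmul_mem (prod_mem fun i _ => hM _ _) _
  have h1 := hdet _ hg
  have h2 := hdet _ hg'
  have h3 : valuation F (g : Matrix (Fin d) (Fin d) F).det *
      valuation F ((g⁻¹ : GL (Fin d) F) : Matrix (Fin d) (Fin d) F).det = 1 := by
    rw [← map_mul, ← Matrix.det_mul, Units.mul_inv, Matrix.det_one, map_one]
  refine le_antisymm h1 ?_
  rw [← h3]
  exact mul_le_of_le_one_right' h2

variable [ValuativeRel F] [TopologicalSpace F] [IsNonarchimedeanLocalField F]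

theorem normAbs_pos (x : Fˣ) : 0 < normAbs x := by
  have : 0 < Nat.card 𝓀[F] := Nat.card_pos
  exact zpow_pos (by exact_mod_cast this) _

theorem normAbs_mul (x y : Fˣ) : normAbs (x * y) = normAbs x * normAbs y := by
  have : 0 < Nat.card 𝓀[F] := Nat.card_pos
  rw [normAbs, normAbs, normAbs, ← zpow_add₀ (by exact_mod_cast this.ne'), Units.val_mul, map_mul,
    map_mul, WithZero.log_mul]
  · simp
  · simp

theorem normAbs_eq_one {x : Fˣ} (hx : valuation F (x : F) = 1) : normAbs x = 1 := by
  rw [normAbs, hx, map_one, WithZero.log_one, zpow_zero]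

theorem modulusPow_mul (w : Equiv.Perm (Fin k)) (s : ℝ) (m m' : ∀ i, GL (Fin (n i)) F) :
    modulusPow w s (m * m') = modulusPow w s m * modulusPow w s m' := by
  have hnn : ∀ m : ∀ i, GL (Fin (n i)) F, 0 ≤ ∏ i : Fin k, ∏ j : Fin k, if w i < w j then
      normAbs (Matrix.GeneralLinearGroup.det (m i)) ^ n j /
        normAbs (Matrix.GeneralLinearGroup.det (m j)) ^ n i else 1 := fun m =>
    Finset.prod_nonneg fun i _ => Finset.prod_nonneg fun j _ => by
      split_ifs
      · exact (div_pos (pow_pos (normAbs_pos _) _) (pow_pos (normAbs_pos _) _)).le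
      · exact zero_le_one
  rw [modulusPow, modulusPow, modulusPow, ← Real.mul_rpow (hnn m) (hnn m'),
    ← Finset.prod_mul_distrib]
  congr 1
  refine Finset.prod_congr rfl fun i _ => ?_
  rw [← Finset.prod_mul_distrib]
  refine Finset.prod_congr rfl fun j _ => ?_
  split_ifs
  · rw [Pi.mul_apply, Pi.mul_apply, map_mul, map_mul, normAbs_mul, normAbs_mul, mul_pow, mul_pow,
      mul_div_mul_comm]
  · rw [one_mul]

theorem modulusPow_eq_one (w : Equiv.Perm (Fin k)) (s : ℝ) {m : ∀ i, GL (Fin (n i)) F}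
    (hm : ∀ i, valuation F (Matrix.GeneralLinearGroup.det (m i) : F) = 1) :
    modulusPow w s m = 1 := by
  have h1 := fun i => normAbs_eq_one (hm i)
  simp [modulusPow, h1]

end Levi

/-! ### Functions supported on a double coset -/

section DoubleCoset

variable {G : Type u} [Group G] {T : Type v} [AddCommGroup T] [Module ℂ T]

/-- A vector on which `P ∩ K` acts through the character `Θ` of `K` extends to an equivariant
function supported on `P K`. -/
theorem exists_function_of_compatible (P K : Subgroup G) (τ : P →* Module.End ℂ T) (Θ : K →* ℂˣ)
    (t : T) (ht : ∀ g (hp : g ∈ P) (hk : g ∈ K), τ ⟨g, hp⟩ t = (Θ ⟨g, hk⟩ : ℂ) • t) :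
    ∃ f : G → T, (∀ (p : P) (x : K), f ((p : G) * (x : G)) = (Θ x : ℂ) • τ p t) ∧
      ∀ g, (¬ ∃ p ∈ P, ∃ x ∈ K, g = p * x) → f g = 0 := by
  classical
  have hex : ∀ g, ∃ y : T, (∀ (p : P) (x : K), g = (p : G) * (x : G) → y = (Θ x : ℂ) • τ p t) ∧
      ((¬ ∃ p ∈ P, ∃ x ∈ K, g = p * x) → y = 0) := by
    intro g
    by_cases hg : ∃ p ∈ P, ∃ x ∈ K, g = p * x
    · obtain ⟨p, hp, x, hx, rfl⟩ := hg
      refine ⟨(Θ ⟨x, hx⟩ : ℂ) • τ ⟨p, hp⟩ t, fun p' x' h => ?_,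
        fun h => (h ⟨p, hp, x, hx, rfl⟩).elim⟩
      have h1 : (p' : G)⁻¹ * p = x' * x⁻¹ := by
        rw [inv_mul_eq_iff_eq_mul, ← mul_assoc, ← h, mul_inv_cancel_right]
      have hP : (p' : G)⁻¹ * p ∈ P := mul_mem (inv_mem p'.2) hp
      have hK : (p' : G)⁻¹ * p ∈ K := h1 ▸ mul_mem x'.2 (inv_mem hx)
      have h2 := ht _ hP hK
      have h3 : (⟨p, hp⟩ : P) = p' * ⟨_, hP⟩ := Subtype.ext (by simp)
      have h4 : x' = (⟨_, hK⟩ : K) * ⟨x, hx⟩ := Subtype.ext (by simp [h1])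
      rw [h3, h4, map_mul, map_mul, Module.End.mul_apply, h2, map_smul, smul_smul, Units.val_mul,
        mul_comm]
    · exact ⟨0, fun p x h => (hg ⟨p, p.2, x, x.2, h⟩).elim, fun _ => rfl⟩
  choose f hf hf' using hex
  exact ⟨f, fun p x => hf _ p x rfl, hf'⟩

theorem tprod_ne_zero {ι : Type*} [Fintype ι] {V : ι → Type*} [∀ i, AddCommGroup (V i)]
    [∀ i, Module ℂ (V i)] {φ : ∀ i, V i} (h : ∀ i, φ i ≠ 0) : PiTensorProduct.tprod ℂ φ ≠ 0 := by
  have hex : ∀ i, ∃ l : V i →ₗ[ℂ] ℂ, l (φ i) ≠ 0 := fun i =>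
    not_forall.1 (mt (Module.forall_dual_apply_eq_zero_iff ℂ _).1 (h i))
  choose l hl using hex
  intro h0
  have h1 := congrArg (PiTensorProduct.lift
    ((MultilinearMap.mkPiAlgebra ℂ ι ℂ).compLinearMap l)) h0
  rw [PiTensorProduct.lift.tprod, map_zero] at h1
  simp only [MultilinearMap.compLinearMap_apply, MultilinearMap.mkPiAlgebra_apply] at h1
  exact Finset.prod_ne_zero_iff.2 (fun i _ => hl i) h1

end DoubleCoset

/-! ### The group `K_π` and its character -/

section SetK

/-- The exponent of `ϖ` which bounds the entries of an element of `K_π` in the blocks off the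
diagonal, and the distance of its diagonal blocks from `B¹`. -/
def blockExponent {k : ℕ} (c : ℕ) (i j : Fin k) : ℤ :=
  if i = j then c + 1 else if i < j then ⌊((c : ℚ) + 1) / 2⌋ else ⌈((c : ℚ) + 1) / 2⌉

section Exponent

variable {k c : ℕ}

theorem floor_ceil_half (hc : 0 < c) :
    1 ≤ ⌊((c : ℚ) + 1) / 2⌋ ∧ ⌊((c : ℚ) + 1) / 2⌋ ≤ ⌈((c : ℚ) + 1) / 2⌉ ∧
      ⌊((c : ℚ) + 1) / 2⌋ + ⌈((c : ℚ) + 1) / 2⌉ = c + 1 := by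
  obtain ⟨f, hf, hf'⟩ : ∃ f : ℤ, 2 * f ≤ c + 1 ∧ (c : ℤ) + 1 ≤ 2 * f + 1 :=
    ⟨((c : ℤ) + 1) / 2, by omega, by omega⟩
  have hq : 2 * (f : ℚ) ≤ c + 1 := by exact_mod_cast hf
  have hq' : (c : ℚ) + 1 ≤ 2 * f + 1 := by exact_mod_cast hf'
  have h1 : ⌊((c : ℚ) + 1) / 2⌋ = f := by
    rw [Int.floor_eq_iff]
    constructor <;> linarith
  have h2 : ⌈((c : ℚ) + 1) / 2⌉ = c + 1 - f := by
    rw [Int.ceil_eq_iff]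
    push_cast
    constructor <;> linarith
  rw [h1, h2]
  omega

theorem one_le_blockExponent (hc : 0 < c) (i j : Fin k) : 1 ≤ blockExponent c i j := by
  have := floor_ceil_half hc
  unfold blockExponent
  split_ifs <;> omega

theorem blockExponent_le (hc : 0 < c) (i j : Fin k) : blockExponent c i j ≤ (c + 1 : ℕ) := by
  have := floor_ceil_half hc
  unfold blockExponent
  split_ifs <;> push_cast <;> omega

theorem blockExponent_le_add (hc : 0 < c) (i l j : Fin k) :
    blockExponent c i j ≤ blockExponent c i l + blockExponent c l j := by
  have := floor_ceil_half hc
  unfold blockExponent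
  split_ifs <;> omega

end Exponent

/-- Block diagonal matrices, as the embedding of the Levi subgroup. -/
def blockDiag (F : Type u) [Field F] {k : ℕ} (n : Fin k → ℕ) :
    (∀ i, GL (Fin (n i)) F) →* BlockGL F n :=
  (Units.map (Matrix.blockDiagonal'RingHom (fun i => Fin (n i)) F).toMonoidHom).comp
    MulEquiv.piUnits.symm.toMonoidHom

theorem coe_blockDiag {F : Type u} [Field F] {k : ℕ} {n : Fin k → ℕ}
    (m : ∀ i, GL (Fin (n i)) F) : (blockDiag F n m : Matrix _ _ F)
      = Matrix.blockDiagonal' fun i => (m i : Matrix (Fin (n i)) (Fin (n i)) F) := rfl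

variable {F : Type u} [Field F] [ValuativeRel F] {ϖ : 𝒪[F]} {h0 : ϖ ≠ 0} {ψ : AddChar F Circle}
  {k : ℕ} {n : Fin k → ℕ}

theorem depth_le_mul_inducedDepth (hn : ∀ i, 0 < n i)
    (D : ∀ i, SupercuspidalDatum.{u, w} ϖ h0 ψ (n i)) (i : Fin k) :
    (D i).depth ≤ (D i).e * inducedDepth D := by
  have h1 : (D i).normalisedDepth ≤ inducedDepth D :=
    (le_ciSup (f := fun i => (D i).normalisedDepth) (Set.finite_range _).bddAbove i).trans
      (Nat.le_ceil _)
  have he : (0 : ℝ) < (D i).e := by exact_mod_cast (D i).e_pos (hn i)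
  rw [SupercuspidalDatum.normalisedDepth, div_le_iff₀ he, mul_comm] at h1
  exact_mod_cast h1

theorem inducedDepth_pos (hk : 0 < k) (hn : ∀ i, 0 < n i)
    (D : ∀ i, SupercuspidalDatum.{u, w} ϖ h0 ψ (n i)) : 0 < inducedDepth D :=
  Nat.pos_of_mul_pos_left ((D ⟨0, hk⟩).depth_pos.trans_le (depth_le_mul_inducedDepth hn D _))

/-- The bounds on the entries of the difference of an element of `K_π` and its block diagonal
part. -/
abbrev entrySetK (D : ∀ i, SupercuspidalDatum.{u, w} ϖ h0 ψ (n i)) :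
    Set (Matrix (Σ i, Fin (n i)) (Σ i, Fin (n i)) F) :=
  entrySet ϖ fun p q => blockExponent (inducedDepth D) p.1 q.1

theorem exists_blocks {D : ∀ i, SupercuspidalDatum.{u, w} ϖ h0 ψ (n i)}
    (B : ∀ i, (D i).Polarisation) {g : BlockGL F n} (hg : g ∈ setK B) :
    ∃ m : ∀ i, (B i).B1, ∀ i, block g i i
      = ((m i : GL (Fin (n i)) F) : Matrix (Fin (n i)) (Fin (n i)) F) := by
  choose m hm hm' using hg.1
  exact ⟨fun i => ⟨m i, hm i⟩, hm'⟩

/-- An element of `K_π` differs from its block diagonal part by an element of `entrySetK D`. -/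
theorem sub_blockDiag_mem {D : ∀ i, SupercuspidalDatum.{u, w} ϖ h0 ψ (n i)}
    (B : ∀ i, (D i).Polarisation) {g : BlockGL F n} (hg : g ∈ setK B) (m : ∀ i, GL (Fin (n i)) F)
    (hm : ∀ i, block g i i = (m i : Matrix (Fin (n i)) (Fin (n i)) F)) :
    (g : Matrix _ _ F) - (blockDiag F n m : Matrix _ _ F) ∈ entrySetK D := by
  rintro ⟨i, a⟩ ⟨j, b⟩
  rw [Matrix.sub_apply, coe_blockDiag]
  obtain hij | rfl | hij := lt_trichotomy i j
  · rw [Matrix.blockDiagonal'_apply_ne _ _ _ hij.ne, sub_zero]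
    simpa [block, blockExponent, hij.ne, hij] using hg.2.1 i j hij a b
  · rw [Matrix.blockDiagonal'_apply_eq, ← hm i]
    simp only [block, Matrix.of_apply, sub_self]
    exact fracIdeal_zero_mem _ _
  · rw [Matrix.blockDiagonal'_apply_ne _ _ _ hij.ne', sub_zero]
    simpa [block, blockExponent, hij.ne', not_lt_of_gt hij] using hg.2.2 i j hij a b

variable [TopologicalSpace F] [IsNonarchimedeanLocalField F]

namespace SupercuspidalDatum.Polarisation

variable {d : ℕ} {D : SupercuspidalDatum.{u, w} ϖ h0 ψ d} (B : D.Polarisation)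

theorem integral (hϖ : Irreducible ϖ) (hd : 0 < d) {g : GL (Fin d) F} (hg : g ∈ B.B1)
    (a b : Fin d) : (g : Matrix (Fin d) (Fin d) F) a b ∈ 𝒪[F] :=
  D.integral_of_mem_J1 hϖ hd (B.le_J1 hg) a b

/-- `B¹` and `θ̃` are stable under perturbations modulo `ϖ ^ (c + 1)` as soon as `c` is at least the
normalised depth. -/
theorem exists_eq_add (hϖ : Irreducible ϖ) (hψ : IsLevelOne ψ) (hd : 0 < d) {c : ℕ}
    (hc : D.depth ≤ D.e * c) (g : B.B1) {z : Matrix (Fin d) (Fin d) F}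
    (hz : ∀ a b, z a b ∈ fracIdeal ϖ (c + 1)) :
    ∃ g' : B.B1, ((g' : GL (Fin d) F) : Matrix (Fin d) (Fin d) F)
      = ((g : GL (Fin d) F) : Matrix (Fin d) (Fin d) F) + z ∧ B.θt g' = B.θt g := by
  have hgz : ∀ a b, ((((g : GL (Fin d) F)⁻¹ : GL (Fin d) F) : Matrix (Fin d) (Fin d) F) * z) a b
      ∈ fracIdeal ϖ (c + 1) := by
    intro a b
    rw [Matrix.mul_apply]
    exact fracIdeal_sum_mem fun s _ => fracIdeal_mul_mem h0 (by simp)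
      (mem_fracIdeal_zero.2 (B.integral hϖ hd (inv_mem g.2) a s)) (hz s b)
  obtain ⟨y, hy, hyz⟩ := exists_mem_unitFiltration hϖ hd D.e_dvd (Nat.succ_pos D.depth)
    (D.mem_radPow_of_forall_mem_fracIdeal hd hc hgz)
  have hyH := D.unitFiltration_depth_le_H1 hy
  refine ⟨g * ⟨y, B.H1_le hyH⟩, ?_, ?_⟩
  · rw [Subgroup.coe_mul, Units.val_mul, hyz, Matrix.mul_add, Matrix.mul_one, ← Matrix.mul_assoc,
      Units.mul_inv, Matrix.one_mul]
  · rw [map_mul, B.extends_θ ⟨y, hyH⟩, D.θ_eq_one_of_mem hϖ hψ hd hy hyH, mul_one]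

end SupercuspidalDatum.Polarisation

section Group

variable {D : ∀ i, SupercuspidalDatum.{u, w} ϖ h0 ψ (n i)} (B : ∀ i, (D i).Polarisation)

theorem mul_blockDiag_mem (hϖ : Irreducible ϖ) (hn : ∀ i, 0 < n i) (m : ∀ i, (B i).B1)
    {x : Matrix (Σ i, Fin (n i)) (Σ i, Fin (n i)) F} (hx : x ∈ entrySetK D) :
    x * (blockDiag F n (fun i => (m i : GL (Fin (n i)) F)) : Matrix _ _ F) ∈ entrySetK D := by
  rintro ⟨i, a⟩ ⟨j, b⟩
  rw [Matrix.mul_apply]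
  refine fracIdeal_sum_mem fun ⟨l, c⟩ _ => ?_
  rw [coe_blockDiag]
  by_cases h : l = j
  · subst h
    rw [Matrix.blockDiagonal'_apply_eq]
    exact fracIdeal_mul_mem h0 (by simp) (hx _ _)
      (mem_fracIdeal_zero.2 ((B l).integral hϖ (hn l) (m l).2 _ _))
  · rw [Matrix.blockDiagonal'_apply_ne _ _ _ h, mul_zero]
    exact fracIdeal_zero_mem _ _

theorem blockDiag_mul_mem (hϖ : Irreducible ϖ) (hn : ∀ i, 0 < n i) (m : ∀ i, (B i).B1)
    {x : Matrix (Σ i, Fin (n i)) (Σ i, Fin (n i)) F} (hx : x ∈ entrySetK D) :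
    (blockDiag F n (fun i => (m i : GL (Fin (n i)) F)) : Matrix _ _ F) * x ∈ entrySetK D := by
  rintro ⟨i, a⟩ ⟨j, b⟩
  rw [Matrix.mul_apply]
  refine fracIdeal_sum_mem fun ⟨l, c⟩ _ => ?_
  rw [coe_blockDiag]
  by_cases h : i = l
  · subst h
    rw [Matrix.blockDiagonal'_apply_eq]
    exact fracIdeal_mul_mem h0 (by simp)
      (mem_fracIdeal_zero.2 ((B i).integral hϖ (hn i) (m i).2 _ _)) (hx _ _)
  · rw [Matrix.blockDiagonal'_apply_ne _ _ _ h, zero_mul]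
    exact fracIdeal_zero_mem _ _

/-- Conversely, a perturbation of a block diagonal matrix by an element of `entrySetK D` lies in
`K_π`, and `θ̃` takes the same values on the diagonal blocks. -/
theorem mem_setK_of_sub_blockDiag_mem (hϖ : Irreducible ϖ) (hψ : IsLevelOne ψ) (hn : ∀ i, 0 < n i)
    {g : BlockGL F n} (m : ∀ i, (B i).B1)
    (hm : (g : Matrix _ _ F) - (blockDiag F n (fun i => (m i : GL (Fin (n i)) F)) : Matrix _ _ F)
      ∈ entrySetK D) :
    g ∈ setK B ∧ ∃ m' : ∀ i, (B i).B1, (∀ i, block g i i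
      = ((m' i : GL (Fin (n i)) F) : Matrix (Fin (n i)) (Fin (n i)) F)) ∧
      ∀ i, (B i).θt (m' i) = (B i).θt (m i) := by
  have hdiag : ∀ i, ∃ g' : (B i).B1, ((g' : GL (Fin (n i)) F) : Matrix _ _ F)
      = ((m i : GL (Fin (n i)) F) : Matrix _ _ F) + (block g i i
        - ((m i : GL (Fin (n i)) F) : Matrix _ _ F)) ∧ (B i).θt g' = (B i).θt (m i) := by
    intro i
    refine (B i).exists_eq_add hϖ hψ (hn i) (depth_le_mul_inducedDepth hn D i) (m i) fun a b => ?_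
    have h1 := hm ⟨i, a⟩ ⟨i, b⟩
    rw [Matrix.sub_apply, coe_blockDiag, Matrix.blockDiagonal'_apply_eq] at h1
    simpa [block, blockExponent] using h1
  choose m' hm' hθ using hdiag
  have hm'' : ∀ i, block g i i
      = ((m' i : GL (Fin (n i)) F) : Matrix (Fin (n i)) (Fin (n i)) F) := fun i => by
    rw [hm', add_sub_cancel]
  refine ⟨⟨fun i => ⟨m' i, (m' i).2, hm'' i⟩, fun i j hij a b => ?_, fun i j hij a b => ?_⟩,
    m', hm'', hθ⟩
  · have h1 := hm ⟨i, a⟩ ⟨j, b⟩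
    rw [Matrix.sub_apply, coe_blockDiag, Matrix.blockDiagonal'_apply_ne _ _ _ hij.ne,
      sub_zero] at h1
    simpa [block, blockExponent, hij.ne, hij] using h1
  · have h1 := hm ⟨i, a⟩ ⟨j, b⟩
    rw [Matrix.sub_apply, coe_blockDiag, Matrix.blockDiagonal'_apply_ne _ _ _ hij.ne',
      sub_zero] at h1
    simpa [block, blockExponent, hij.ne', not_lt_of_gt hij] using h1

theorem mul_sub_blockDiag_mem (hϖ : Irreducible ϖ) (hk : 0 < k) (hn : ∀ i, 0 < n i)
    {g h : BlockGL F n} (m m' : ∀ i, (B i).B1)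
    (hg : (g : Matrix _ _ F) - (blockDiag F n (fun i => (m i : GL (Fin (n i)) F)) : Matrix _ _ F)
      ∈ entrySetK D)
    (hh : (h : Matrix _ _ F) - (blockDiag F n (fun i => (m' i : GL (Fin (n i)) F)) : Matrix _ _ F)
      ∈ entrySetK D) :
    ((g * h : BlockGL F n) : Matrix _ _ F)
      - (blockDiag F n (fun i => ((m * m') i : GL (Fin (n i)) F)) : Matrix _ _ F)
      ∈ entrySetK D := by
  have h1 : blockDiag F n (fun i => ((m * m') i : GL (Fin (n i)) F))
      = blockDiag F n (fun i => (m i : GL (Fin (n i)) F))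
        * blockDiag F n (fun i => (m' i : GL (Fin (n i)) F)) := by
    rw [← map_mul]
    rfl
  rw [h1, Units.val_mul, Units.val_mul]
  have h2 := entrySet_add_mem (entrySet_add_mem (blockDiag_mul_mem B hϖ hn m hh)
    (mul_blockDiag_mem B hϖ hn m' hg)) (entrySet_mul_mem h0
      (fun p s q => blockExponent_le_add (inducedDepth_pos hk hn D) p.1 s.1 q.1) hg hh)
  convert h2 using 1
  noncomm_ring

theorem inv_sub_blockDiag_mem (hϖ : Irreducible ϖ) (hk : 0 < k) (hn : ∀ i, 0 < n i)
    {g : BlockGL F n} (m : ∀ i, (B i).B1)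
    (hg : (g : Matrix _ _ F) - (blockDiag F n (fun i => (m i : GL (Fin (n i)) F)) : Matrix _ _ F)
      ∈ entrySetK D) :
    ((g⁻¹ : BlockGL F n) : Matrix _ _ F)
      - (blockDiag F n (fun i => (m⁻¹ i : GL (Fin (n i)) F)) : Matrix _ _ F) ∈ entrySetK D := by
  have hc := inducedDepth_pos hk hn D
  set d := blockDiag F n (fun i => (m i : GL (Fin (n i)) F)) with hd
  have hdinv : blockDiag F n (fun i => (m⁻¹ i : GL (Fin (n i)) F)) = d⁻¹ := by
    rw [hd, ← map_inv]
    rfl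
  have h1 := blockDiag_mul_mem B hϖ hn m⁻¹ hg
  rw [hdinv] at h1 ⊢
  obtain ⟨y, hy, hy'⟩ := exists_unit_of_mem_entrySet hϖ
    (r := fun p q : Σ i, Fin (n i) => blockExponent (inducedDepth D) p.1 q.1)
    (C := inducedDepth D + 1) (fun p s q => blockExponent_le_add hc p.1 s.1 q.1)
    (fun p q => one_le_blockExponent hc p.1 q.1) (fun p q => blockExponent_le hc p.1 q.1) h1
  have hgy : g = d * y := Units.ext (by
    rw [Units.val_mul, hy, Matrix.mul_add, Matrix.mul_one, ← Matrix.mul_assoc, Units.mul_inv,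
      Matrix.one_mul, add_sub_cancel])
  have h2 := mul_blockDiag_mem B hϖ hn m⁻¹ hy'
  rw [hdinv, Matrix.sub_mul, Matrix.one_mul, ← Units.val_mul, ← _root_.mul_inv_rev, ← hgy] at h2
  exact h2

/-- The group `K_π`. -/
def groupK (hϖ : Irreducible ϖ) (hψ : IsLevelOne ψ) (hk : 0 < k) (hn : ∀ i, 0 < n i) :
    Subgroup (BlockGL F n) where
  carrier := setK B
  one_mem' := by
    refine (mem_setK_of_sub_blockDiag_mem B hϖ hψ hn 1 ?_).1
    have h1 : blockDiag F n (fun i => ((1 : ∀ i, (B i).B1) i : GL (Fin (n i)) F)) = 1 :=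
      map_one (blockDiag F n)
    rw [h1, sub_self]
    exact fun _ _ => fracIdeal_zero_mem _ _
  mul_mem' := by
    intro g h hg hh
    obtain ⟨m, hm⟩ := exists_blocks B hg
    obtain ⟨m', hm'⟩ := exists_blocks B hh
    exact (mem_setK_of_sub_blockDiag_mem B hϖ hψ hn _ (mul_sub_blockDiag_mem B hϖ hk hn m m'
      (sub_blockDiag_mem B hg _ hm) (sub_blockDiag_mem B hh _ hm'))).1
  inv_mem' := by
    intro g hg
    obtain ⟨m, hm⟩ := exists_blocks B hg
    exact (mem_setK_of_sub_blockDiag_mem B hϖ hψ hn _ (inv_sub_blockDiag_mem B hϖ hk hn m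
      (sub_blockDiag_mem B hg _ hm))).1

theorem exists_charK (hϖ : Irreducible ϖ) (hψ : IsLevelOne ψ) (hk : 0 < k) (hn : ∀ i, 0 < n i) :
    ∃ Θ : groupK B hϖ hψ hk hn →* ℂˣ, ∀ (x : groupK B hϖ hψ hk hn) (m : ∀ i, (B i).B1),
      (∀ i, block (x : BlockGL F n) i i
        = ((m i : GL (Fin (n i)) F) : Matrix (Fin (n i)) (Fin (n i)) F)) →
      Θ x = ∏ i, (B i).θt (m i) := by
  choose m hm using fun x : groupK B hϖ hψ hk hn => exists_blocks B x.2
  have huniq : ∀ (x : groupK B hϖ hψ hk hn) (m' : ∀ i, (B i).B1),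
      (∀ i, block (x : BlockGL F n) i i
        = ((m' i : GL (Fin (n i)) F) : Matrix (Fin (n i)) (Fin (n i)) F)) → m x = m' :=
    fun x m' h => funext fun i => Subtype.ext (Units.ext ((hm x i).symm.trans (h i)))
  refine ⟨⟨⟨fun x => ∏ i, (B i).θt (m x i), ?_⟩, fun x y => ?_⟩, fun x m' h => ?_⟩
  · have h1 : m 1 = 1 := huniq 1 1 fun i => block_one i
    simp only [h1, Pi.one_apply, map_one, Finset.prod_const_one]
  · obtain ⟨-, m', hm', hθ⟩ := mem_setK_of_sub_blockDiag_mem B hϖ hψ hn _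
      (mul_sub_blockDiag_mem B hϖ hk hn _ _ (sub_blockDiag_mem B x.2 _ (hm x))
        (sub_blockDiag_mem B y.2 _ (hm y)))
    simp only [huniq (x * y) m' hm', hθ, Pi.mul_apply, map_mul, Finset.prod_mul_distrib]
  · simp only [MonoidHom.coe_mk, OneHom.coe_mk, huniq x m' h]

theorem integral_of_mem_setK (hϖ : Irreducible ϖ) (hk : 0 < k) (hn : ∀ i, 0 < n i)
    {g : BlockGL F n} (hg : g ∈ setK B) (p q : Σ i, Fin (n i)) :
    (g : Matrix _ _ F) p q ∈ 𝒪[F] := by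
  obtain ⟨m, hm⟩ := exists_blocks B hg
  have h1 := sub_blockDiag_mem B hg _ hm p q
  have h2 := mem_fracIdeal_zero.1 (fracIdeal_anti h0
    (zero_le_one.trans (one_le_blockExponent (inducedDepth_pos hk hn D) p.1 q.1)) h1)
  rw [Matrix.sub_apply] at h2
  have h3 : (blockDiag F n (fun i => (m i : GL (Fin (n i)) F)) : Matrix _ _ F) p q ∈ 𝒪[F] := by
    obtain ⟨i, a⟩ := p
    obtain ⟨j, b⟩ := q
    rw [coe_blockDiag, Matrix.blockDiagonal'_apply]
    split_ifs with h
    · exact (B i).integral hϖ (hn i) (m i).2 _ _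
    · exact zero_mem _
  simpa using add_mem h2 h3

/-- An element congruent to the identity modulo `ϖ ^ (c + 1)` lies in `K_π`, and `Θ` is trivial on
it. -/
theorem mem_setK_of_congruent (hϖ : Irreducible ϖ) (hψ : IsLevelOne ψ) (hk : 0 < k)
    (hn : ∀ i, 0 < n i) {g : BlockGL F n}
    (hg : ∀ p q, ((g : Matrix (Σ i, Fin (n i)) (Σ i, Fin (n i)) F) - 1) p q
      ∈ fracIdeal ϖ ((inducedDepth D + 1 : ℕ) : ℤ)) :
    g ∈ setK B ∧ ∃ m : ∀ i, (B i).B1, (∀ i, block g i i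
      = ((m i : GL (Fin (n i)) F) : Matrix (Fin (n i)) (Fin (n i)) F)) ∧
      ∀ i, (B i).θt (m i) = 1 := by
  have h1 : blockDiag F n (fun i => ((1 : ∀ i, (B i).B1) i : GL (Fin (n i)) F)) = 1 :=
    map_one (blockDiag F n)
  obtain ⟨h2, m, hm, hθ⟩ := mem_setK_of_sub_blockDiag_mem B hϖ hψ hn 1 (g := g) (by
    rw [h1]
    exact fun p q => fracIdeal_anti h0
      (blockExponent_le (inducedDepth_pos hk hn D) p.1 q.1) (hg p q))
  exact ⟨h2, m, hm, fun i => by rw [hθ, Pi.one_apply, map_one]⟩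

end Group

end SetK

/-! ### The induced representation -/

section Induced

/-- The action `δ_P ^ s σ` of the parabolic subgroup on the space of `σ`. -/
noncomputable def parabolicAction {F : Type u} [Field F] [ValuativeRel F] [TopologicalSpace F]
    [IsNonarchimedeanLocalField F] {k : ℕ} {n : Fin k → ℕ} (w : Equiv.Perm (Fin k)) (s : ℝ)
    {V : Fin k → Type v} [∀ i, AddCommGroup (V i)] [∀ i, Module ℂ (V i)]
    (σ : ∀ i, Representation ℂ (GL (Fin (n i)) F) (V i)) :
    parabolic F n w →* Module.End ℂ (PiTensorProduct ℂ V) where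
  toFun p := (modulusPow w s (leviHom F n w p) : ℂ) •
    PiTensorProduct.map fun i => σ i (leviHom F n w p i)
  map_one' := by
    have h1 : modulusPow w s (1 : ∀ i, GL (Fin (n i)) F) = 1 :=
      modulusPow_eq_one w s fun i => by simp
    simp only [map_one, h1, Pi.one_apply, Complex.ofReal_one, one_smul]
    exact PiTensorProduct.map_one
  map_mul' p q := by
    simp only [map_mul, modulusPow_mul, Pi.mul_apply, Complex.ofReal_mul]
    rw [PiTensorProduct.map_mul, smul_mul_smul_comm]

variable {F : Type u} [Field F] [ValuativeRel F] {ϖ : 𝒪[F]} {h0 : ϖ ≠ 0} {ψ : AddChar F Circle}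
  {k : ℕ} {n : Fin k → ℕ} {D : ∀ i, SupercuspidalDatum.{u, w} ϖ h0 ψ (n i)}
  (B : ∀ i, (D i).Polarisation) [TopologicalSpace F] [IsNonarchimedeanLocalField F]

/-- The tensor product of the vectors on which `B¹_i` acts by `θ̃_i` is an eigenvector of
`P ∩ K_π`. -/
theorem parabolicAction_tprod_of_mem_setK (hϖ : Irreducible ϖ) (hn : ∀ i, 0 < n i)
    (w : Equiv.Perm (Fin k)) (s : ℝ) {V : Fin k → Type v} [∀ i, AddCommGroup (V i)]
    [∀ i, Module ℂ (V i)] (σ : ∀ i, Representation ℂ (GL (Fin (n i)) F) (V i)) {φ : ∀ i, V i}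
    (hφ : ∀ i, ∀ b : (B i).B1, σ i b (φ i) = ((B i).θt b : ℂ) • φ i)
    (p : parabolic F n w) (m : ∀ i, (B i).B1) (hm : ∀ i, block (p : BlockGL F n) i i
      = ((m i : GL (Fin (n i)) F) : Matrix (Fin (n i)) (Fin (n i)) F)) :
    parabolicAction w s σ p (PiTensorProduct.tprod ℂ φ)
      = ((∏ i, (B i).θt (m i) : ℂˣ) : ℂ) • PiTensorProduct.tprod ℂ φ := by
  have h1 : leviHom F n w p = fun i => (m i : GL (Fin (n i)) F) :=
    ((hasLeviPart_iff p _).1 hm).symm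
  have h2 : modulusPow w s (leviHom F n w p) = 1 := by
    rw [h1]
    exact modulusPow_eq_one w s fun i => valuation_det_eq_one ((B i).integral hϖ (hn i) (m i).2)
      ((B i).integral hϖ (hn i) (inv_mem (m i).2))
  change ((modulusPow w s (leviHom F n w p) : ℂ) •
    PiTensorProduct.map fun i => σ i (leviHom F n w p i)) _ = _
  rw [h2, h1, Complex.ofReal_one, one_smul, PiTensorProduct.map_tprod]
  simp only [hφ]
  rw [MultilinearMap.map_smul_univ, Units.coe_prod]

end Induced

end MinimalVector

theorem mainTheorem4 {F : Type*} [Field F] [ValuativeRel F] [TopologicalSpace F]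
    [IsNonarchimedeanLocalField F] (ϖ : 𝒪[F]) (hϖ : Irreducible ϖ)
    (ψ : AddChar F Circle) (hψ : MinimalVector.IsLevelOne ψ)
    {k : ℕ} (hk : 0 < k) (n : Fin k → ℕ) (hn : ∀ i, 0 < n i)
    (w : Equiv.Perm (Fin k)) (s : ℝ)
    (D : ∀ i, MinimalVector.SupercuspidalDatum ϖ hϖ.ne_zero ψ (n i))
    {V : Fin k → Type*} [∀ i, AddCommGroup (V i)] [∀ i, Module ℂ (V i)]
    (σ : ∀ i, Representation ℂ (GL (Fin (n i)) F) (V i)) (A : ℝ)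
    (hπ : MinimalVector.HasGenericInductionDatum D σ A)
    (B : ∀ i, (D i).Polarisation) :
    ∃ (K : Subgroup (MinimalVector.BlockGL F n)) (Θ : K →* ℂˣ),
      (K : Set (MinimalVector.BlockGL F n)) = MinimalVector.setK B ∧
      IsOpen (K : Set (MinimalVector.BlockGL F n)) ∧
      IsCompact (K : Set (MinimalVector.BlockGL F n)) ∧
      (∀ (x : K) (b : ∀ i, (B i).B1),
        (∀ i, MinimalVector.block (x : MinimalVector.BlockGL F n) i i
          = ((b i : GL (Fin (n i)) F) : Matrix (Fin (n i)) (Fin (n i)) F)) →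
        Θ x = ∏ i, (B i).θt (b i)) ∧
      ∃ φ : ∀ i, V i,
        (∀ i, φ i ≠ 0 ∧ ∀ b : (B i).B1, σ i b (φ i) = ((B i).θt b : ℂ) • φ i) ∧
        ∃ φ₀ : MinimalVector.parabolicIndSpace w s σ,
          φ₀ ≠ 0 ∧
          (∀ x : K, MinimalVector.parabolicInd w s σ x φ₀ = (Θ x : ℂ) • φ₀) ∧
          (∀ g, φ₀.1 g ≠ 0 ↔ ∃ p ∈ MinimalVector.parabolic F n w, ∃ x ∈ K, g = p * x) ∧
          (∀ p ∈ MinimalVector.parabolic F n w, ∀ m, MinimalVector.HasLeviPart p m → ∀ x : K,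
            φ₀.1 (p * x) = ((MinimalVector.modulusPow w s m : ℂ) * (Θ x : ℂ)) •
              PiTensorProduct.map (fun i => σ i (m i)) (PiTensorProduct.tprod ℂ φ)) := by
  let K := MinimalVector.groupK B hϖ hψ hk hn
  obtain ⟨Θ, hΘ⟩ : ∃ Θ : K →* ℂˣ, _ := MinimalVector.exists_charK B hϖ hψ hk hn
  have htop := MinimalVector.isOpen_and_isCompact_of_integral hϖ.ne_zero K
    (fun g hg => MinimalVector.integral_of_mem_setK B hϖ hk hn hg)
    ((MinimalVector.inducedDepth D + 1 : ℕ) : ℤ)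
    (fun g hg _ => (MinimalVector.mem_setK_of_congruent B hϖ hψ hk hn hg).1)
  choose φ hφ0 hφ using fun i =>
    (D i).exists_eigenvector_of_equiv (hπ.equiv i) hϖ hψ (hn i) (B i)
  refine ⟨K, Θ, rfl, htop.1, htop.2, hΘ, φ, fun i => ⟨hφ0 i, hφ i⟩, ?_⟩
  let P := MinimalVector.parabolic F n w
  let τ := MinimalVector.parabolicAction w s σ
  let t := PiTensorProduct.tprod ℂ φ
  have ht : ∀ g (hp : g ∈ P) (hg : g ∈ K), τ ⟨g, hp⟩ t = (Θ ⟨g, hg⟩ : ℂ) • t := by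
    intro g hp hg
    obtain ⟨m, hm⟩ := MinimalVector.exists_blocks B hg
    rw [hΘ ⟨g, hg⟩ m hm]
    exact MinimalVector.parabolicAction_tprod_of_mem_setK B hϖ hn w s σ hφ ⟨g, hp⟩ m hm
  obtain ⟨f, hf, hf0⟩ := MinimalVector.exists_function_of_compatible P K τ Θ t ht
  have hfP : ∀ (p : P) g, f (p * g) = τ p (f g) := by
    intro p g
    by_cases hg : ∃ q ∈ P, ∃ x ∈ K, g = q * x
    · obtain ⟨q, hq, x, hx, rfl⟩ := hg
      have h1 := hf (p * ⟨q, hq⟩) ⟨x, hx⟩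
      have h2 := hf ⟨q, hq⟩ ⟨x, hx⟩
      rw [map_mul, Module.End.mul_apply, Subgroup.coe_mul, mul_assoc] at h1
      rw [h1, h2, map_smul]
    · rw [hf0 g hg, map_zero]
      refine hf0 _ fun ⟨q, hq, x, hx, h⟩ => hg ⟨(p : MinimalVector.BlockGL F n)⁻¹ * q,
        mul_mem (inv_mem p.2) hq, x, hx, ?_⟩
      rw [mul_assoc, ← h, inv_mul_cancel_left]
  have hfK : ∀ g (x : K), f (g * x) = (Θ x : ℂ) • f g := by
    intro g x
    by_cases hg : ∃ q ∈ P, ∃ y ∈ K, g = q * y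
    · obtain ⟨q, hq, y, hy, rfl⟩ := hg
      have h1 := hf ⟨q, hq⟩ (⟨y, hy⟩ * x)
      have h2 := hf ⟨q, hq⟩ ⟨y, hy⟩
      rw [Subgroup.coe_mul, ← mul_assoc] at h1
      rw [h1, h2, map_mul, Units.val_mul, smul_smul, mul_comm]
    · rw [hf0 g hg, smul_zero]
      refine hf0 _ fun ⟨q, hq, y, hy, h⟩ => hg ⟨q, hq, y * (x : MinimalVector.BlockGL F n)⁻¹,
        mul_mem hy (inv_mem x.2), ?_⟩
      rw [← mul_assoc, ← h, mul_inv_cancel_right]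
  have hτt : ∀ p : P, τ p t ≠ 0 := by
    intro p hp
    have h1 : τ (p⁻¹ * p) t = 0 := by rw [map_mul, Module.End.mul_apply, hp, map_zero]
    rw [inv_mul_cancel, map_one, Module.End.one_apply] at h1
    exact MinimalVector.tprod_ne_zero hφ0 h1
  have hne : ∀ (p : P) (x : K), f (p * x) ≠ 0 := fun p x => by
    rw [hf]
    exact smul_ne_zero (Θ x).ne_zero (hτt p)
  have hsmooth : MinimalVector.IsSmoothFun f := by
    -- `f` is right invariant under the kernel of `Θ`
    refine ⟨Θ.ker.map K.subtype, ?_, ?_⟩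
    · refine (MinimalVector.isOpen_and_isCompact_of_integral hϖ.ne_zero _ ?_
        ((MinimalVector.inducedDepth D + 1 : ℕ) : ℤ) ?_).1
      · rintro _ ⟨x, -, rfl⟩
        exact MinimalVector.integral_of_mem_setK B hϖ hk hn x.2
      · intro g hg _
        obtain ⟨h1, m, hm, hm1⟩ := MinimalVector.mem_setK_of_congruent B hϖ hψ hk hn hg
        refine ⟨⟨g, h1⟩, ?_, rfl⟩
        rw [SetLike.mem_coe, MonoidHom.mem_ker, hΘ ⟨g, h1⟩ m hm]
        exact Finset.prod_eq_one fun i _ => hm1 i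
    · rintro g _ ⟨x, hx, rfl⟩
      rw [SetLike.mem_coe, MonoidHom.mem_ker] at hx
      rw [Subgroup.subtype_apply, hfK, hx, Units.val_one, one_smul]
  refine ⟨⟨f, fun p hp m hm g => ?_, hsmooth⟩, fun h => ?_, fun x => ?_, fun g => ⟨fun h => ?_, ?_⟩,
    fun p hp m hm x => ?_⟩
  · rw [(MinimalVector.hasLeviPart_iff ⟨p, hp⟩ m).1 hm]
    exact hfP ⟨p, hp⟩ g
  · exact hne 1 1 (congrFun (congrArg Subtype.val h) _)
  · exact Subtype.ext (funext fun g => hfK g x)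
  · exact not_not.1 (mt (hf0 g) h)
  · rintro ⟨p, hp, x, hx, rfl⟩
    exact hne ⟨p, hp⟩ ⟨x, hx⟩
  · rw [(MinimalVector.hasLeviPart_iff ⟨p, hp⟩ m).1 hm, mul_comm, ← smul_smul]
    exact hf ⟨p, hp⟩ x
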